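/- All curves are plane curves over $\mathbb{C}$, i.e. divisors of non-zero homogeneous forms in $\mathbb{P}^2$. An $n$-fold point of a curve is a point of multiplicity $n$ at which the germ of the curve is reduced; it is ordinary (non-degenerate) if its $n$ tangent directions are pairwise distinct. A quadruple-point is a $4$-fold point. An $[n;n]$-point is an $n$-fold point $p$ such that the strict transform of the curve in the blow-up of $p$ has an $n$-fold point on the exceptional line; it is non-degenerate if this infinitely near $n$-fold point is ordinary. The infinitely near point is a tangent direction at $p$, and the line through $p$ in that direction is the distinguished tangent line of the $[n;n]$-point. A non-degenerate $[2;2]$-point is a (non-degenerate) tacnode, i.e. a singularity of type $A_3$. **Proposition.** Let $C\subset\mathbb{P}^2$ be a plane octic with three distinct $[3;3]$-points $p_1,p_2,p_3$, with distinguished tangent lines $L_1,L_2,L_3$, and with a quadruple-point $p_4$. Then $C$ is reduced and is the sum of four irreducible rational curves. More precisely, exactly one of the following two configurations occurs: 1. The lines $L_1,L_2,L_3$ meet in exactly one point, namely $p_4$, and $C = D_5+L_1+L_2+L_3$, where $D_5$ is an irreducible rational quintic which passes through $p_4$ and has an $A_3$-singularity at each of $p_1,p_2,p_3$, with distinguished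 tangent lines $L_1,L_2,L_3$, respectively. 2. After a permutation of the indices $1,2,3$: $L_1\cap L_2=\{p_4\}$ and $C = D_4+D_2+L_1+L_2$, where $D_2$ is an irreducible conic which passes through $p_1,p_2,p_3$ with tangent lines $L_1,L_2,L_3$, respectively, and $D_4$ is an irreducible rational quartic which has an ordinary double point at $p_4$, is smooth and tangent to $D_2$ at $p_1$ and at $p_2$ (with tangent lines $L_1$ and $L_2$), and has an $A_3$-singularity at $p_3$ with distinguished tangent line $L_3$. In either case, the $[3;3]$-points $p_1,p_2,p_3$ and the quadruple-point $p_4$ are non-degenerate, and $C$ has no singular points other than $p_1,p_2,p_3,p_4$. -/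

import Mathlib

noncomputable section

namespace PlaneCurve

open MvPolynomial

/-- Points of the complex projective plane `ℙ²`. -/
abbrev Point := Projectivization ℂ (Fin 3 → ℂ)

/-- Lines of `ℙ²`, as points of the dual plane: the line with coordinates `[a₀ : a₁ : a₂]` is
`a₀ x₀ + a₁ x₁ + a₂ x₂ = 0`. -/
abbrev Line := Projectivization ℂ (Fin 3 → ℂ)

/-- Forms in the homogeneous coordinates of `ℙ²`. A plane curve of degree `d` is given by a nonzero
homogeneous form of degree `d`; the form of a sum of curves is the product of the forms. -/
abbrev Form := MvPolynomial (Fin 3) ℂ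

/-- Polynomials in two affine coordinates `x = X 0`, `y = X 1`, regarded as germs at the origin. -/
abbrev Germ := MvPolynomial (Fin 2) ℂ

/-- The linear form of a line. -/
def lineForm (L : Line) : Form := ∑ i, C (L.rep i) * X i

/-- The point `p` lies on the curve `F = 0`. -/
def PassesThrough (F : Form) (p : Point) : Prop := eval p.rep F = 0

/-- `p` is a singular point of the curve `F = 0`. -/
def IsSingularAt (F : Form) (p : Point) : Prop :=
  PassesThrough F p ∧ ∀ i, eval p.rep (pderiv i F) = 0

/-- The curve `F = 0` is smooth at `p` with tangent line `L`. -/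
def IsTangentAt (F : Form) (p : Point) (L : Line) : Prop :=
  PassesThrough F p ∧ ∃ c : ℂ, c ≠ 0 ∧ ∀ i, eval p.rep (pderiv i F) = c * L.rep i

/-- The curve `F = 0` has no multiple component through `p`. This says that the germ at `p` is
reduced, i.e. that it is smooth or an isolated curve singularity. -/
def IsReducedAt (F : Form) (p : Point) : Prop :=
  ∀ G : Form, PassesThrough G p → ¬ G * G ∣ F

/-! ### Multiple points of germs -/

/-- The germ `f = 0` at the origin has multiplicity `n`. -/
def IsNFoldGerm (n : ℕ) (f : Germ) : Prop :=
  (∀ k < n, homogeneousComponent k f = 0) ∧ homogeneousComponent n f ≠ 0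

/-- The germ is an ordinary `n`-fold point: the lowest-order part of `f` is a product of `n`
pairwise non-proportional linear factors. -/
def IsOrdinaryGerm (n : ℕ) (f : Germ) : Prop :=
  IsNFoldGerm n f ∧ ∃ a b : Fin n → ℂ,
    homogeneousComponent n f = ∏ i, (C (a i) * X 0 + C (b i) * X 1) ∧
    ∀ i j, i ≠ j → a i * b j ≠ a j * b i

/-- `f'` is the strict transform of the `n`-fold germ `f` in the chart `(x, y) ↦ (x, x y)` of the
blow-up of the origin. The exceptional line is `x = 0`, and the origin of the chart is the point of
the exceptional line that corresponds to the direction of the `x`-axis. -/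
def IsStrictTransform (n : ℕ) (f f' : Germ) : Prop :=
  aeval (![X 0, X 0 * X 1] : Fin 2 → Germ) f = X 0 ^ n * f'

/-- The germ is an `n`-fold point with an infinitely near `n`-fold point in the direction of the
`x`-axis. -/
def IsInfNearGerm (n : ℕ) (f : Germ) : Prop :=
  IsNFoldGerm n f ∧ ∃ f' : Germ, IsStrictTransform n f f' ∧ IsNFoldGerm n f'

/-- As `IsInfNearGerm`, and the infinitely near `n`-fold point is ordinary. -/
def IsNondegInfNearGerm (n : ℕ) (f : Germ) : Prop :=
  IsNFoldGerm n f ∧ ∃ f' : Germ, IsStrictTransform n f f' ∧ IsOrdinaryGerm n f'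

/-! ### Multiple points of plane curves -/

/-- `(v, u, w)` is a basis of `ℂ³` whose first vector represents `p`; it gives the affine coordinates
`(x, y) ↦ [v + x u + y w]` of `ℙ²`, centred at `p`. -/
def IsFrameAt (p : Point) (v u w : Fin 3 → ℂ) : Prop :=
  v ∈ p.submodule ∧ LinearIndependent ℂ ![v, u, w]

/-- The equation `F (v + x u + y w)` of the curve `F = 0` in these affine coordinates. -/
def localEquation (F : Form) (v u w : Fin 3 → ℂ) : Germ :=
  aeval (fun i => C (v i) + C (u i) * X 0 + C (w i) * X 1 : Fin 3 → Germ) F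

/-- The frame `(v, u, w)` at `p` is such that `L` is the line through `p` in the direction `u`
(the `x`-axis of the affine coordinates). -/
def IsFrameAlong (p : Point) (L : Line) (v u w : Fin 3 → ℂ) : Prop :=
  IsFrameAt p v u w ∧ L.rep ⬝ᵥ v = 0 ∧ L.rep ⬝ᵥ u = 0

/-- `p` is an `n`-fold point of the curve `F = 0`. -/
def IsNFoldPoint (n : ℕ) (F : Form) (p : Point) : Prop :=
  IsReducedAt F p ∧ ∃ v u w, IsFrameAt p v u w ∧ IsNFoldGerm n (localEquation F v u w)

/-- `p` is an ordinary (non-degenerate) `n`-fold point of the curve `F = 0`. -/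
def IsOrdinaryPoint (n : ℕ) (F : Form) (p : Point) : Prop :=
  IsReducedAt F p ∧ ∃ v u w, IsFrameAt p v u w ∧ IsOrdinaryGerm n (localEquation F v u w)

/-- `p` is an `[n;n]`-point of the curve `F = 0`, with distinguished tangent line `L`. -/
def IsInfNearPoint (n : ℕ) (F : Form) (p : Point) (L : Line) : Prop :=
  IsReducedAt F p ∧
    ∃ v u w, IsFrameAlong p L v u w ∧ IsInfNearGerm n (localEquation F v u w)

/-- `p` is a non-degenerate `[n;n]`-point of the curve `F = 0`, with distinguished tangent line `L`.
For `n = 2` this is a non-degenerate tacnode (type `A₃`), for `n = 3` a `J₁₀`. -/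
def IsNondegInfNearPoint (n : ℕ) (F : Form) (p : Point) (L : Line) : Prop :=
  IsReducedAt F p ∧
    ∃ v u w, IsFrameAlong p L v u w ∧ IsNondegInfNearGerm n (localEquation F v u w)

/-! ### Rational curves -/

/-- The curve `F = 0` is irreducible and birational to `ℙ¹`: there is a rational map
`g = [g₀ : g₁ : g₂]` from `ℙ¹` to the curve and a rational map `h = [h₀ : h₁]` back to `ℙ¹` which is
defined on the image and satisfies `h ∘ g = id`. (As the curve is irreducible, `g` is dominant, and
then `g` and `h` are inverse to each other.) -/
def IsRationalCurve (F : Form) : Prop :=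
  Irreducible F ∧
    ∃ (d : ℕ) (g : Fin 3 → MvPolynomial (Fin 2) ℂ) (e : ℕ) (h : Fin 2 → Form),
      (∀ i, (g i).IsHomogeneous d) ∧ (∀ j, (h j).IsHomogeneous e) ∧
      aeval g F = 0 ∧
      aeval g (h 0) ≠ 0 ∧ aeval g (h 0) * X 1 = aeval g (h 1) * X 0

/-! ### The two configurations -/

/-- The three lines `L i` meet exactly in `p₄`, and the curve is their sum with a rational quintic
through `p₄` that has an `A₃` at each `p i`, with distinguished tangent line `L i`. -/
def IsQuinticConfiguration (F : Form) (p : Fin 3 → Point) (L : Fin 3 → Line) (p₄ : Point) : Prop :=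
  (∀ q : Point, (∀ i, PassesThrough (lineForm (L i)) q) ↔ q = p₄) ∧
  ∃ D₅ : Form, D₅.IsHomogeneous 5 ∧ IsRationalCurve D₅ ∧
    F = D₅ * lineForm (L 0) * lineForm (L 1) * lineForm (L 2) ∧
    PassesThrough D₅ p₄ ∧
    ∀ i, IsNondegInfNearPoint 2 D₅ (p i) (L i)

/-- The curve is the sum of the lines `L 0`, `L 1`, of a conic that is tangent to `L i` at `p i` for
all `i`, and of a rational quartic that has an ordinary double point at the intersection `p₄` of
`L 0` and `L 1`, is tangent to the conic at `p 0` and `p 1`, and has an `A₃` at `p 2` with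
distinguished tangent line `L 2`. -/
def IsConicConfiguration (F : Form) (p : Fin 3 → Point) (L : Fin 3 → Line) (p₄ : Point) : Prop :=
  (∀ q : Point, PassesThrough (lineForm (L 0)) q ∧ PassesThrough (lineForm (L 1)) q ↔ q = p₄) ∧
  ∃ D₄ D₂ : Form, D₄.IsHomogeneous 4 ∧ IsRationalCurve D₄ ∧
    D₂.IsHomogeneous 2 ∧ IsRationalCurve D₂ ∧
    F = D₄ * D₂ * lineForm (L 0) * lineForm (L 1) ∧
    (∀ i, IsTangentAt D₂ (p i) (L i)) ∧
    IsOrdinaryPoint 2 D₄ p₄ ∧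
    IsTangentAt D₄ (p 0) (L 0) ∧ IsTangentAt D₄ (p 1) (L 1) ∧
    IsNondegInfNearPoint 2 D₄ (p 2) (L 2)

end PlaneCurve

end

/-!
The singularities are measured by weighted orders: in the expansion `F (v + T x u + T ^ e y w)` at a
point `v` (`WeightedFrame`, `WeightedFrame.loc`), multiplicities are orders in `T` with `e = 1`,
and an `[n;n]`-point is a point of order `2 n` with `e = 2` and `u` along the distinguished tangent
line, at which the transverse axis meets the curve with multiplicity `n`
(`IsInfNearGerm.weighted_order`). These orders are additive, so an octic as in the statement
distributes them over its irreducible components (`FrameSystem.exists_components`): a component has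
degree `d`, weighted orders `2 a₁`, `2 a₂`, `2 a₃` at the `[3;3]`-points, and multiplicity `b` at
the quadruple point, with the sums `∑ d = 8`, `∑ aₖ = 3`, `∑ b = 4` over all components.

Two inequalities restrict these numbers. Bézout's inequality `bezout` bounds
`2 ∑ aₖ aₖ' + b b'` by `d d'` for two components (also for equal ones, since a multiple component
avoids the four points, at which the curve is reduced). It is proved by linear algebra, because the
conditions of given weighted orders are independent on forms of large degree
(`conditions_surjective`). Intersecting an irreducible curve with its adjoint curves then gives the
bound `genus_bound`, that is, `2 ∑ aₖ (aₖ - 1) + b (b - 1) ≤ (d - 1) (d - 2)`. The intersection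
number of a component with the rest of the curve is `d (8 - d)`, so the sum of both inequalities is
`4 ∑ aₖ + 3 b - 5 d ≤ 2`, while these numbers have sum `8` over all components. This leaves three
cases (`numerical_classification`): a quintic and the lines `L₁`, `L₂`, `L₃` through the quadruple
point; a quartic, a conic and two of these lines; or a conic and its three tangents `L₁`, `L₂`, `L₃`
through the quadruple point. The last case is impossible, since the three points of tangency would
be on the polar line of the quadruple point (`FrameSystem.HasType.not_concurrent`).

In the other cases the four points are in general position, so there are coordinates in which they
are the base points and the unit point (`CoordinateSystem.exists_adapted`). A component whose
self-intersection number is used up by the four points is in a pencil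
(`FrameSystem.HasType.exists_pencil`); this determines the conic, and gives the quintic and the
quartic in explicit families (`exists_quintic`, `exists_conic`, `exists_quartic`). The local claims
can be read off from the initial forms of these equations (`WeightedFrame.HasInit`), where
irreducibility excludes the degenerate parameters, and explicit parametrizations show that the
components are rational. There are no further singular points because all the numerical inequalities
are equalities (`FrameSystem.eq_of_isSingularAt`), and the two cases exclude each other by unique
factorization (`not_isConicConfiguration`).
-/

noncomputable section

namespace PlaneCurve

open MvPolynomial

/-! ### Weighted expansions at a point -/

/-- The substitution `(x, y) ↦ (T x, T ^ e y)`: the coefficient of `T ^ n` is the part of weight `n`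
of a germ, where `x` has weight `1` and `y` has weight `e`. -/
def scale (e : ℕ) : Germ →ₐ[ℂ] Polynomial Germ :=
  aeval ![Polynomial.C (X 0) * Polynomial.X, Polynomial.C (X 1) * Polynomial.X ^ e]

lemma scale_monomial (e : ℕ) (m : Fin 2 →₀ ℕ) (c : ℂ) :
    scale e (monomial m c) = Polynomial.monomial (m 0 + e * m 1) (monomial m c) := by
  rw [scale, aeval_monomial, Finsupp.prod_fintype _ _ (by simp), monomial_eq,
    Finsupp.prod_fintype _ _ (by simp), ← Polynomial.C_mul_X_pow_eq_monomial]
  simp only [Fin.prod_univ_two, Matrix.cons_val_zero, Matrix.cons_val_one, map_mul, map_pow]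
  have : (algebraMap ℂ (Polynomial Germ)) c = Polynomial.C (C c) := rfl
  rw [this]; ring

lemma coeff_scale (e : ℕ) (f : Germ) (n : ℕ) (m : Fin 2 →₀ ℕ) :
    coeff m ((scale e f).coeff n) = if m 0 + e * m 1 = n then coeff m f else 0 := by
  induction f using MvPolynomial.induction_on' with
  | monomial k c =>
    rw [scale_monomial, Polynomial.coeff_monomial]
    by_cases h : k = m
    · subst h; split_ifs <;> simp
    · split_ifs <;> simp [coeff_monomial, h]
  | add p q hp hq =>
    rw [map_add, Polynomial.coeff_add, coeff_add, hp, hq, coeff_add]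
    split_ifs <;> simp

lemma X_pow_dvd_scale {e k : ℕ} {f : Germ} :
    Polynomial.X ^ k ∣ scale e f ↔ ∀ m : Fin 2 →₀ ℕ, m 0 + e * m 1 < k → coeff m f = 0 := by
  rw [Polynomial.X_pow_dvd_iff]
  constructor
  · intro h m hm
    have := congrArg (coeff m) (h _ hm)
    rwa [coeff_scale, if_pos rfl] at this
  · intro h n hn
    ext m
    rw [coeff_scale]
    split_ifs with h1
    · rw [h m (h1 ▸ hn)]; rfl
    · rfl

lemma scale_one_coeff (f : Germ) (n : ℕ) :
    (scale 1 f).coeff n = homogeneousComponent n f := by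
  ext m
  rw [coeff_scale, coeff_homogeneousComponent, Finsupp.degree_eq_sum, Fin.sum_univ_two, one_mul]

/-- An affine frame `(v, u, w)` at the point `p`, with coordinates `x` (along `u`) of weight `1` and
`y` (along `w`) of weight `e`. Weight `e = 1` measures multiplicities; with `e = 2` a germ is of
order at least `2 a` if and only if it has multiplicity at least `a` at the origin, and its total
transform without `a` times the exceptional line has multiplicity at least `a` at the infinitely
near point in the direction of `u`. -/
structure WeightedFrame where
  /-- the point -/
  p : Point
  /-- a vector that represents the point -/
  v : Fin 3 → ℂ
  /-- the direction of weight `1` -/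
  u : Fin 3 → ℂ
  /-- the direction of weight `e` -/
  w : Fin 3 → ℂ
  /-- the weight of `w` -/
  e : ℕ
  isFrame : IsFrameAt p v u w
  e_pos : 0 < e

/-- The expansion `F (v + T x u + T ^ e y w)`, a polynomial in `T` with coefficients in
`ℂ[x, y]`. -/
def WeightedFrame.loc (A : WeightedFrame) : Form →ₐ[ℂ] Polynomial Germ :=
  (scale A.e).comp (aeval (fun i => C (A.v i) + C (A.u i) * X 0 + C (A.w i) * X 1 : Fin 3 → Germ))

lemma WeightedFrame.loc_eq (A : WeightedFrame) (F : Form) :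
    A.loc F = scale A.e (localEquation F A.v A.u A.w) := rfl

/-- The form `F` has weighted order at least `k` in the frame `A`. -/
def WeightedFrame.OrdGE (A : WeightedFrame) (k : ℕ) (F : Form) : Prop :=
  Polynomial.X ^ k ∣ A.loc F

/-- The linear form with coefficient vector `a`. -/
def linForm (a : Fin 3 → ℂ) : Form := ∑ i, C (a i) * X i

lemma lineForm_eq (L : Line) : lineForm L = linForm L.rep := rfl

lemma linForm_isHomogeneous (a : Fin 3 → ℂ) : (linForm a).IsHomogeneous 1 :=
  IsHomogeneous.sum _ _ _ fun _ _ => isHomogeneous_C_mul_X _ _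

lemma eval_linForm (a z : Fin 3 → ℂ) : eval z (linForm a) = a ⬝ᵥ z := by
  simp [linForm, dotProduct]

lemma linForm_ne_zero {a : Fin 3 → ℂ} (h : a ≠ 0) : linForm a ≠ 0 := by
  intro h0
  apply h
  ext i
  have := eval_linForm a (Pi.single i 1)
  simpa [h0] using this.symm

lemma linForm_smul (c : ℂ) (a : Fin 3 → ℂ) : linForm (c • a) = C c * linForm a := by
  simp [linForm, Finset.mul_sum, mul_assoc]

lemma linForm_add (a b : Fin 3 → ℂ) : linForm (a + b) = linForm a + linForm b := by
  simp [linForm, add_mul, Finset.sum_add_distrib]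

lemma linForm_sub (a b : Fin 3 → ℂ) : linForm (a - b) = linForm a - linForm b := by
  simp [linForm, sub_mul, Finset.sum_sub_distrib]

lemma pderiv_linForm (a : Fin 3 → ℂ) (i : Fin 3) : pderiv i (linForm a) = C (a i) := by
  simp [linForm, pderiv_X, Pi.single_apply]

lemma WeightedFrame.loc_linForm (A : WeightedFrame) (a : Fin 3 → ℂ) :
    A.loc (linForm a) = Polynomial.C (C (a ⬝ᵥ A.v)) +
      Polynomial.C (C (a ⬝ᵥ A.u) * X 0) * Polynomial.X +
      Polynomial.C (C (a ⬝ᵥ A.w) * X 1) * Polynomial.X ^ A.e := by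
  have hC : ∀ c : ℂ, scale A.e (C c) = Polynomial.C (C c) := fun c => by
    rw [← algebraMap_eq, AlgHom.commutes]; rfl
  have h0 : scale A.e (X 0) = Polynomial.C (X 0) * Polynomial.X := by simp [scale]
  have h1 : scale A.e (X 1) = Polynomial.C (X 1) * Polynomial.X ^ A.e := by simp [scale]
  have hA : ∀ c : ℂ, algebraMap ℂ (Polynomial Germ) c = Polynomial.C (C c) := fun _ => rfl
  simp only [loc_eq, localEquation, linForm, map_mul, aeval_X, algHom_C, map_add,
    dotProduct, hC, h0, h1, Fin.sum_univ_three, hA]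
  ring

lemma exists_dual {v u w : Fin 3 → ℂ} (h : LinearIndependent ℂ ![v, u, w]) :
    ∃ a b c : Fin 3 → ℂ,
      (a ⬝ᵥ v = 1 ∧ a ⬝ᵥ u = 0 ∧ a ⬝ᵥ w = 0) ∧ (b ⬝ᵥ v = 0 ∧ b ⬝ᵥ u = 1 ∧ b ⬝ᵥ w = 0) ∧
      (c ⬝ᵥ v = 0 ∧ c ⬝ᵥ u = 0 ∧ c ⬝ᵥ w = 1) ∧
      ∀ z : Fin 3 → ℂ, z = (a ⬝ᵥ z) • v + (b ⬝ᵥ z) • u + (c ⬝ᵥ z) • w := by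
  set M : Matrix (Fin 3) (Fin 3) ℂ := Matrix.of ![v, u, w] with hM
  have hu : IsUnit M := Matrix.linearIndependent_rows_iff_isUnit.mp h
  have hdet : IsUnit M.det := (Matrix.isUnit_iff_isUnit_det _).mp hu
  have h1 : M * M⁻¹ = 1 := Matrix.mul_nonsing_inv _ hdet
  have h2 : M⁻¹ * M = 1 := Matrix.nonsing_inv_mul _ hdet
  have e1 : ∀ i j, ∑ k, M i k * M⁻¹ k j = (1 : Matrix (Fin 3) (Fin 3) ℂ) i j := fun i j => by
    rw [← h1]; rfl
  have e2 : ∀ i j, ∑ k, M⁻¹ i k * M k j = (1 : Matrix (Fin 3) (Fin 3) ℂ) i j := fun i j => by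
    rw [← h2]; rfl
  have key : ∀ i j, (fun k => M⁻¹ k j) ⬝ᵥ (M i) = (1 : Matrix (Fin 3) (Fin 3) ℂ) i j := by
    intro i j
    rw [← e1]; exact Finset.sum_congr rfl fun k _ => mul_comm _ _
  refine ⟨fun k => M⁻¹ k 0, fun k => M⁻¹ k 1, fun k => M⁻¹ k 2, ⟨?_, ?_, ?_⟩, ⟨?_, ?_, ?_⟩,
    ⟨?_, ?_, ?_⟩, ?_⟩
  · exact (key 0 0).trans (by simp)
  · exact (key 1 0).trans (by simp)
  · exact (key 2 0).trans (by simp)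
  · exact (key 0 1).trans (by simp)
  · exact (key 1 1).trans (by simp)
  · exact (key 2 1).trans (by simp)
  · exact (key 0 2).trans (by simp)
  · exact (key 1 2).trans (by simp)
  · exact (key 2 2).trans (by simp)
  · intro z
    have : Matrix.vecMul (Matrix.vecMul z M⁻¹) M = z := by
      rw [Matrix.vecMul_vecMul, h2, Matrix.vecMul_one]
    ext j
    have h3 := congrFun this j
    simp only [Matrix.vecMul, dotProduct, Fin.sum_univ_three, hM] at h3
    simp only [dotProduct, Fin.sum_univ_three, Pi.add_apply, Pi.smul_apply, smul_eq_mul]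
    rw [← h3]
    simp
    ring

namespace WeightedFrame
variable (A : WeightedFrame)

lemma ordGE_zero (F : Form) : A.OrdGE 0 F := by simp [OrdGE]

lemma OrdGE.mul {A : WeightedFrame} {k l : ℕ} {F G : Form} (hF : A.OrdGE k F) (hG : A.OrdGE l G) :
    A.OrdGE (k + l) (F * G) := by
  unfold OrdGE at *
  rw [pow_add, map_mul]
  exact mul_dvd_mul hF hG

lemma OrdGE.mono {A : WeightedFrame} {k l : ℕ} {F : Form} (hF : A.OrdGE k F) (h : l ≤ k) :
    A.OrdGE l F := (pow_dvd_pow _ h).trans hF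

lemma OrdGE.dvd {A : WeightedFrame} {k : ℕ} {F G : Form} (hF : A.OrdGE k F) (h : F ∣ G) :
    A.OrdGE k G := hF.trans (map_dvd A.loc h)

lemma OrdGE.pow {A : WeightedFrame} {k : ℕ} {F : Form} (hF : A.OrdGE k F) (n : ℕ) :
    A.OrdGE (k * n) (F ^ n) := by
  unfold OrdGE at *
  rw [pow_mul, map_pow]
  exact pow_dvd_pow_of_dvd hF n

lemma OrdGE.add {A : WeightedFrame} {k : ℕ} {F G : Form} (hF : A.OrdGE k F) (hG : A.OrdGE k G) :
    A.OrdGE k (F + G) := by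
  unfold OrdGE at *
  rw [map_add]; exact dvd_add hF hG

lemma ordGE_iff (k : ℕ) (F : Form) : A.OrdGE k F ↔
    ∀ m : Fin 2 →₀ ℕ, m 0 + A.e * m 1 < k → coeff m (localEquation F A.v A.u A.w) = 0 := by
  rw [OrdGE, loc_eq, X_pow_dvd_scale]

lemma coeff_zero_loc (F : Form) : (A.loc F).coeff 0 = C (eval A.v F) := by
  have : ((Polynomial.evalRingHom (0 : Germ)).comp (A.loc : Form →+* Polynomial Germ)) =
      (C : ℂ →+* Germ).comp (eval A.v) := by
    apply MvPolynomial.ringHom_ext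
    · intro r
      have : A.loc (C r) = Polynomial.C (C r) := by
        rw [← algebraMap_eq, AlgHom.commutes]; rfl
      simp [this]
    · intro i
      have := A.loc_linForm (Pi.single i 1)
      have h2 : linForm (Pi.single i 1) = X i := by simp [linForm, Pi.single_apply]
      rw [h2] at this
      have he : A.e ≠ 0 := A.e_pos.ne'
      simp [this, he]
  have h := congrArg (fun f => f F) this
  simpa [Polynomial.coeff_zero_eq_eval_zero] using h

lemma ordGE_one_iff (F : Form) : A.OrdGE 1 F ↔ eval A.v F = 0 := by
  rw [OrdGE, pow_one, Polynomial.X_dvd_iff, coeff_zero_loc, C_eq_zero]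

lemma v_ne_zero : A.v ≠ 0 := A.isFrame.2.ne_zero 0

lemma mk_v : Projectivization.mk ℂ A.v A.v_ne_zero = A.p := by
  have h := A.isFrame.1
  rw [Projectivization.submodule_eq, Submodule.mem_span_singleton] at h
  obtain ⟨c, hc⟩ := h
  rw [← A.p.mk_rep, Projectivization.mk_eq_mk_iff']
  exact ⟨c, hc⟩

lemma exists_sep {A B : WeightedFrame} (h : A.p ≠ B.p) :
    ∃ a : Fin 3 → ℂ, a ⬝ᵥ A.v = 0 ∧ a ⬝ᵥ B.v ≠ 0 := by
  obtain ⟨a, b, c, ha, hb, hc, hz⟩ := exists_dual A.isFrame.2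
  by_contra! hcon
  have h1 := hcon b hb.1
  have h2 := hcon c hc.1
  apply h
  rw [← A.mk_v, ← B.mk_v, eq_comm, Projectivization.mk_eq_mk_iff']
  refine ⟨a ⬝ᵥ B.v, ?_⟩
  conv_rhs => rw [hz B.v, h1, h2]
  simp

end WeightedFrame

/-! ### Bézout's inequality for weighted orders -/

lemma finrank_homogeneousSubmodule (n : ℕ) :
    2 * Module.finrank ℂ (homogeneousSubmodule (Fin 3) ℂ n) = (n + 1) * (n + 2) := by
  have hs : ({d | d.degree = n} : Set (Fin 3 →₀ ℕ)) =
      ((Finset.univ : Finset (Fin 3)).finsuppAntidiag n : Set (Fin 3 →₀ ℕ)) := by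
    ext d
    simp [Finset.mem_finsuppAntidiag, Finsupp.degree_eq_sum]
  rw [homogeneousSubmodule_eq_finsupp_supported, hs,
    (AddMonoidAlgebra.supportedEquivFinsupp _).finrank_eq, Module.finrank_finsupp_self,
    ← Nat.card_eq_fintype_card, Nat.card_eq_card_toFinset, Finset.toFinset_coe,
    Finset.card_finsuppAntidiag_nat_eq_choose]
  have h : (Finset.univ : Finset (Fin 3)).card + n - 1 = n + 2 := by simp; omega
  have h2 : (n + 2).choose n = (n + 2).choose 2 := by
    rw [← Nat.choose_symm (by omega)]; congr 1; omega
  rw [h, h2, Nat.choose_two_right, mul_comm, Nat.div_mul_cancel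
    (by simpa using (Nat.even_mul_pred_self (n + 2)).two_dvd)]
  have : n + 2 - 1 = n + 1 := rfl
  rw [this, mul_comm]

instance (n : ℕ) : FiniteDimensional ℂ (homogeneousSubmodule (Fin 3) ℂ n) :=
  Module.Finite.iff_fg.mpr (homogeneousSubmodule_fg _ _ n)

section LinearAlgebra
variable {V W W' : Type*} [AddCommGroup V] [Module ℂ V] [AddCommGroup W] [Module ℂ W]
  [AddCommGroup W'] [Module ℂ W']

lemma finrank_map_add_finrank_ker (f : V →ₗ[ℂ] W) (S : Submodule ℂ V) [FiniteDimensional ℂ S] :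
    Module.finrank ℂ (S.map f) + Module.finrank ℂ (LinearMap.ker (f.domRestrict S)) =
      Module.finrank ℂ S := by
  rw [← (f.domRestrict S).finrank_range_add_finrank_ker, LinearMap.range_domRestrict]

/-- The codimension of a subspace does not grow under a linear map. -/
lemma finrank_map_add_le (f : V →ₗ[ℂ] W) {S T : Submodule ℂ V} [FiniteDimensional ℂ S]
    (h : T ≤ S) :
    Module.finrank ℂ (S.map f) + Module.finrank ℂ T ≤
      Module.finrank ℂ (T.map f) + Module.finrank ℂ S := by
  have : FiniteDimensional ℂ T := Submodule.finiteDimensional_of_le h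
  have h1 := finrank_map_add_finrank_ker f S
  have h2 := finrank_map_add_finrank_ker f T
  have h3 : Module.finrank ℂ (LinearMap.ker (f.domRestrict T)) ≤
      Module.finrank ℂ (LinearMap.ker (f.domRestrict S)) := by
    let g : LinearMap.ker (f.domRestrict T) →ₗ[ℂ] LinearMap.ker (f.domRestrict S) :=
      ((Submodule.inclusion h).domRestrict _).codRestrict _ fun x => by
        have := x.2
        rw [LinearMap.mem_ker] at this ⊢
        exact this
    refine LinearMap.finrank_le_finrank_of_injective (f := g) fun x y hxy => ?_
    have := congrArg (fun z => (z.1.1 : V)) hxy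
    exact Subtype.ext (Subtype.ext this)
  omega

lemma finrank_map_le_of_ker_le (f : V →ₗ[ℂ] W) (g : V →ₗ[ℂ] W') [FiniteDimensional ℂ W']
    (S : Submodule ℂ V) [FiniteDimensional ℂ S] (h : ∀ x, g x = 0 → f x = 0) :
    Module.finrank ℂ (S.map f) ≤ Module.finrank ℂ W' := by
  have h1 := finrank_map_add_finrank_ker f S
  have h2 := finrank_map_add_finrank_ker g S
  have h3 : Module.finrank ℂ (LinearMap.ker (g.domRestrict S)) ≤
      Module.finrank ℂ (LinearMap.ker (f.domRestrict S)) :=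
    Submodule.finrank_mono fun x hx => h _ hx
  have h4 := Submodule.finrank_le (S.map g)
  omega

end LinearAlgebra

/-- Index set for the monomials `x ^ i y ^ j` with `i + e j < e m`. -/
abbrev LowMonomial (e m : ℕ) : Type := Σ j : Fin m, Fin (e * (m - j))

/-- The exponent of a monomial of weight less than `e m`. -/
def LowMonomial.toFinsupp {e m : ℕ} (c : LowMonomial e m) : Fin 2 →₀ ℕ :=
  Finsupp.single 0 (c.2 : ℕ) + Finsupp.single 1 (c.1 : ℕ)

lemma LowMonomial.toFinsupp_zero {e m : ℕ} (c : LowMonomial e m) :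
    c.toFinsupp 0 = (c.2 : ℕ) := by simp [toFinsupp]

lemma LowMonomial.toFinsupp_one {e m : ℕ} (c : LowMonomial e m) :
    c.toFinsupp 1 = (c.1 : ℕ) := by simp [toFinsupp]

lemma LowMonomial.toFinsupp_injective {e m : ℕ} :
    Function.Injective (LowMonomial.toFinsupp : LowMonomial e m → _) := by
  rintro ⟨j, i⟩ ⟨j', i'⟩ h
  have h0 := DFunLike.congr_fun h 0
  have h1 := DFunLike.congr_fun h 1
  rw [toFinsupp_zero, toFinsupp_zero] at h0
  rw [toFinsupp_one, toFinsupp_one] at h1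
  have : j = j' := Fin.ext h1
  subst this
  exact congrArg _ (Fin.ext h0)

lemma LowMonomial.weight_lt {e m : ℕ} (c : LowMonomial e m) :
    c.toFinsupp 0 + e * c.toFinsupp 1 < e * m := by
  rw [toFinsupp_zero, toFinsupp_one]
  have h1 := c.2.2
  have h2 := c.1.2
  have : e * (m - c.1) + e * c.1 = e * m := by rw [← mul_add, Nat.sub_add_cancel h2.le]
  omega

lemma exists_lowMonomial {e m : ℕ} {k : Fin 2 →₀ ℕ} (h : k 0 + e * k 1 < e * m) :
    ∃ c : LowMonomial e m, c.toFinsupp = k := by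
  have h1 : k 1 < m := by
    by_contra! hc
    have := Nat.mul_le_mul_left e hc
    omega
  have h0 : k 0 < e * (m - k 1) := by
    have : e * (m - k 1) + e * k 1 = e * m := by rw [← mul_add, Nat.sub_add_cancel h1.le]
    omega
  refine ⟨⟨⟨k 1, h1⟩, ⟨k 0, h0⟩⟩, ?_⟩
  ext i
  fin_cases i
  · exact LowMonomial.toFinsupp_zero _
  · exact LowMonomial.toFinsupp_one _

lemma card_lowMonomial (e m : ℕ) : 2 * Fintype.card (LowMonomial e m) = e * (m * (m + 1)) := by
  rw [Fintype.card_sigma]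
  simp only [Fintype.card_fin]
  rw [← Finset.mul_sum, Fin.sum_univ_eq_sum_range (fun j => m - j)]
  have : ∑ j ∈ Finset.range m, (m - j) = ∑ j ∈ Finset.range (m + 1), j := by
    rw [Finset.sum_range_succ', ← Finset.sum_range_reflect]
    simp only [add_zero]
    refine Finset.sum_congr rfl fun j hj => ?_
    have := Finset.mem_range.mp hj
    omega
  rw [this, mul_left_comm, mul_comm 2, Finset.sum_range_id_mul_two]
  simp [mul_comm]

variable {ι : Type*}

/-- The conditions for a form to have weighted order at least `e m` at finitely many points, as a
linear map: the low coefficients of the local equations. -/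
def conditions (A : ι → WeightedFrame) (m : ι → ℕ) :
    Form →ₗ[ℂ] ((Σ t, LowMonomial (A t).e (m t)) → ℂ) :=
  LinearMap.pi fun c => (lcoeff ℂ c.2.toFinsupp).comp
    (aeval (fun i => C ((A c.1).v i) + C ((A c.1).u i) * X 0 + C ((A c.1).w i) * X 1 :
      Fin 3 → Germ)).toLinearMap

lemma conditions_eq_zero_iff {A : ι → WeightedFrame} {m : ι → ℕ} {F : Form} :
    conditions A m F = 0 ↔ ∀ t, (A t).OrdGE ((A t).e * m t) F := by
  constructor
  · intro h t
    rw [WeightedFrame.ordGE_iff]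
    intro k hk
    obtain ⟨c, rfl⟩ := exists_lowMonomial hk
    exact congrFun h ⟨t, c⟩
  · intro h
    ext ⟨t, c⟩
    exact ((A t).ordGE_iff _ _).mp (h t) _ c.weight_lt

variable [Fintype ι]

lemma two_mul_card_conditions (A : ι → WeightedFrame) (m : ι → ℕ) :
    2 * Module.finrank ℂ ((Σ t, LowMonomial (A t).e (m t)) → ℂ) =
      ∑ t, (A t).e * (m t * (m t + 1)) := by
  rw [Module.finrank_fintype_fun_eq_card, Fintype.card_sigma, Finset.mul_sum]
  exact Finset.sum_congr rfl fun t _ => card_lowMonomial _ _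

/-- A product of powers of lines through the other points that avoids the given point. -/
lemma exists_separating [DecidableEq ι] {A : ι → WeightedFrame}
    (hA : Function.Injective fun t => (A t).p) (k : ι → ℕ) (t : ι) :
    ∃ (N : ℕ) (G : Form), G.IsHomogeneous N ∧ eval (A t).v G ≠ 0 ∧
      ∀ s, s ≠ t → (A s).OrdGE (k s) G := by
  have hs : ∀ s : ι, ∃ a : Fin 3 → ℂ, s ≠ t → a ⬝ᵥ (A s).v = 0 ∧ a ⬝ᵥ (A t).v ≠ 0 := by
    intro s
    by_cases h : s = t
    · exact ⟨0, fun h' => absurd h h'⟩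
    · obtain ⟨a, ha⟩ := WeightedFrame.exists_sep (A := A s) (B := A t) (fun h' => h (hA h'))
      exact ⟨a, fun _ => ha⟩
  choose a ha using hs
  refine ⟨_, ∏ s ∈ Finset.univ.erase t, linForm (a s) ^ k s,
    IsHomogeneous.prod _ _ _ fun s _ => (linForm_isHomogeneous (a s)).pow (k s), ?_, ?_⟩
  · rw [map_prod, Finset.prod_ne_zero_iff]
    intro s hs
    rw [map_pow, eval_linForm]
    exact pow_ne_zero _ (ha s (Finset.ne_of_mem_erase hs)).2
  · intro s hs
    have h1 : (A s).OrdGE 1 (linForm (a s)) := by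
      rw [WeightedFrame.ordGE_one_iff, eval_linForm]; exact (ha s hs).1
    have := h1.pow (k s)
    rw [one_mul] at this
    exact this.dvd (Finset.dvd_prod_of_mem _ (Finset.mem_erase.mpr ⟨hs, Finset.mem_univ _⟩))

/-- The conditions at distinct points are independent on forms of large degree. -/
lemma conditions_surjective {A : ι → WeightedFrame}
    (hA : Function.Injective fun t => (A t).p) (m : ι → ℕ) :
    ∃ n₀, ∀ n, n₀ ≤ n → (homogeneousSubmodule (Fin 3) ℂ n).map (conditions A m) = ⊤ := by
  classical
  choose N G hG hGt hGs using exists_separating hA fun t => (A t).e * m t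
  choose a b c ha hb hc _ using fun t => exists_dual (A t).isFrame.2
  refine ⟨∑ t, (N t + (A t).e * m t + m t), fun n hn => ?_⟩
  have hle : ∀ (t : ι) (x : LowMonomial (A t).e (m t)),
      N t + (x.toFinsupp 0 + x.toFinsupp 1) ≤ n := by
    intro t x
    have h1 := Finset.single_le_sum (f := fun t => N t + (A t).e * m t + m t)
      (fun _ _ => Nat.zero_le _) (Finset.mem_univ t)
    have h2 := x.weight_lt
    have h3 : x.toFinsupp 1 < m t := by rw [x.toFinsupp_one]; exact x.1.2
    omega
  -- a form whose local equation at its own point is a unit times the given monomial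
  let M : (Σ t, LowMonomial (A t).e (m t)) → Form := fun x =>
    G x.1 * (linForm (a x.1) ^ (n - (N x.1 + (x.2.toFinsupp 0 + x.2.toFinsupp 1))) *
      (linForm (b x.1) ^ x.2.toFinsupp 0 * linForm (c x.1) ^ x.2.toFinsupp 1))
  have hMh : ∀ x, (M x).IsHomogeneous n := by
    intro x
    have := (hG x.1).mul (((linForm_isHomogeneous (a x.1)).pow
      (n - (N x.1 + (x.2.toFinsupp 0 + x.2.toFinsupp 1)))).mul
      (((linForm_isHomogeneous (b x.1)).pow (x.2.toFinsupp 0)).mul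
        ((linForm_isHomogeneous (c x.1)).pow (x.2.toFinsupp 1))))
    convert this using 1
    have := hle x.1 x.2
    omega
  have hMloc : ∀ x, (A x.1).loc (M x) =
      (A x.1).loc (G x.1) * scale (A x.1).e (monomial x.2.toFinsupp 1) := by
    intro x
    simp only [M, map_mul, map_pow, WeightedFrame.loc_linForm, ha, hb, hc]
    rw [scale_monomial, ← Polynomial.C_mul_X_pow_eq_monomial, monomial_eq,
      Finsupp.prod_fintype _ _ (by simp)]
    simp only [Fin.prod_univ_two, map_zero, zero_mul, add_zero, map_one, one_pow, one_mul,
      zero_add, map_mul, map_pow]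
    ring
  -- combinations of these forms are determined by the values of the conditions
  let T := Fintype.linearCombination ℂ M
  have hinj : Function.Injective (conditions A m ∘ₗ T) := by
    rw [← LinearMap.ker_eq_bot, LinearMap.ker_eq_bot']
    intro y hy
    have hord := conditions_eq_zero_iff.mp hy
    ext ⟨t, x⟩
    have h1 := hord t
    have hT : T y = ∑ x, y ⟨t, x⟩ • M ⟨t, x⟩ +
        ∑ s ∈ Finset.univ.erase t, ∑ x, y ⟨s, x⟩ • M ⟨s, x⟩ := by
      rw [Fintype.linearCombination_apply, Fintype.sum_sigma]
      exact (Finset.add_sum_erase _ (fun s => ∑ x, y ⟨s, x⟩ • M ⟨s, x⟩) (Finset.mem_univ t)).symm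
    have h2 : Polynomial.X ^ ((A t).e * m t) ∣ (A t).loc
        (∑ s ∈ Finset.univ.erase t, ∑ x, y ⟨s, x⟩ • M ⟨s, x⟩) := by
      rw [map_sum]
      refine Finset.dvd_sum fun s hs => ?_
      rw [map_sum]
      refine Finset.dvd_sum fun x _ => ?_
      rw [map_smul]
      exact dvd_smul_of_dvd _ ((hGs s t (Finset.ne_of_mem_erase hs).symm).dvd (dvd_mul_right _ _))
    have h3 : Polynomial.X ^ ((A t).e * m t) ∣ (A t).loc (∑ x, y ⟨t, x⟩ • M ⟨t, x⟩) := by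
      have h4 : Polynomial.X ^ ((A t).e * m t) ∣ (A t).loc (T y) := h1
      rw [hT, map_add] at h4
      exact (dvd_add_left h2).mp h4
    have h5 : (A t).loc (∑ x, y ⟨t, x⟩ • M ⟨t, x⟩) =
        (A t).loc (G t) * scale (A t).e (∑ x, monomial (LowMonomial.toFinsupp x) (y ⟨t, x⟩)) := by
      rw [map_sum, map_sum, Finset.mul_sum]
      refine Finset.sum_congr rfl fun x _ => ?_
      rw [map_smul, hMloc ⟨t, x⟩, ← mul_smul_comm, ← map_smul, smul_monomial, smul_eq_mul, mul_one]
    rw [h5] at h3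
    have h6 : ¬ Polynomial.X ∣ (A t).loc (G t) := by
      rw [Polynomial.X_dvd_iff, WeightedFrame.coeff_zero_loc, C_eq_zero]
      exact hGt t
    have h7 := X_pow_dvd_scale.mp (Polynomial.prime_X.pow_dvd_of_dvd_mul_left _ h6 h3) _ x.weight_lt
    rw [coeff_sum] at h7
    simpa [coeff_monomial, LowMonomial.toFinsupp_injective.eq_iff] using h7
  have hsurj := LinearMap.surjective_of_injective hinj
  rw [eq_top_iff]
  intro y _
  obtain ⟨z, hz⟩ := hsurj y
  refine ⟨T z, ?_, hz⟩
  rw [Fintype.linearCombination_apply]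
  exact Submodule.sum_mem _ fun x _ => Submodule.smul_mem _ _ (hMh x)

/-- The cofactor of a form in a form is a form. -/
lemma _root_.MvPolynomial.IsHomogeneous.of_mul {G M : Form} {d k : ℕ} (hG : G.IsHomogeneous d)
    (hG0 : G ≠ 0) (h : (G * M).IsHomogeneous (d + k)) : M.IsHomogeneous k := by
  have hcomp : G * homogeneousComponent k M = G * M := by
    have h1 : ∀ j, homogeneousComponent (d + j) (G * M) = G * homogeneousComponent j M := by
      intro j
      conv_lhs => rw [← sum_homogeneousComponent M, Finset.mul_sum, map_sum]
      rw [Finset.sum_congr rfl fun i _ => homogeneousComponent_of_mem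
        (hG.mul (homogeneousComponent_isHomogeneous i M))]
      simp only [add_right_inj, Finset.sum_ite_eq, Finset.mem_range]
      split_ifs with h
      · rfl
      · rw [homogeneousComponent_eq_zero _ _ (by omega), mul_zero]
    rw [← h1 k, homogeneousComponent_of_mem h, if_pos rfl]
  have := mul_left_cancel₀ hG0 hcomp
  rw [← this]
  exact homogeneousComponent_isHomogeneous k M

lemma finrank_map_mul {F : Form} (hF : F ≠ 0) (S : Submodule ℂ Form) :
    Module.finrank ℂ (S.map (LinearMap.mulLeft ℂ F)) = Module.finrank ℂ S :=
  (Submodule.equivMapOfInjective _ (mul_right_injective₀ hF) S).finrank_eq.symm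

/-- Two curves without common component, with weighted orders at least `e m` and `e n` at points
with weights `(1, e)`, have intersection number at least `e m n` at each of them; the total is
bounded by the product of the degrees.

The forms `H F + K G` of large degree have codimension `d d'` by the exactness of the Koszul
complex. The conditions of order `e (m + n)` are independent, but they impose on multiples of `F`
only as many conditions as those of order `e n` impose on the cofactor, and similarly for `G`; so
these forms satisfy at least `∑ e m n` linear relations. -/
theorem bezout {A : ι → WeightedFrame} (hA : Function.Injective fun t => (A t).p)
    (m n : ι → ℕ) {F G : Form} {d d' : ℕ} (hF : F.IsHomogeneous d) (hG : G.IsHomogeneous d')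
    (hF0 : F ≠ 0) (hG0 : G ≠ 0) (hFG : IsRelPrime F G)
    (hm : ∀ t, (A t).OrdGE ((A t).e * m t) F) (hn : ∀ t, (A t).OrdGE ((A t).e * n t) G) :
    ∑ t, (A t).e * (m t * n t) ≤ d * d' := by
  obtain ⟨k, hk⟩ := conditions_surjective hA (m + n)
  specialize hk (k + d + d') (by omega)
  set S := homogeneousSubmodule (Fin 3) ℂ with hS
  set Φ := conditions A (m + n) with hΦ
  set U := (S (k + d')).map (LinearMap.mulLeft ℂ F) with hU
  set V := (S (k + d)).map (LinearMap.mulLeft ℂ G) with hV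
  have hUS : U ≤ S (k + d + d') := by
    rintro _ ⟨H, hH, rfl⟩
    have := hF.mul hH
    rw [show d + (k + d') = k + d + d' by omega] at this
    exact this
  have hVS : V ≤ S (k + d + d') := by
    rintro _ ⟨H, hH, rfl⟩
    have := hG.mul hH
    rw [show d' + (k + d) = k + d + d' by omega] at this
    exact this
  have hfU : FiniteDimensional ℂ U := Submodule.finiteDimensional_of_le hUS
  have hfV : FiniteDimensional ℂ V := Submodule.finiteDimensional_of_le hVS
  -- exactness of the Koszul complex of the coprime forms `F`, `G`
  have hUV : U ⊓ V ≤ (S k).map (LinearMap.mulLeft ℂ (F * G)) := by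
    rintro _ ⟨⟨H, hH, rfl⟩, ⟨K, hK, hKH⟩⟩
    simp only [LinearMap.mulLeft_apply] at hKH ⊢
    by_cases h0 : H = 0
    · exact ⟨0, Submodule.zero_mem _, by simp [h0]⟩
    obtain ⟨M, rfl⟩ : G ∣ H := hFG.symm.dvd_of_dvd_mul_left ⟨K, hKH.symm⟩
    refine ⟨M, ?_, by simp⟩
    refine hG.of_mul hG0 ?_
    rwa [show d' + k = k + d' by omega]
  have hdim := Submodule.finrank_sup_add_finrank_inf_eq U V
  have h1 : Module.finrank ℂ U = Module.finrank ℂ (S (k + d')) := finrank_map_mul hF0 _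
  have h2 : Module.finrank ℂ V = Module.finrank ℂ (S (k + d)) := finrank_map_mul hG0 _
  have h3 : Module.finrank ℂ (U ⊓ V : Submodule ℂ Form) ≤ Module.finrank ℂ (S k) := by
    have := Submodule.finrank_mono hUV
    rwa [finrank_map_mul (mul_ne_zero hF0 hG0)] at this
  have h4 := finrank_map_add_le Φ (sup_le hUS hVS)
  rw [hk, finrank_top, Submodule.map_sup] at h4
  have h5 := Submodule.finrank_add_le_finrank_add_finrank (U.map Φ) (V.map Φ)
  have h6 : Module.finrank ℂ (U.map Φ) ≤
      Module.finrank ℂ ((Σ t, LowMonomial (A t).e (n t)) → ℂ) := by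
    rw [hU, ← Submodule.map_comp]
    refine finrank_map_le_of_ker_le _ (conditions A n) _ fun H hH => ?_
    rw [conditions_eq_zero_iff] at hH
    refine conditions_eq_zero_iff.mpr fun t => ?_
    rw [Pi.add_apply, mul_add]
    exact (hm t).mul (hH t)
  have h7 : Module.finrank ℂ (V.map Φ) ≤
      Module.finrank ℂ ((Σ t, LowMonomial (A t).e (m t)) → ℂ) := by
    rw [hV, ← Submodule.map_comp]
    refine finrank_map_le_of_ker_le _ (conditions A m) _ fun H hH => ?_
    rw [conditions_eq_zero_iff] at hH
    refine conditions_eq_zero_iff.mpr fun t => ?_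
    rw [Pi.add_apply, add_comm, mul_add]
    exact (hn t).mul (hH t)
  have c1 := two_mul_card_conditions A (m + n)
  have c2 := two_mul_card_conditions A m
  have c3 := two_mul_card_conditions A n
  have c4 : ∑ t, (A t).e * ((m + n) t * ((m + n) t + 1)) = ∑ t, (A t).e * (m t * (m t + 1)) +
      ∑ t, (A t).e * (n t * (n t + 1)) + 2 * ∑ t, (A t).e * (m t * n t) := by
    rw [Finset.mul_sum, ← Finset.sum_add_distrib, ← Finset.sum_add_distrib]
    refine Finset.sum_congr rfl fun t _ => ?_
    simp only [Pi.add_apply]; ring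
  have s0 := finrank_homogeneousSubmodule k
  have s1 := finrank_homogeneousSubmodule (k + d)
  have s2 := finrank_homogeneousSubmodule (k + d')
  have s3 := finrank_homogeneousSubmodule (k + d + d')
  rw [← hS] at s0 s1 s2 s3
  nlinarith

/-! ### Points of a curve -/

lemma aeval_mul_of_isHomogeneous {σ S : Type*} [Fintype σ] [CommRing S] [Algebra ℂ S]
    {F : MvPolynomial σ ℂ} {d : ℕ} (hF : F.IsHomogeneous d) (c : S) (g : σ → S) :
    aeval (fun i => c * g i) F = c ^ d * aeval g F := by
  rw [aeval_def, aeval_def, eval₂_eq', eval₂_eq', Finset.mul_sum]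
  refine Finset.sum_congr rfl fun m hm => ?_
  simp only [mul_pow, Finset.prod_mul_distrib, Finset.prod_pow_eq_pow_sum]
  have : ∑ i, m i = d := by
    rw [← Finsupp.degree_eq_sum]; exact (hF.degree_eq_sum_deg_support hm).symm
  rw [this]
  ring

lemma eval_smul_of_isHomogeneous {F : Form} {d : ℕ} (hF : F.IsHomogeneous d) (c : ℂ)
    (z : Fin 3 → ℂ) : eval (c • z) F = c ^ d * eval z F := by
  have := aeval_mul_of_isHomogeneous hF c z
  rw [← coe_aeval_eq_eval, ← coe_aeval_eq_eval]
  exact this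

lemma WeightedFrame.exists_smul_rep (A : WeightedFrame) : ∃ c : ℂ, c ≠ 0 ∧ A.v = c • A.p.rep := by
  have h := A.isFrame.1
  rw [Projectivization.submodule_eq, Submodule.mem_span_singleton] at h
  obtain ⟨c, hc⟩ := h
  refine ⟨c, ?_, hc.symm⟩
  rintro rfl
  exact A.v_ne_zero (by rw [← hc, zero_smul])

lemma WeightedFrame.passesThrough_iff (A : WeightedFrame) {F : Form} {d : ℕ}
    (hF : F.IsHomogeneous d) : PassesThrough F A.p ↔ A.OrdGE 1 F := by
  obtain ⟨c, hc, hv⟩ := A.exists_smul_rep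
  rw [ordGE_one_iff, hv, eval_smul_of_isHomogeneous hF, PassesThrough]
  simp [hc]

lemma passesThrough_mk {z : Fin 3 → ℂ} (hz : z ≠ 0) {F : Form} {d : ℕ}
    (hF : F.IsHomogeneous d) (h : eval z F = 0) :
    PassesThrough F (Projectivization.mk ℂ z hz) := by
  obtain ⟨a, ha⟩ := Projectivization.exists_smul_eq_mk_rep ℂ z hz
  rw [PassesThrough, ← ha, Units.smul_def, eval_smul_of_isHomogeneous hF, h, mul_zero]

lemma exists_basis_extension {v : Fin 3 → ℂ} (hv : v ≠ 0) :
    ∃ u w, LinearIndependent ℂ ![v, u, w] := by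
  have h1 : LinearIndependent ℂ ![v] := LinearIndependent.of_subsingleton (0 : Fin 1) hv
  obtain ⟨u, hu⟩ := exists_linearIndependent_cons_of_lt_finrank h1 (by simp)
  obtain ⟨w, hw⟩ := exists_linearIndependent_cons_of_lt_finrank hu (by simp)
  refine ⟨u, w, ?_⟩
  have := hw.comp ![2, 1, 0] (by decide)
  have h2 : (Fin.cons w (Fin.cons u ![v]) : Fin 3 → Fin 3 → ℂ) ∘ ![2, 1, 0] = ![v, u, w] := by
    ext i j
    fin_cases i <;> rfl
  rwa [h2] at this

lemma exists_frame (q : Point) : ∃ A : WeightedFrame, A.p = q ∧ A.e = 1 := by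
  obtain ⟨u, w, h⟩ := exists_basis_extension q.rep_nonzero
  exact ⟨⟨q, q.rep, u, w, 1, ⟨by
    rw [Projectivization.submodule_eq]; exact Submodule.mem_span_singleton_self _, h⟩,
    one_pos⟩, rfl, rfl⟩

/-- A line through a point `o` off the curve meets the curve. -/
lemma exists_root_on_line {D : Form} {d : ℕ} (hd : d ≠ 0) (hD : D.IsHomogeneous d)
    {o : Fin 3 → ℂ} (ho : eval o D ≠ 0) (r : Fin 3 → ℂ) : ∃ t : ℂ, eval (r + t • o) D = 0 := by
  have hev : ∀ (a b : Fin 3 → ℂ) (t : ℂ), Polynomial.eval t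
      (aeval (fun i => Polynomial.C (a i) + Polynomial.C (b i) * Polynomial.X) D) =
      eval (a + t • b) D := by
    intro a b t
    rw [← Polynomial.coe_evalRingHom, map_aeval]
    exact eval₂Hom_congr (RingHom.ext fun c => by simp) (funext fun i => by
      simp only [Polynomial.coe_evalRingHom, Polynomial.eval_add, Polynomial.eval_mul,
        Polynomial.eval_C, Polynomial.eval_X, Pi.add_apply, Pi.smul_apply, smul_eq_mul]
      ring) rfl
  set P : Polynomial ℂ := aeval (fun i => Polynomial.C (r i) + Polynomial.C (o i) * Polynomial.X) D
  by_cases hP : P.degree = 0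
  · -- a constant restriction would make `D` vanish at `o`, the point at infinity of the line
    exfalso
    obtain ⟨c, hc⟩ : ∃ c, P = Polynomial.C c := ⟨_, Polynomial.eq_C_of_degree_eq_zero hP⟩
    set Q : Polynomial ℂ :=
      aeval (fun i => Polynomial.C (o i) + Polynomial.C (r i) * Polynomial.X) D -
        Polynomial.C c * Polynomial.X ^ d with hQ
    have hQ0 : ∀ s : ℂ, s ≠ 0 → Q.IsRoot s := by
      intro s hs
      have h1 := hev r o s⁻¹
      rw [show (aeval (fun i => Polynomial.C (r i) + Polynomial.C (o i) * Polynomial.X)) D =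
        Polynomial.C c from hc, Polynomial.eval_C] at h1
      have h2 : o + s • r = s • (r + s⁻¹ • o) := by
        rw [smul_add, smul_smul, mul_inv_cancel₀ hs, one_smul, add_comm]
      rw [Polynomial.IsRoot, hQ, Polynomial.eval_sub, hev, h2, eval_smul_of_isHomogeneous hD, ← h1]
      simp only [Polynomial.eval_mul, Polynomial.eval_C, Polynomial.eval_pow, Polynomial.eval_X]
      ring
    have hQz : Q = 0 := by
      refine Polynomial.eq_zero_of_infinite_isRoot _ (Set.Infinite.mono (s := {s : ℂ | s ≠ 0})
        (fun s hs => hQ0 s hs) ?_)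
      exact (Set.finite_singleton (0 : ℂ)).infinite_compl
    apply ho
    have h0 : Polynomial.eval 0 Q = 0 := by rw [hQz, Polynomial.eval_zero]
    rwa [hQ, Polynomial.eval_sub, hev, Polynomial.eval_mul, Polynomial.eval_pow, Polynomial.eval_X,
      zero_pow hd, mul_zero, sub_zero, zero_smul, add_zero] at h0
  · obtain ⟨t, ht⟩ := IsAlgClosed.exists_root P hP
    exact ⟨t, by rw [← hev]; exact ht⟩

lemma infinite_points {D : Form} {d : ℕ} (hd : d ≠ 0) (hD : D.IsHomogeneous d) (h0 : D ≠ 0) :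
    {q : Point | PassesThrough D q}.Infinite := by
  obtain ⟨o, ho⟩ : ∃ o, eval o D ≠ 0 := by
    by_contra! h
    exact h0 (hD.eq_zero_of_forall_eval_eq_zero h)
  have ho0 : o ≠ 0 := by
    rintro rfl
    apply ho
    have := eval_smul_of_isHomogeneous hD 0 0
    rwa [zero_smul, zero_pow hd, zero_mul] at this
  obtain ⟨u, w, hind⟩ := exists_basis_extension ho0
  obtain ⟨a, b, c, ha, hb, hc, _⟩ := exists_dual hind
  choose t ht using fun s : ℂ => exists_root_on_line hd hD ho (u + s • w)
  have hb1 : ∀ s, b ⬝ᵥ (u + s • w + t s • o) = 1 := fun s => by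
    simp [dotProduct_add, hb.1, hb.2.1, hb.2.2]
  have hc1 : ∀ s, c ⬝ᵥ (u + s • w + t s • o) = s := fun s => by
    simp [dotProduct_add, hc.1, hc.2.1, hc.2.2]
  have hne : ∀ s, u + s • w + t s • o ≠ 0 := fun s h => by
    have := hb1 s
    rw [h] at this
    simp at this
  refine Set.infinite_of_injective_forall_mem
    (f := fun s => Projectivization.mk ℂ (u + s • w + t s • o) (hne s)) ?_
    fun s => passesThrough_mk _ hD (ht s)
  intro s s' h
  obtain ⟨k, hk⟩ := (Projectivization.mk_eq_mk_iff' _ _ _ _ _).mp h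
  have h1 := congrArg (b ⬝ᵥ ·) hk
  have h2 := congrArg (c ⬝ᵥ ·) hk
  simp only [dotProduct_smul, hb1, hc1, smul_eq_mul, mul_one] at h1 h2
  rw [← h2, h1, one_mul]

lemma exists_points {D : Form} {d : ℕ} (hd : d ≠ 0) (hD : D.IsHomogeneous d) (h0 : D ≠ 0)
    {ι : Type*} [Finite ι] (p : ι → Point) (M : ℕ) :
    ∃ B : Fin M → WeightedFrame, (∀ j, (B j).e = 1 ∧ (B j).OrdGE 1 D) ∧
      Function.Injective (fun j => (B j).p) ∧ ∀ i j, p i ≠ (B j).p := by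
  obtain ⟨t, hts, htc⟩ :=
    ((infinite_points hd hD h0).sdiff (Set.finite_range p)).exists_subset_card_eq M
  choose fr hfr using exists_frame
  let e := (Fintype.equivFinOfCardEq (α := t) (by rw [Fintype.card_coe, htc])).symm
  refine ⟨fun j => fr (e j), fun j => ⟨(hfr _).2, ?_⟩, fun j j' h => ?_, fun i j h => ?_⟩
  · rw [← WeightedFrame.passesThrough_iff _ hD, (hfr _).1]
    exact (hts (e j).2).1
  · simp only [(hfr _).1] at h
    exact e.injective (Subtype.ext h)
  · rw [(hfr _).1] at h
    exact (hts (e j).2).2 ⟨i, h⟩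

/-! ### The genus bound -/

/-- An irreducible curve of degree `d` has arithmetic genus `(d - 1)(d - 2) / 2`, and a point of
weighted order `e m` lowers the genus by `e m (m - 1) / 2`. If the sum of these numbers exceeded the
arithmetic genus, one of the adjoint curves of large degree would meet the curve too often. -/
theorem genus_bound {ι : Type*} [Fintype ι] {A : ι → WeightedFrame}
    (hA : Function.Injective fun t => (A t).p) (m : ι → ℕ) {D : Form} {d : ℕ} (hd : d ≠ 0)
    (hD : D.IsHomogeneous d) (hirr : Irreducible D) (hm : ∀ t, (A t).OrdGE ((A t).e * m t) D) :
    ∑ t, (A t).e * (m t * (m t - 1)) + 3 * d ≤ d * d + 2 := by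
  have hD0 := hirr.ne_zero
  set δ := Module.finrank ℂ ((Σ t, LowMonomial (A t).e ((m t - 1))) → ℂ) with hδ
  have c1 : 2 * δ = ∑ t, (A t).e * (m t * (m t - 1)) := by
    rw [hδ, two_mul_card_conditions A (fun t => m t - 1)]
    refine Finset.sum_congr rfl fun t _ => ?_
    rcases Nat.eq_zero_or_pos (m t) with h | h
    · simp [h]
    · rw [Nat.sub_add_cancel h, mul_comm (m t - 1)]
  set S := homogeneousSubmodule (Fin 3) ℂ with hS
  have s0 := finrank_homogeneousSubmodule δ
  have s1 := finrank_homogeneousSubmodule (δ + d)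
  rw [← hS] at s0 s1
  obtain ⟨M, hM⟩ : ∃ M, Module.finrank ℂ (S (δ + d)) = Module.finrank ℂ (S δ) + 1 + δ + M := by
    apply Nat.exists_eq_add_of_le
    have : 1 ≤ d := Nat.one_le_iff_ne_zero.mpr hd
    nlinarith
  obtain ⟨B, hB, hBinj, hAB⟩ := exists_points hd hD hD0 (fun t => (A t).p) M
  set A' : ι ⊕ Fin M → WeightedFrame := Sum.elim A B with hA'
  have hA'inj : Function.Injective fun t => (A' t).p := by
    rintro (i | i) (j | j) h
    · exact congrArg _ (hA h)
    · exact absurd h (hAB i j)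
    · exact absurd h.symm (hAB j i)
    · exact congrArg _ (hBinj h)
  set n' : ι ⊕ Fin M → ℕ := Sum.elim (fun t => m t - 1) (fun _ => 1) with hn'
  have c2 : Module.finrank ℂ ((Σ t, LowMonomial (A' t).e (n' t)) → ℂ) = δ + M := by
    have := two_mul_card_conditions A' n'
    rw [Fintype.sum_sum_type] at this
    have h1 := two_mul_card_conditions A (fun t => m t - 1)
    simp only [hA', hn', Sum.elim_inl, Sum.elim_inr, (hB _).1] at this
    rw [← h1, ← hδ] at this
    simp only [one_mul, Finset.sum_const, Finset.card_univ, Fintype.card_fin, smul_eq_mul] at this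
    omega
  -- an adjoint curve of degree `δ + d` through the extra points that does not contain `D`
  obtain ⟨G, hG, hGc, hGD⟩ : ∃ G ∈ S (δ + d), conditions A' n' G = 0 ∧
      G ∉ (S δ).map (LinearMap.mulLeft ℂ D) := by
    by_contra! hcon
    have h1 := finrank_map_add_finrank_ker (conditions A' n') (S (δ + d))
    have h2 := Submodule.finrank_le ((S (δ + d)).map (conditions A' n'))
    rw [c2] at h2
    have h3 : Module.finrank ℂ (LinearMap.ker ((conditions A' n').domRestrict (S (δ + d)))) ≤
        Module.finrank ℂ ((S δ).map (LinearMap.mulLeft ℂ D)) := by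
      rw [(Submodule.equivMapOfInjective (S (δ + d)).subtype (Submodule.subtype_injective _)
        (LinearMap.ker ((conditions A' n').domRestrict (S (δ + d))))).finrank_eq]
      have : FiniteDimensional ℂ ((S δ).map (LinearMap.mulLeft ℂ D)) := inferInstance
      refine Submodule.finrank_mono ?_
      rintro _ ⟨x, hx, rfl⟩
      exact hcon x x.2 hx
    rw [finrank_map_mul hD0] at h3
    linarith
  have hdvd : ¬ D ∣ G := by
    rintro ⟨K, rfl⟩
    refine hGD ⟨K, hD.of_mul hD0 ?_, rfl⟩
    rw [add_comm]; exact hG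
  have hG0 : G ≠ 0 := by
    rintro rfl
    exact hdvd (dvd_zero _)
  have hbez := bezout hA'inj (Sum.elim m (fun _ => 1)) n' hD hG hD0 hG0
    (hirr.isRelPrime_iff_not_dvd.mpr hdvd)
    (by
      rintro (i | i)
      · exact hm i
      · simp only [hA', Sum.elim_inr, (hB i).1]
        exact (hB i).2)
    (conditions_eq_zero_iff.mp hGc)
  rw [Fintype.sum_sum_type] at hbez
  simp only [hA', hn', Sum.elim_inl, Sum.elim_inr, (hB _).1] at hbez
  rw [← c1] at hbez
  simp at hbez
  nlinarith

/-! ### Change of frame -/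

/-- The form `F` in the homogeneous coordinates given by the basis `(v, u, w)`. -/
def WeightedFrame.coordForm (A : WeightedFrame) (F : Form) : Form :=
  aeval (fun i => C (A.v i) * X 0 + C (A.u i) * X 1 + C (A.w i) * X 2 : Fin 3 → Form) F

lemma coeff_dehomogenize {H : Form} {d : ℕ} (hH : H.IsHomogeneous d) {m : Fin 3 →₀ ℕ}
    (hm : m.degree = d) (k : Fin 2 →₀ ℕ) (h0 : k 0 = m 1) (h1 : k 1 = m 2) :
    coeff k (aeval (![1, X 0, X 1] : Fin 3 → Germ) H) = coeff m H := by
  conv_lhs => rw [H.as_sum, map_sum, coeff_sum]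
  have key : ∀ l : Fin 3 →₀ ℕ, aeval (![1, X 0, X 1] : Fin 3 → Germ) (monomial l (coeff l H)) =
      monomial (Finsupp.single 0 (l 1) + Finsupp.single 1 (l 2)) (coeff l H) := by
    intro l
    rw [aeval_monomial, Finsupp.prod_fintype _ _ (by simp), monomial_eq,
      Finsupp.prod_fintype _ _ (by simp)]
    simp [Fin.prod_univ_three, algebraMap_eq]
  simp only [key, coeff_monomial]
  rw [Finset.sum_eq_single m]
  · rw [if_pos]
    ext i
    fin_cases i <;> simp [h0, h1]
  · intro l hl hlm
    rw [if_neg]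
    rintro rfl
    apply hlm
    have hd := hH.degree_eq_sum_deg_support hl
    rw [← Finsupp.degree_apply] at hd
    rw [Finsupp.degree_eq_sum, Fin.sum_univ_three] at hm hd
    simp at h0 h1
    ext i
    fin_cases i
    · simp; omega
    · simp; omega
    · simp; omega
  · intro hm0
    rw [notMem_support_iff.mp hm0]
    simp

namespace WeightedFrame

lemma coordForm_isHomogeneous (A : WeightedFrame) {F : Form} {d : ℕ} (hF : F.IsHomogeneous d) :
    (A.coordForm F).IsHomogeneous d := by
  have := hF.aeval (fun i => C (A.v i) * X 0 + C (A.u i) * X 1 + C (A.w i) * X 2 : Fin 3 → Form)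
    (n := 1) fun i => ((isHomogeneous_C_mul_X _ _).add (isHomogeneous_C_mul_X _ _)).add
      (isHomogeneous_C_mul_X _ _)
  rwa [one_mul] at this

lemma localEquation_eq (A : WeightedFrame) (F : Form) : localEquation F A.v A.u A.w =
    aeval (![1, X 0, X 1] : Fin 3 → Germ) (A.coordForm F) := by
  rw [coordForm, ← AlgHom.comp_apply, comp_aeval, localEquation]
  congr 2
  ext1 i
  simp [algebraMap_eq]

/-- A form is the polynomial `coordForm` of the linear forms dual to the frame. -/
lemma eq_aeval_coordForm (A : WeightedFrame) {a b c : Fin 3 → ℂ}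
    (h : ∀ z : Fin 3 → ℂ, z = (a ⬝ᵥ z) • A.v + (b ⬝ᵥ z) • A.u + (c ⬝ᵥ z) • A.w) (F : Form) :
    F = aeval ![linForm a, linForm b, linForm c] (A.coordForm F) := by
  rw [coordForm, ← AlgHom.comp_apply, comp_aeval]
  conv_lhs => rw [← aeval_X_left_apply F]
  congr 2
  ext1 i
  apply MvPolynomial.funext
  intro z
  have := congrFun (h z) i
  simp only [Pi.add_apply, Pi.smul_apply, smul_eq_mul] at this
  simp only [eval_X, map_add, map_mul, aeval_X, algHom_C, algebraMap_eq, eval_C, eval_linForm,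
    Matrix.cons_val_zero, Matrix.cons_val_one, Matrix.cons_val]
  rw [this]; ring

/-- Comparison of weighted orders in two frames: if the second and third dual forms of `A` have
orders at least `α` and `β` in the frame `B`, so has every monomial in them, with these weights. -/
lemma OrdGE.transfer {A B : WeightedFrame} {k l α β : ℕ} {F : Form} {d : ℕ}
    (hF : F.IsHomogeneous d) (h : A.OrdGE k F)
    (hkl : ∀ i j, k ≤ i + A.e * j → l ≤ α * i + β * j)
    (hα : ∀ b : Fin 3 → ℂ, b ⬝ᵥ A.v = 0 → b ⬝ᵥ A.u = 1 → b ⬝ᵥ A.w = 0 → B.OrdGE α (linForm b))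
    (hβ : ∀ c : Fin 3 → ℂ, c ⬝ᵥ A.v = 0 → c ⬝ᵥ A.u = 0 → c ⬝ᵥ A.w = 1 → B.OrdGE β (linForm c)) :
    B.OrdGE l F := by
  obtain ⟨a, b, c, ha, hb, hc, hz⟩ := exists_dual A.isFrame.2
  have hb' := hα b hb.1 hb.2.1 hb.2.2
  have hc' := hβ c hc.1 hc.2.1 hc.2.2
  rw [A.ordGE_iff, localEquation_eq] at h
  rw [OrdGE, A.eq_aeval_coordForm hz F, (A.coordForm F).as_sum, map_sum, map_sum]
  refine Finset.dvd_sum fun m hm => ?_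
  have hH := A.coordForm_isHomogeneous hF
  have hd : m.degree = d := (hH.degree_eq_sum_deg_support hm).symm
  have hk : k ≤ m 1 + A.e * m 2 := by
    by_contra! hlt
    have := h (Finsupp.single 0 (m 1) + Finsupp.single 1 (m 2)) (by simpa using hlt)
    rw [coeff_dehomogenize hH hd _ (by simp) (by simp)] at this
    exact mem_support_iff.mp hm this
  rw [aeval_monomial, Finsupp.prod_fintype _ _ (by simp), Fin.prod_univ_three, map_mul, map_mul,
    map_mul, mul_assoc]
  refine dvd_mul_of_dvd_right (dvd_mul_of_dvd_right ?_ _) _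
  have := (hb'.pow (m 1)).mul (hc'.pow (m 2))
  have h2 := this.mono (hkl _ _ hk)
  unfold OrdGE at h2
  simpa using h2

lemma dot_eq_zero_of_p_eq {A B : WeightedFrame} (h : A.p = B.p) {b : Fin 3 → ℂ}
    (hb : b ⬝ᵥ A.v = 0) : b ⬝ᵥ B.v = 0 := by
  obtain ⟨c, hc, hv⟩ := A.exists_smul_rep
  obtain ⟨c', hc', hv'⟩ := B.exists_smul_rep
  rw [hv, dotProduct_smul, smul_eq_mul, mul_eq_zero, or_iff_right hc] at hb
  rw [hv', ← h, dotProduct_smul, hb, smul_zero]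

lemma ordGE_one_linForm {A B : WeightedFrame} (h : A.p = B.p) {b : Fin 3 → ℂ}
    (hb : b ⬝ᵥ A.v = 0) : B.OrdGE 1 (linForm b) := by
  rw [ordGE_one_iff, eval_linForm, dot_eq_zero_of_p_eq h hb]

lemma ordGE_linForm_of_dot_eq_zero {B : WeightedFrame} {b : Fin 3 → ℂ} (hv : b ⬝ᵥ B.v = 0)
    (hu : b ⬝ᵥ B.u = 0) : B.OrdGE B.e (linForm b) := by
  rw [OrdGE, loc_linForm, hv, hu]
  simp

/-- The multiplicity does not depend on the frame. -/
lemma OrdGE.of_weight_one {A B : WeightedFrame} {k d : ℕ} {F : Form} (hF : F.IsHomogeneous d)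
    (h : A.OrdGE k F) (hp : A.p = B.p) (hA : A.e = 1) : B.OrdGE k F :=
  h.transfer hF (α := 1) (β := 1) (fun i j hij => by rw [hA] at hij; omega)
    (fun b hb _ _ => ordGE_one_linForm hp hb) (fun b hb _ _ => ordGE_one_linForm hp hb)

/-- A point of weighted order `2 k` has multiplicity at least `k`. -/
lemma OrdGE.of_weight_two {A B : WeightedFrame} {k d : ℕ} {F : Form} (hF : F.IsHomogeneous d)
    (h : A.OrdGE (2 * k) F) (hp : A.p = B.p) (hA : A.e = 2) : B.OrdGE k F :=
  h.transfer hF (α := 1) (β := 1) (fun i j hij => by rw [hA] at hij; omega)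
    (fun b hb _ _ => ordGE_one_linForm hp hb) (fun b hb _ _ => ordGE_one_linForm hp hb)

end WeightedFrame

/-! ### Orders along a transverse line -/

/-- The restriction of a germ to the `y`-axis. -/
def restrictY : Germ →ₐ[ℂ] Polynomial ℂ := aeval ![0, Polynomial.X]

lemma coeff_restrictY (f : Germ) (n : ℕ) :
    (restrictY f).coeff n = coeff (Finsupp.single 1 n) f := by
  induction f using MvPolynomial.induction_on' with
  | monomial k c =>
    rw [restrictY, aeval_monomial, Finsupp.prod_fintype _ _ (by simp), coeff_monomial]
    simp only [Fin.prod_univ_two, Matrix.cons_val_zero, Matrix.cons_val_one]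
    by_cases h0 : k 0 = 0
    · rw [h0, pow_zero, one_mul]
      have : algebraMap ℂ (Polynomial ℂ) c = Polynomial.C c := rfl
      rw [this, Polynomial.coeff_C_mul_X_pow]
      congr 1
      rw [eq_iff_iff]
      constructor
      · rintro rfl
        ext i
        fin_cases i <;> simp [h0]
      · rintro rfl
        simp
    · rw [zero_pow h0, zero_mul, mul_zero, Polynomial.coeff_zero, if_neg]
      rintro rfl
      simp at h0
  | add p q hp hq => rw [map_add, Polynomial.coeff_add, coeff_add, hp, hq]

lemma X_pow_dvd_restrictY {e k : ℕ} {f : Germ} (h : Polynomial.X ^ k ∣ scale e f) :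
    ∀ n, e * n < k → (restrictY f).coeff n = 0 := by
  intro n hn
  rw [coeff_restrictY]
  exact X_pow_dvd_scale.mp h _ (by simpa using hn)

lemma X_pow_dvd_iff_le_natTrailingDegree {R : Type*} [Semiring R] {P : Polynomial R} (hP : P ≠ 0)
    (k : ℕ) : Polynomial.X ^ k ∣ P ↔ k ≤ P.natTrailingDegree := by
  rw [Polynomial.X_pow_dvd_iff]
  constructor
  · exact fun h => Polynomial.le_natTrailingDegree hP h
  · exact fun h n hn => Polynomial.coeff_eq_zero_of_lt_natTrailingDegree (hn.trans_le h)

lemma natTrailingDegree_prod {R ι : Type*} [CommRing R] [IsDomain R] [Fintype ι]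
    (P : ι → Polynomial R) (hP : ∀ i, P i ≠ 0) :
    (∏ i, P i).natTrailingDegree = ∑ i, (P i).natTrailingDegree := by
  classical
  have : ∀ s : Finset ι, (∏ i ∈ s, P i).natTrailingDegree = ∑ i ∈ s, (P i).natTrailingDegree := by
    intro s
    induction s using Finset.induction_on with
    | empty => simp
    | insert a s ha ih =>
      rw [Finset.prod_insert ha, Finset.sum_insert ha, Polynomial.natTrailingDegree_mul (hP a)
        (Finset.prod_ne_zero_iff.mpr fun i _ => hP i), ih]
  exact this _

/-- The multiplicities of the factors at a point add up. -/
lemma exists_multiplicities {ι : Type*} [Fintype ι] (A : WeightedFrame) (D : ι → Form)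
    (h : A.loc (∏ i, D i) ≠ 0) :
    ∃ b : ι → ℕ, ∑ i, b i = (A.loc (∏ i, D i)).natTrailingDegree ∧
      ∀ i k, A.OrdGE k (D i) ↔ k ≤ b i := by
  rw [map_prod, Finset.prod_ne_zero_iff] at h
  refine ⟨fun i => (A.loc (D i)).natTrailingDegree, ?_, fun i k => ?_⟩
  · rw [map_prod, natTrailingDegree_prod _ fun i => h i (Finset.mem_univ i)]
  · exact X_pow_dvd_iff_le_natTrailingDegree (h i (Finset.mem_univ i)) k

/-- If a product has weighted order `2 n` in a frame with weights `(1, 2)`, and order exactly `n`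
along the `y`-axis, then each factor has even weighted order `2 a`, and order exactly `a` along the
`y`-axis: the weighted order of a factor is at most twice its order along the `y`-axis, and both
add up. -/
lemma exists_half_orders {ι : Type*} [Fintype ι] (A : WeightedFrame) (hA : A.e = 2)
    (D : ι → Form) (n : ℕ) (h : A.OrdGE (2 * n) (∏ i, D i))
    (hn : coeff (Finsupp.single 1 n) (localEquation (∏ i, D i) A.v A.u A.w) ≠ 0) :
    ∃ a : ι → ℕ, ∑ i, a i = n ∧ (∀ i, A.OrdGE (2 * a i) (D i)) ∧
      ∀ i, coeff (Finsupp.single 1 (a i)) (localEquation (D i) A.v A.u A.w) ≠ 0 := by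
  set f : ι → Germ := fun i => localEquation (D i) A.v A.u A.w with hf
  have hprod : localEquation (∏ i, D i) A.v A.u A.w = ∏ i, f i := map_prod _ _ _
  have h0 : restrictY (∏ i, f i) ≠ 0 := by
    intro h0
    apply hn
    rw [hprod, ← coeff_restrictY, h0, Polynomial.coeff_zero]
  have h1 : ∀ i, restrictY (f i) ≠ 0 := by
    rw [map_prod, Finset.prod_ne_zero_iff] at h0
    exact fun i => h0 i (Finset.mem_univ i)
  have h2 : ∀ i, scale 2 (f i) ≠ 0 := by
    intro i hi
    apply h1 i
    ext k
    exact X_pow_dvd_restrictY (e := 2) (k := 2 * k + 1) (by rw [hi]; exact dvd_zero _) k (by omega)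
  set a : ι → ℕ := fun i => (restrictY (f i)).natTrailingDegree with ha
  have hsum : ∑ i, a i = (restrictY (∏ i, f i)).natTrailingDegree := by
    rw [map_prod, natTrailingDegree_prod _ h1]
  have hle : (restrictY (∏ i, f i)).natTrailingDegree ≤ n := by
    apply Polynomial.natTrailingDegree_le_of_ne_zero
    rw [coeff_restrictY, ← hprod]
    exact hn
  have hdvd : 2 * n ≤ ∑ i, (scale 2 (f i)).natTrailingDegree := by
    rw [← natTrailingDegree_prod _ h2, ← X_pow_dvd_iff_le_natTrailingDegree
      (Finset.prod_ne_zero_iff.mpr fun i _ => h2 i), ← map_prod, ← hprod]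
    rwa [WeightedFrame.OrdGE, WeightedFrame.loc_eq, hA] at h
  have hai : ∀ i, (scale 2 (f i)).natTrailingDegree ≤ 2 * a i := by
    intro i
    by_contra! hlt
    have := X_pow_dvd_restrictY ((X_pow_dvd_iff_le_natTrailingDegree (h2 i) _).mpr le_rfl) _ hlt
    exact Polynomial.trailingCoeff_nonzero_iff_nonzero.mpr (h1 i) this
  have hs : ∑ i, (scale 2 (f i)).natTrailingDegree ≤ ∑ i, 2 * a i :=
    Finset.sum_le_sum fun i _ => hai i
  have heq : ∀ i, (scale 2 (f i)).natTrailingDegree = 2 * a i := by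
    intro i
    have h3 : ∑ i, (scale 2 (f i)).natTrailingDegree = ∑ i, 2 * a i := by
      rw [← Finset.mul_sum] at hs ⊢
      omega
    exact (Finset.sum_eq_sum_iff_of_le fun i _ => hai i).mp h3 i (Finset.mem_univ i)
  refine ⟨a, ?_, fun i => ?_, fun i => ?_⟩
  · rw [← Finset.mul_sum] at hs
    omega
  · rw [WeightedFrame.OrdGE, WeightedFrame.loc_eq, hA,
      X_pow_dvd_iff_le_natTrailingDegree (h2 i), heq i]
  · rw [← coeff_restrictY]
    exact Polynomial.trailingCoeff_nonzero_iff_nonzero.mpr (h1 i)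

/-! ### Numerical classification of the components -/

/-- The genus bound and the bound for the intersection with the rest of the curve determine the
numerical types of components of degree at most `3`. -/
lemma low_degree_types {d x y z b : ℕ} (hd : d < 4) (hx : x < 4) (hy : y < 4) (hz : z < 4)
    (hb : b < 5) (hd1 : 1 ≤ d)
    (hg : 2 * (x * (x - 1) + y * (y - 1) + z * (z - 1)) + b * (b - 1) + 3 * d ≤ d * d + 2)
    (hr : 2 * (x * (3 - x) + y * (3 - y) + z * (3 - z)) + b * (4 - b) ≤ d * (8 - d)) :
    (d = 1 ∧ x + y + z = 1 ∧ b = 1) ∨ (d = 1 ∧ 4 * (x + y + z) + 3 * b ≤ 4) ∨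
    (d = 2 ∧ x = 1 ∧ y = 1 ∧ z = 1 ∧ b = 0) ∨
    (d = 2 ∧ x + y + z = 2 ∧ x ≤ 1 ∧ y ≤ 1 ∧ z ≤ 1 ∧ b = 1) ∨
    (2 ≤ d ∧ 4 * (x + y + z) + 3 * b ≤ 5 * d) := by
  have key : ∀ d < 4, ∀ x < 4, ∀ y < 4, ∀ z < 4, ∀ b < 5, decide (1 ≤ d →
      2 * (x * (x - 1) + y * (y - 1) + z * (z - 1)) + b * (b - 1) + 3 * d ≤ d * d + 2 →
      2 * (x * (3 - x) + y * (3 - y) + z * (3 - z)) + b * (4 - b) ≤ d * (8 - d) →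
      (d = 1 ∧ x + y + z = 1 ∧ b = 1) ∨ (d = 1 ∧ 4 * (x + y + z) + 3 * b ≤ 4) ∨
      (d = 2 ∧ x = 1 ∧ y = 1 ∧ z = 1 ∧ b = 0) ∨
      (d = 2 ∧ x + y + z = 2 ∧ x ≤ 1 ∧ y ≤ 1 ∧ z ≤ 1 ∧ b = 1) ∨
      (2 ≤ d ∧ 4 * (x + y + z) + 3 * b ≤ 5 * d)) = true := by
    decide +kernel
  exact of_decide_eq_true (key d hd x hx y hy z hz b hb) hd1 hg hr

/-- The numerical content of the theorem: `d i` are the degrees of the components of the octic,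
`a i k` half their weighted orders at the `[3;3]`-points and `b i` their multiplicities at the
quadruple point. The crucial quantity is `4 ∑ a + 3 b - 5 d`: it is `8` for the whole curve, and at
most `2` for a component (by the sum of the genus bound and of the bound for the intersection with
the other components). So there are at least four components, and few types of components of low
degree contribute at all. -/
theorem numerical_classification {ι : Type*} [Fintype ι] (d b : ι → ℕ) (a : ι → Fin 3 → ℕ)
    (hd : ∀ i, 1 ≤ d i) (sd : ∑ i, d i = 8) (sa : ∀ k, ∑ i, a i k = 3) (sb : ∑ i, b i = 4)
    (hg : ∀ i, 2 * (∑ k, a i k * (a i k - 1)) + b i * (b i - 1) + 3 * d i ≤ d i * d i + 2)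
    (hp : ∀ i j, i ≠ j → 2 * (∑ k, a i k * a j k) + b i * b j ≤ d i * d j) :
    (∃ e : Fin 4 ≃ ι, (d (e 0) = 5 ∧ (∀ k, a (e 0) k = 2) ∧ b (e 0) = 1) ∧
      ∀ k : Fin 3, d (e k.succ) = 1 ∧ (∀ j, a (e k.succ) j = if j = k then 1 else 0) ∧
        b (e k.succ) = 1) ∨
    (∃ (e : Fin 4 ≃ ι) (σ : Equiv.Perm (Fin 3)),
      (d (e 0) = 4 ∧ a (e 0) (σ 0) = 1 ∧ a (e 0) (σ 1) = 1 ∧ a (e 0) (σ 2) = 2 ∧ b (e 0) = 2) ∧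
      (d (e 1) = 2 ∧ (∀ k, a (e 1) k = 1) ∧ b (e 1) = 0) ∧
      (d (e 2) = 1 ∧ (∀ j, a (e 2) j = if j = σ 0 then 1 else 0) ∧ b (e 2) = 1) ∧
      (d (e 3) = 1 ∧ (∀ j, a (e 3) j = if j = σ 1 then 1 else 0) ∧ b (e 3) = 1)) ∨
    (∃ (q : ι) (l : Fin 3 → ι), (d q = 2 ∧ (∀ k, a q k = 1) ∧ b q = 0) ∧
      ∀ k, d (l k) = 1 ∧ (∀ j, a (l k) j = if j = k then 1 else 0) ∧ b (l k) = 1) := by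
  classical
  have ha3 : ∀ i k, a i k ≤ 3 := fun i k => by
    rw [← sa k]; exact Finset.single_le_sum (f := fun i => a i k) (fun _ _ => Nat.zero_le _)
      (Finset.mem_univ i)
  have hb4 : ∀ i, b i ≤ 4 := fun i => by
    rw [← sb]; exact Finset.single_le_sum (f := b) (fun _ _ => Nat.zero_le _) (Finset.mem_univ i)
  have hd8 : ∀ i, d i ≤ 8 := fun i => by
    rw [← sd]; exact Finset.single_le_sum (f := d) (fun _ _ => Nat.zero_le _) (Finset.mem_univ i)
  -- intersection of a component with the rest of the curve
  have hrest : ∀ i, 2 * (∑ k, a i k * (3 - a i k)) + b i * (4 - b i) ≤ d i * (8 - d i) := by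
    intro i
    have e1 : ∀ k, ∑ j ∈ Finset.univ.erase i, a j k = 3 - a i k := fun k => by
      rw [← sa k, ← Finset.add_sum_erase _ _ (Finset.mem_univ i)]; simp
    have e2 : ∑ j ∈ Finset.univ.erase i, b j = 4 - b i := by
      rw [← sb, ← Finset.add_sum_erase _ _ (Finset.mem_univ i)]; simp
    have e3 : ∑ j ∈ Finset.univ.erase i, d j = 8 - d i := by
      rw [← sd, ← Finset.add_sum_erase _ _ (Finset.mem_univ i)]; simp
    have := Finset.sum_le_sum fun j (hj : j ∈ Finset.univ.erase i) =>
      hp i j (Finset.ne_of_mem_erase hj).symm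
    rw [Finset.sum_add_distrib, ← Finset.mul_sum, ← Finset.mul_sum, ← Finset.mul_sum,
      Finset.sum_comm] at this
    simp only [← Finset.mul_sum, e1, e2, e3] at this
    exact this
  have hlin : ∀ i, 4 * (∑ k, a i k) + 3 * b i ≤ 5 * d i + 2 := by
    intro i
    have h1 := hg i
    have h2 := hrest i
    have q : ∀ x : ℕ, x ≤ 3 → x * (x - 1) + x * (3 - x) = 2 * x := by decide
    have q4 : ∀ x : ℕ, x ≤ 4 → x * (x - 1) + x * (4 - x) = 3 * x := by decide
    have q8 : d i * d i + d i * (8 - d i) = 8 * d i := by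
      rw [← mul_add, Nat.add_sub_cancel' (hd8 i), mul_comm]
    have q0 := q _ (ha3 i 0)
    have q1 := q _ (ha3 i 1)
    have q2 := q _ (ha3 i 2)
    have q3 := q4 _ (hb4 i)
    rw [Fin.sum_univ_three] at h1 h2 ⊢
    omega
  -- Types with a bound for the crucial quantity `4 ∑ a + 3 b - 5 d`: distinguished tangent lines
  -- through the quadruple point (`2`), other lines (`-1`), conics through all the `[3;3]`-points
  -- (`2`) or through two of them and the quadruple point (`1`), components of degree at least `4`
  -- (`2`), and the remaining components (`0`).
  let isL : ι → Prop := fun i => d i = 1 ∧ ∑ k, a i k = 1 ∧ b i = 1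
  let isL' : ι → Prop := fun i => d i = 1 ∧ 4 * (∑ k, a i k) + 3 * b i ≤ 4
  let isQ : ι → Prop := fun i => d i = 2 ∧ (∀ k, a i k = 1) ∧ b i = 0
  let isQ' : ι → Prop := fun i => d i = 2 ∧ ∑ k, a i k = 2 ∧ (∀ k, a i k ≤ 1) ∧ b i = 1
  let isB : ι → Prop := fun i => 4 ≤ d i
  let isR : ι → Prop := fun i => 2 ≤ d i ∧ 4 * (∑ k, a i k) + 3 * b i ≤ 5 * d i
  have htype : ∀ i, isL i ∨ isL' i ∨ isQ i ∨ isQ' i ∨ isB i ∨ isR i := by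
    intro i
    by_cases h4 : 4 ≤ d i
    · exact Or.inr (Or.inr (Or.inr (Or.inr (Or.inl h4))))
    have h1 := hg i
    have h2 := hrest i
    rw [Fin.sum_univ_three] at h1 h2
    have hall : ∀ P : Fin 3 → Prop, P 0 → P 1 → P 2 → ∀ k, P k := fun P p0 p1 p2 k => by
      fin_cases k <;> assumption
    simp only [isL, isL', isQ, isQ', isB, isR, Fin.sum_univ_three]
    rcases low_degree_types (not_le.mp h4) (Nat.lt_succ_of_le (ha3 i 0))
      (Nat.lt_succ_of_le (ha3 i 1)) (Nat.lt_succ_of_le (ha3 i 2)) (Nat.lt_succ_of_le (hb4 i))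
      (hd i) h1 h2 with h | h | ⟨h, hx, hy, hz, hb⟩ | ⟨h, hs, hx, hy, hz, hb⟩ | h
    · exact Or.inl h
    · exact Or.inr (Or.inl h)
    · exact Or.inr (Or.inr (Or.inl ⟨h, hall _ hx hy hz, hb⟩))
    · exact Or.inr (Or.inr (Or.inr (Or.inl ⟨h, hs, hall _ hx hy hz, hb⟩)))
    · exact Or.inr (Or.inr (Or.inr (Or.inr (Or.inr h))))
  -- a type for each component
  have hch : ∀ i, ∃ t : Fin 6, (t = 0 → isL i) ∧ (t = 1 → isL' i) ∧ (t = 2 → isQ i) ∧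
      (t = 3 → isQ' i) ∧ (t = 4 → isB i) ∧ (t = 5 → isR i) := by
    intro i
    rcases htype i with h | h | h | h | h | h
    · exact ⟨0, by simp [h]⟩
    · exact ⟨1, by simp [h]⟩
    · exact ⟨2, by simp [h]⟩
    · exact ⟨3, by simp [h]⟩
    · exact ⟨4, by simp [h]⟩
    · exact ⟨5, by simp [h]⟩
  choose t ht0 ht1 ht2 ht3 ht4 ht5 using hch
  have h6 : ∀ i, t i = 0 ∨ t i = 1 ∨ t i = 2 ∨ t i = 3 ∨ t i = 4 ∨ t i = 5 := fun i => by
    generalize t i = s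
    revert s
    decide
  let n : Fin 6 → ℕ := fun s => (Finset.univ.filter fun i => t i = s).card
  have hn : ∀ s, n s = ∑ i, if t i = s then 1 else 0 := fun s => by
    simp only [n, Finset.card_filter]
  have hcard : Fintype.card ι = n 0 + n 1 + n 2 + n 3 + n 4 + n 5 := by
    rw [← Fin.sum_univ_six, ← Finset.card_univ,
      Finset.card_eq_sum_card_fiberwise (f := t) (t := Finset.univ) (by simp)]
  -- the degrees and the crucial quantities add up to `8`
  have hdeg : n 0 + n 1 + 2 * n 2 + 2 * n 3 + 4 * n 4 + 2 * n 5 ≤ 8 := by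
    simp only [hn, ← sd, Finset.mul_sum, ← Finset.sum_add_distrib]
    refine Finset.sum_le_sum fun i _ => ?_
    rcases h6 i with hs | hs | hs | hs | hs | hs
    · simp [hs, (ht0 i hs).1]
    · simp [hs, (ht1 i hs).1]
    · simp [hs, (ht2 i hs).1]
    · simp [hs, (ht3 i hs).1]
    · simpa [hs] using ht4 i hs
    · simpa [hs] using (ht5 i hs).1
  have hgam : 8 + n 1 ≤ 2 * n 0 + 2 * n 2 + n 3 + 2 * n 4 := by
    have e1 : ∑ i, ∑ k, a i k = 9 := by
      rw [Finset.sum_comm]; simp [sa]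
    have : ∑ i, (4 * (∑ k, a i k) + 3 * b i + (if t i = 1 then 1 else 0)) ≤
        ∑ i, (5 * d i + (2 * (if t i = 0 then 1 else 0) + 2 * (if t i = 2 then 1 else 0) +
          (if t i = 3 then 1 else 0) + 2 * (if t i = 4 then 1 else 0))) := by
      refine Finset.sum_le_sum fun i _ => ?_
      have hl := hlin i
      rcases h6 i with hs | hs | hs | hs | hs | hs
      · obtain ⟨h1, h2, h3⟩ := ht0 i hs
        rw [h1, h2, h3, hs]; simp
      · obtain ⟨h1, h2⟩ := ht1 i hs
        rw [h1, hs]; simp; omega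
      · obtain ⟨h1, h2, h3⟩ := ht2 i hs
        rw [h1, h3, hs]; simp [h2]
      · obtain ⟨h1, h2, h3, h4⟩ := ht3 i hs
        rw [h1, h2, h4, hs]; simp
      · rw [hs]; simpa using hl
      · rw [hs]; simpa using (ht5 i hs).2
    simp only [Finset.sum_add_distrib, ← Finset.mul_sum, sd, sb, e1, ← hn] at this
    omega
  have hline : ∀ i, isL i → ∃ k, ∀ j, a i j = if j = k then 1 else 0 := by
    rintro i ⟨-, h, -⟩
    rw [Fin.sum_univ_three] at h
    have : a i 0 = 1 ∧ a i 1 = 0 ∧ a i 2 = 0 ∨ a i 0 = 0 ∧ a i 1 = 1 ∧ a i 2 = 0 ∨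
      a i 0 = 0 ∧ a i 1 = 0 ∧ a i 2 = 1 := by omega
    rcases this with h | h | h
    · exact ⟨0, by simp [Fin.forall_fin_succ, h]⟩
    · exact ⟨1, by simp [Fin.forall_fin_succ, h]⟩
    · exact ⟨2, by simp [Fin.forall_fin_succ, h]⟩
  choose! κ hκ using hline
  -- a line of the first type is determined by its `[3;3]`-point, as two lines meet only once
  have hκinj : ∀ i j, isL i → isL j → κ i = κ j → i = j := by
    intro i j hi hj hij
    by_contra hne
    have := hp i j hne
    simp [hκ i hi, hκ j hj, hij, hi.1, hj.1] at this
    omega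
  have hmem : ∀ s i, i ∈ (Finset.univ.filter fun i => t i = s) ↔ t i = s := by simp
  have hn0 : n 0 ≤ 3 := by
    rw [← Fintype.card_fin 3, ← Finset.card_univ]
    refine Finset.card_le_card_of_injOn κ (fun _ _ => Finset.mem_coe.mpr (Finset.mem_univ _)) ?_
    intro i hi j hj hij
    exact hκinj i j (ht0 i ((hmem _ _).mp hi)) (ht0 j ((hmem _ _).mp hj)) hij
  -- two conics of the third type would have intersection number at least `6`
  have hn2 : n 2 ≤ 1 := by
    rw [Finset.card_le_one]
    intro i hi j hj
    by_contra hne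
    have h1 := ht2 i ((hmem _ _).mp hi)
    have h2 := ht2 j ((hmem _ _).mp hj)
    have := hp i j hne
    simp [h1.2.1, h2.2.1, h1.1, h2.1] at this
    omega
  have hn3 : 1 ≤ n 3 → n 0 ≤ 1 := by
    intro h
    obtain ⟨q, hq⟩ := Finset.card_pos.mp h
    obtain ⟨hq1, hq2, hq3, hq4⟩ := ht3 q ((hmem _ _).mp hq)
    -- a line of the first type contains none of the two base points of the conic
    have key : ∀ i, isL i → a q (κ i) = 0 := by
      intro i hi
      have hne : q ≠ i := by
        rintro rfl
        rw [hi.1] at hq1; omega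
      have := hp q i hne
      simp [hκ i hi, hi.1, hi.2.2, hq1, hq4] at this
      omega
    rw [Finset.card_le_one]
    intro i hi j hj
    have hi' := ht0 i ((hmem _ _).mp hi)
    have hj' := ht0 j ((hmem _ _).mp hj)
    refine hκinj i j hi' hj' ?_
    by_contra hne
    have h1 := key i hi'
    have h2 := key j hj'
    rw [Fin.sum_univ_three] at hq2
    have h3 := hq3 0; have h4 := hq3 1; have h5 := hq3 2
    clear * - h1 h2 h3 h4 h5 hq2 hne
    generalize κ i = x at *
    generalize κ j = y at *
    fin_cases x <;> fin_cases y <;> simp at * <;> omega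
  have hthree : n 0 = 3 → ∃ l : Fin 3 → ι, ∀ k, t (l k) = 0 ∧ κ (l k) = k := by
    intro h
    have himg : (Finset.univ.filter fun i => t i = 0).image κ = Finset.univ := by
      rw [← Finset.card_eq_iff_eq_univ, Finset.card_image_of_injOn, Fintype.card_fin]
      · exact h
      · intro i hi j hj hij
        exact hκinj i j (ht0 i ((hmem _ _).mp hi)) (ht0 j ((hmem _ _).mp hj)) hij
    have : ∀ k, ∃ i, t i = 0 ∧ κ i = k := by
      intro k
      have := Finset.mem_univ k
      rw [← himg, Finset.mem_image] at this
      obtain ⟨i, hi, hik⟩ := this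
      exact ⟨i, (hmem _ _).mp hi, hik⟩
    exact Classical.skolem.mp this
  have hequiv : ∀ f : Fin 4 → ι, Function.Injective f → Fintype.card ι = 4 →
      ∃ e : Fin 4 ≃ ι, ∀ x, e x = f x := by
    intro f hf hc
    have hb : Function.Bijective f :=
      (Fintype.bijective_iff_injective_and_card f).mpr ⟨hf, by rw [hc, Fintype.card_fin]⟩
    exact ⟨Equiv.ofBijective f hb, fun _ => rfl⟩
  have hcases : (n 4 = 1 ∧ n 0 = 3 ∧ Fintype.card ι = 4) ∨
      (n 4 = 1 ∧ n 0 = 2 ∧ n 2 = 1 ∧ Fintype.card ι = 4) ∨ (n 0 = 3 ∧ n 2 = 1) := by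
    omega
  rcases hcases with ⟨h4, h0, hc⟩ | ⟨h4, h0, h2, hc⟩ | ⟨h0, h2⟩
  · left
    obtain ⟨l, hl⟩ := hthree h0
    obtain ⟨v, hv⟩ := Finset.card_pos.mp (show 0 < n 4 by omega)
    have hv4 := (hmem _ _).mp hv
    obtain ⟨e, he⟩ := hequiv (Fin.cons v l) (by
      rw [Fin.cons_injective_iff]
      refine ⟨?_, fun x y hxy => ?_⟩
      · rintro ⟨k, hk⟩
        rw [← hk, (hl k).1] at hv4
        simp at hv4
      · rw [← (hl x).2, hxy, (hl y).2]) hc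
    have hL : ∀ k : Fin 3, isL (e k.succ) ∧ κ (e k.succ) = k := fun k => by
      rw [he, Fin.cons_succ]; exact ⟨ht0 _ (hl k).1, (hl k).2⟩
    have hL2 : ∀ k : Fin 3, d (e k.succ) = 1 ∧ (∀ j, a (e k.succ) j = if j = k then 1 else 0) ∧
        b (e k.succ) = 1 := fun k => ⟨(hL k).1.1, fun j => by
      have := hκ _ (hL k).1 j
      rwa [(hL k).2] at this, (hL k).1.2.2⟩
    refine ⟨e, ⟨?_, fun k => ?_, ?_⟩, hL2⟩
    · rw [← Equiv.sum_comp e, Fin.sum_univ_succ] at sd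
      simp [fun k => (hL2 k).1] at sd
      omega
    · have := sa k
      rw [← Equiv.sum_comp e, Fin.sum_univ_succ] at this
      simp [fun k => (hL2 k).2.1] at this
      omega
    · rw [← Equiv.sum_comp e, Fin.sum_univ_succ] at sb
      simp [fun k => (hL2 k).2.2] at sb
      omega
  · right; left
    obtain ⟨v, hv⟩ := Finset.card_pos.mp (show 0 < n 4 by omega)
    obtain ⟨q, hq⟩ := Finset.card_pos.mp (show 0 < n 2 by omega)
    obtain ⟨i, j, hij, hs⟩ := Finset.card_eq_two.mp h0
    have hv4 := (hmem _ _).mp hv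
    have hq2 := (hmem _ _).mp hq
    have hi0 : t i = 0 := (hmem _ _).mp (by rw [hs]; simp)
    have hj0 : t j = 0 := (hmem _ _).mp (by rw [hs]; simp)
    have hκne : κ i ≠ κ j := fun h => hij (hκinj i j (ht0 i hi0) (ht0 j hj0) h)
    obtain ⟨σ, hσ0, hσ1⟩ : ∃ σ : Equiv.Perm (Fin 3), σ 0 = κ i ∧ σ 1 = κ j := by
      revert hκne
      generalize κ i = x
      generalize κ j = y
      revert x y
      decide
    obtain ⟨e, he⟩ := hequiv ![v, q, i, j] (by
      have h1 : v ≠ q := fun h => by rw [h, hq2] at hv4; simp at hv4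
      have h2 : v ≠ i := fun h => by rw [h, hi0] at hv4; simp at hv4
      have h3 : v ≠ j := fun h => by rw [h, hj0] at hv4; simp at hv4
      have h5 : q ≠ i := fun h => by rw [h, hi0] at hq2; simp at hq2
      have h6 : q ≠ j := fun h => by rw [h, hj0] at hq2; simp at hq2
      intro x y hxy
      fin_cases x <;> fin_cases y <;>
        first
        | rfl
        | exact absurd hxy h1 | exact absurd hxy h2 | exact absurd hxy h3
        | exact absurd hxy h5 | exact absurd hxy h6 | exact absurd hxy hij
        | exact absurd hxy h1.symm | exact absurd hxy h2.symm | exact absurd hxy h3.symm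
        | exact absurd hxy h5.symm | exact absurd hxy h6.symm | exact absurd hxy hij.symm) hc
    have e0 : e 0 = v := he 0
    have e1 : e 1 = q := he 1
    have e2 : e 2 = i := he 2
    have e3 : e 3 = j := he 3
    have hQ := ht2 q hq2
    have hI := ht0 i hi0
    have hJ := ht0 j hj0
    have hIa := hκ i hI
    have hJa := hκ j hJ
    rw [← hσ0] at hIa
    rw [← hσ1] at hJa
    have hsum : ∀ f : ι → ℕ, ∑ i, f i = f v + f q + f i + f j := fun f => by
      rw [← Equiv.sum_comp e, Fin.sum_univ_four, e0, e1, e2, e3]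
    refine ⟨e, σ, ?_, ?_, ?_, ?_⟩
    · rw [e0]
      have h01 : σ 0 ≠ σ 1 := by simp
      have h02 : σ 2 ≠ σ 0 := by simp
      have h12 : σ 2 ≠ σ 1 := by simp
      have s0 := sa (σ 0)
      have s1 := sa (σ 1)
      have s2 := sa (σ 2)
      rw [hsum] at sd sb s0 s1 s2
      rw [hIa, hJa, hQ.2.1] at s0 s1 s2
      rw [hQ.1, hI.1, hJ.1] at sd
      rw [hQ.2.2, hI.2.2, hJ.2.2] at sb
      simp [h01, h02, h12, h01.symm] at s0 s1 s2
      refine ⟨by omega, by omega, by omega, by omega, by omega⟩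
    · rw [e1]; exact hQ
    · rw [e2]; exact ⟨hI.1, hIa, hI.2.2⟩
    · rw [e3]; exact ⟨hJ.1, hJa, hJ.2.2⟩
  · right; right
    obtain ⟨l, hl⟩ := hthree h0
    obtain ⟨q, hq⟩ := Finset.card_pos.mp (show 0 < n 2 by omega)
    refine ⟨q, l, ht2 q ((hmem _ _).mp hq), fun k => ?_⟩
    have hL := ht0 _ (hl k).1
    refine ⟨hL.1, fun j => ?_, hL.2.2⟩
    have := hκ _ hL j
    rwa [(hl k).2] at this

/-! ### Local conditions in terms of weighted orders -/

lemma IsNFoldGerm.natTrailingDegree_scale {n : ℕ} {f : Germ} (h : IsNFoldGerm n f) :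
    scale 1 f ≠ 0 ∧ (scale 1 f).natTrailingDegree = n := by
  have hn : (scale 1 f).coeff n ≠ 0 := by rw [scale_one_coeff]; exact h.2
  have h0 : scale 1 f ≠ 0 := fun h0 => hn (by rw [h0, Polynomial.coeff_zero])
  refine ⟨h0, le_antisymm (Polynomial.natTrailingDegree_le_of_ne_zero hn) ?_⟩
  exact Polynomial.le_natTrailingDegree h0 fun k hk => by rw [scale_one_coeff]; exact h.1 k hk

lemma coeff_blowUp (f : Germ) (i j : ℕ) :
    coeff (Finsupp.single 0 (i + j) + Finsupp.single 1 j)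
      (aeval (![X 0, X 0 * X 1] : Fin 2 → Germ) f) =
      coeff (Finsupp.single 0 i + Finsupp.single 1 j) f := by
  induction f using MvPolynomial.induction_on' with
  | monomial k c =>
    have : aeval (![X 0, X 0 * X 1] : Fin 2 → Germ) (monomial k c) =
        monomial (Finsupp.single 0 (k 0 + k 1) + Finsupp.single 1 (k 1)) c := by
      rw [aeval_monomial, Finsupp.prod_fintype _ _ (by simp), monomial_eq,
        Finsupp.prod_fintype _ _ (by simp)]
      simp only [algebraMap_eq, Fin.prod_univ_two, Matrix.cons_val_zero, Matrix.cons_val_one,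
        Finsupp.add_apply, Finsupp.single_eq_same, ne_eq, one_ne_zero, zero_ne_one,
        not_false_eq_true, Finsupp.single_eq_of_ne, add_zero, zero_add]
      ring
    rw [this, coeff_monomial, coeff_monomial]
    congr 1
    rw [eq_iff_iff, Finsupp.ext_iff, Finsupp.ext_iff]
    simp [Fin.forall_fin_two]
    omega
  | add p q hp hq => rw [map_add, coeff_add, coeff_add, hp, hq]

lemma IsStrictTransform.coeff_eq {n : ℕ} {f f' : Germ} (h : IsStrictTransform n f f') {i j k : ℕ}
    (hk : i + j = k + n) : coeff (Finsupp.single 0 k + Finsupp.single 1 j) f' =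
      coeff (Finsupp.single 0 i + Finsupp.single 1 j) f := by
  rw [← coeff_blowUp f i j, hk, h, Finsupp.single_add,
    add_comm (Finsupp.single 0 k) (Finsupp.single 0 n),
    add_assoc, X_pow_eq_monomial]
  simp

lemma finsupp_fin_two (m : Fin 2 →₀ ℕ) : Finsupp.single 0 (m 0) + Finsupp.single 1 (m 1) = m := by
  ext i
  fin_cases i <;> simp

lemma coeff_eq_zero_of_homogeneousComponent {n : ℕ} {f : Germ} (h : homogeneousComponent n f = 0)
    {m : Fin 2 →₀ ℕ} (hm : m 0 + m 1 = n) : coeff m f = 0 := by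
  have := congrArg (coeff m) h
  rwa [coeff_homogeneousComponent, Finsupp.degree_eq_sum, Fin.sum_univ_two, if_pos hm] at this

/-- An `n`-fold point with an infinitely near `n`-fold point has weighted order `2 n`, and meets the
transverse axis with multiplicity `n`. -/
lemma IsInfNearGerm.weighted_order {n : ℕ} {f : Germ} (h : IsInfNearGerm n f) :
    Polynomial.X ^ (2 * n) ∣ scale 2 f ∧ coeff (Finsupp.single 1 n) f ≠ 0 := by
  obtain ⟨⟨h1, h2⟩, f', hs, h3, h4⟩ := h
  have key : ∀ m : Fin 2 →₀ ℕ, m 0 + 2 * m 1 < 2 * n → coeff m f = 0 := by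
    intro m hm
    by_cases hmn : m 0 + m 1 < n
    · exact coeff_eq_zero_of_homogeneousComponent (h1 _ hmn) rfl
    · obtain ⟨k, hk⟩ := Nat.exists_eq_add_of_le (not_lt.mp hmn)
      have := hs.coeff_eq (i := m 0) (j := m 1) (k := k) (by omega)
      rw [finsupp_fin_two] at this
      rw [← this]
      exact coeff_eq_zero_of_homogeneousComponent (h3 (k + m 1) (by omega)) (by simp)
  refine ⟨X_pow_dvd_scale.mpr key, fun h0 => h2 ?_⟩
  ext m
  rw [coeff_homogeneousComponent, coeff_zero, Finsupp.degree_eq_sum, Fin.sum_univ_two]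
  split_ifs with hm
  · by_cases hm1 : m 1 = n
    · rw [← h0]
      congr 1
      rw [← finsupp_fin_two m, hm1, show m 0 = 0 by omega]
      simp
    · exact key m (by omega)
  · rfl

lemma isOrdinaryGerm_of_scale {n : ℕ} {f : Germ} (a b : Fin n → ℂ)
    (h : Polynomial.X ^ n ∣ scale 1 f)
    (hn : (scale 1 f).coeff n = ∏ i, (C (a i) * X 0 + C (b i) * X 1))
    (h0 : ∀ i, a i ≠ 0 ∨ b i ≠ 0) (hab : ∀ i j, i ≠ j → a i * b j ≠ a j * b i) :
    IsOrdinaryGerm n f := by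
  refine ⟨⟨fun k hk => ?_, ?_⟩, a, b, ?_, hab⟩
  · rw [← scale_one_coeff]; exact Polynomial.X_pow_dvd_iff.mp h k hk
  · rw [← scale_one_coeff, hn, Finset.prod_ne_zero_iff]
    intro i _ hi
    have e0 := congrArg (eval ![1, 0]) hi
    have e1 := congrArg (eval ![0, 1]) hi
    simp at e0 e1
    rcases h0 i with h | h
    · exact h e0
    · exact h e1
  · rw [← scale_one_coeff, hn]

lemma coeff_expand_first (f : Germ) (m : Fin 2 →₀ ℕ) :
    coeff (Finsupp.single 0 (2 * m 0) + Finsupp.single 1 (m 1))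
      (aeval (![X 0 ^ 2, X 1] : Fin 2 → Germ) f) = coeff m f := by
  induction f using MvPolynomial.induction_on' with
  | monomial k c =>
    have : aeval (![X 0 ^ 2, X 1] : Fin 2 → Germ) (monomial k c) =
        monomial (Finsupp.single 0 (2 * k 0) + Finsupp.single 1 (k 1)) c := by
      rw [aeval_monomial, Finsupp.prod_fintype _ _ (by simp), monomial_eq,
        Finsupp.prod_fintype _ _ (by simp)]
      simp only [algebraMap_eq, Fin.prod_univ_two, Matrix.cons_val_zero, Matrix.cons_val_one,
        Finsupp.add_apply, Finsupp.single_eq_same, ne_eq, one_ne_zero, zero_ne_one,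
        not_false_eq_true, Finsupp.single_eq_of_ne, add_zero, zero_add]
      ring
    rw [this, coeff_monomial, coeff_monomial]
    congr 1
    rw [eq_iff_iff, Finsupp.ext_iff, Finsupp.ext_iff]
    simp [Fin.forall_fin_two]
  | add p q hp hq => rw [map_add, coeff_add, coeff_add, hp, hq]

/-- If the part of weight `2 n` of a germ of weighted order `2 n` is a product of `n` distinct
factors `a x² + b y` with `b ≠ 0`, the infinitely near `n`-fold point is ordinary. -/
lemma isNondegInfNearGerm_of_scale {n : ℕ} {f : Germ} (a b : Fin n → ℂ)
    (h : Polynomial.X ^ (2 * n) ∣ scale 2 f)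
    (hn : (scale 2 f).coeff (2 * n) = ∏ i, (C (a i) * X 0 ^ 2 + C (b i) * X 1))
    (hb : ∀ i, b i ≠ 0) (hab : ∀ i j, i ≠ j → a i * b j ≠ a j * b i) :
    IsNondegInfNearGerm n f := by
  have hlow := X_pow_dvd_scale.mp h
  have hinit : ∀ m : Fin 2 →₀ ℕ, m 0 + 2 * m 1 = 2 * n →
      coeff m f = coeff m (∏ i, (C (a i) * X 0 ^ 2 + C (b i) * X 1) : Germ) := by
    intro m hm
    rw [← hn, coeff_scale, if_pos hm]
  -- the strict transform, monomial by monomial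
  have hst : IsStrictTransform n f (∑ m ∈ f.support,
      monomial (Finsupp.single 0 (m 0 + m 1 - n) + Finsupp.single 1 (m 1)) (coeff m f)) := by
    rw [IsStrictTransform]
    conv_lhs => rw [f.as_sum, map_sum]
    rw [Finset.mul_sum]
    refine Finset.sum_congr rfl fun m hm => ?_
    have hw : 2 * n ≤ m 0 + 2 * m 1 := by
      by_contra! hlt
      exact mem_support_iff.mp hm (hlow m hlt)
    have hmn : n ≤ m 0 + m 1 := by omega
    rw [aeval_monomial, Finsupp.prod_fintype _ _ (by simp), monomial_eq,
      Finsupp.prod_fintype _ _ (by simp)]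
    simp only [algebraMap_eq, Fin.prod_univ_two, Matrix.cons_val_zero, Matrix.cons_val_one,
      Finsupp.add_apply, Finsupp.single_apply]
    simp only [if_true, Fin.zero_eq_one_iff, Fin.one_eq_zero_iff, OfNat.ofNat_ne_one, if_false,
      add_zero, zero_add]
    obtain ⟨k, hk⟩ := Nat.exists_eq_add_of_le hmn
    rw [hk, Nat.add_sub_cancel_left, mul_pow]
    have : (X 0 : Germ) ^ m 0 * X 0 ^ m 1 = X 0 ^ n * X 0 ^ k := by
      rw [← pow_add, ← pow_add, hk]
    linear_combination C (coeff m f) * X 1 ^ m 1 * this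
  set f' : Germ := ∑ m ∈ f.support,
      monomial (Finsupp.single 0 (m 0 + m 1 - n) + Finsupp.single 1 (m 1)) (coeff m f)
  have hcoef : ∀ m : Fin 2 →₀ ℕ, m 1 ≤ m 0 + n → coeff m f' =
      coeff (Finsupp.single 0 (m 0 + n - m 1) + Finsupp.single 1 (m 1)) f := by
    intro m hm
    have := hst.coeff_eq (i := m 0 + n - m 1) (j := m 1) (k := m 0) (by omega)
    rwa [finsupp_fin_two] at this
  have hf'n : homogeneousComponent n f' = ∏ i, (C (a i) * X 0 + C (b i) * X 1) := by
    have hhom : (∏ i, (C (a i) * X 0 + C (b i) * X 1) : Germ).IsHomogeneous n := by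
      have := IsHomogeneous.prod Finset.univ (fun i => (C (a i) * X 0 + C (b i) * X 1 : Germ))
        (fun _ => 1) fun i _ => (isHomogeneous_C_mul_X _ _).add (isHomogeneous_C_mul_X _ _)
      simpa using this
    have hsub : aeval (![X 0 ^ 2, X 1] : Fin 2 → Germ) (∏ i, (C (a i) * X 0 + C (b i) * X 1)) =
        ∏ i, (C (a i) * X 0 ^ 2 + C (b i) * X 1) := by
      rw [map_prod]
      simp [algebraMap_eq]
    ext m
    rw [coeff_homogeneousComponent]
    split_ifs with hm
    · rw [Finsupp.degree_eq_sum, Fin.sum_univ_two] at hm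
      rw [hcoef m (by omega), hinit _ (by simp; omega), ← hsub, ← coeff_expand_first _ m]
      congr 3
      omega
    · exact (hhom.coeff_eq_zero hm).symm
  have hprod0 : (∏ i, (C (a i) * X 0 + C (b i) * X 1) : Germ) ≠ 0 := by
    rw [Finset.prod_ne_zero_iff]
    intro i _ hi
    have e1 := congrArg (eval ![0, 1]) hi
    simp at e1
    exact hb i e1
  refine ⟨⟨fun k hk => ?_, fun h0 => ?_⟩, f', hst, ⟨fun k hk => ?_, ?_⟩, a, b, hf'n, hab⟩
  · ext m
    rw [coeff_homogeneousComponent, coeff_zero]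
    split_ifs with hm
    · rw [Finsupp.degree_eq_sum, Fin.sum_univ_two] at hm
      exact hlow m (by omega)
    · rfl
  · have h1 : coeff (Finsupp.single 1 n) f = 0 :=
      coeff_eq_zero_of_homogeneousComponent h0 (by simp)
    rw [hinit _ (by simp), ← coeff_restrictY, map_prod] at h1
    have h2 : ∀ i, restrictY (C (a i) * X 0 ^ 2 + C (b i) * X 1) =
        Polynomial.C (b i) * Polynomial.X := by
      intro i
      have : ∀ c, restrictY (C c) = Polynomial.C c := fun c => by
        rw [← algebraMap_eq, AlgHom.commutes]; rfl
      rw [map_add, map_mul, map_mul, this, this, map_pow]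
      simp [restrictY]
    simp only [h2, Finset.prod_mul_distrib, Finset.prod_const, Finset.card_univ,
      Fintype.card_fin, ← map_prod, Polynomial.coeff_C_mul_X_pow, if_true] at h1
    exact Finset.prod_ne_zero_iff.mpr (fun i _ => hb i) h1
  · ext m
    rw [coeff_homogeneousComponent, coeff_zero]
    split_ifs with hm
    · rw [Finsupp.degree_eq_sum, Fin.sum_univ_two] at hm
      rw [hcoef m (by omega)]
      exact hlow _ (by simp; omega)
    · rfl
  · rw [hf'n]; exact hprod0

/-! ### First derivatives -/

lemma pderiv_localEquation (F : Form) (v u w : Fin 3 → ℂ) :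
    pderiv 0 (localEquation F v u w) = ∑ i, C (u i) * localEquation (pderiv i F) v u w ∧
    pderiv 1 (localEquation F v u w) = ∑ i, C (w i) * localEquation (pderiv i F) v u w := by
  induction F using MvPolynomial.induction_on with
  | C c => simp [localEquation]
  | add p q hp hq =>
    have h : ∀ f g : Form, localEquation (f + g) v u w =
      localEquation f v u w + localEquation g v u w := fun f g => map_add _ _ _
    simp only [h, map_add, hp.1, hp.2, hq.1, hq.2, mul_add, Finset.sum_add_distrib, and_self]
  | mul_X p j hp =>
    have h : ∀ f g : Form, localEquation (f * g) v u w =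
      localEquation f v u w * localEquation g v u w := fun f g => map_mul _ _ _
    have h' : ∀ f g : Form, localEquation (f + g) v u w =
      localEquation f v u w + localEquation g v u w := fun f g => map_add _ _ _
    have hX : localEquation (X j) v u w = C (v j) + C (u j) * X 0 + C (w j) * X 1 := by
      simp [localEquation]
    have hd : ∀ i, localEquation (pderiv i (p * X j)) v u w =
        localEquation (pderiv i p) v u w * localEquation (X j) v u w +
          localEquation p v u w * (if i = j then 1 else 0) := by
      intro i
      rw [pderiv_mul, h', h, h, pderiv_X]
      congr 2
      simp only [Pi.single_apply, eq_comm (a := j)]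
      split_ifs
      · exact map_one _
      · exact map_zero _
    constructor
    · rw [h, pderiv_mul, hp.1]
      simp only [hd, mul_add, Finset.sum_add_distrib, mul_ite, mul_one, mul_zero,
        Finset.sum_ite_eq', Finset.mem_univ, if_true, Finset.sum_mul]
      rw [hX]
      simp [pderiv_X, mul_comm]
      exact Finset.sum_congr rfl fun _ _ => by ring
    · rw [h, pderiv_mul, hp.2]
      simp only [hd, mul_add, Finset.sum_add_distrib, mul_ite, mul_one, mul_zero,
        Finset.sum_ite_eq', Finset.mem_univ, if_true, Finset.sum_mul]
      rw [hX]
      simp [pderiv_X, mul_comm]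
      exact Finset.sum_congr rfl fun _ _ => by ring

lemma constantCoeff_localEquation (F : Form) (v u w : Fin 3 → ℂ) :
    coeff 0 (localEquation F v u w) = eval v F := by
  have : (constantCoeff : Germ →+* ℂ).comp ((aeval (fun i =>
      C (v i) + C (u i) * X 0 + C (w i) * X 1 :
      Fin 3 → Germ) : Form →ₐ[ℂ] Germ) : Form →+* Germ) = eval v := by
    apply MvPolynomial.ringHom_ext
    · intro r; simp [algebraMap_eq]
    · intro i; simp
  exact congrArg (fun f => f F) this

lemma coeff_single_one (f : Germ) (i : Fin 2) :
    coeff (Finsupp.single i 1) f = coeff 0 (pderiv i f) := by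
  induction f using MvPolynomial.induction_on' with
  | monomial k c =>
    rw [pderiv_monomial, coeff_monomial, coeff_monomial]
    by_cases h : k = Finsupp.single i 1
    · subst h; simp
    · rw [if_neg h]
      split_ifs with h2
      · have hki : k i = 0 := by
          by_contra hne
          apply h
          have hle : Finsupp.single i 1 ≤ k := by
            rw [Finsupp.single_le_iff]; omega
          rw [← tsub_add_cancel_of_le hle, h2, zero_add]
        simp [hki]
      · rfl
  | add p q hp hq => rw [coeff_add, map_add, coeff_add, hp, hq]

lemma coeff_localEquation_x (F : Form) (v u w : Fin 3 → ℂ) :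
    coeff (Finsupp.single 0 1) (localEquation F v u w) = ∑ i, u i * eval v (pderiv i F) := by
  rw [coeff_single_one, (pderiv_localEquation F v u w).1, coeff_sum]
  simp [coeff_C_mul, constantCoeff_localEquation]

lemma coeff_localEquation_y (F : Form) (v u w : Fin 3 → ℂ) :
    coeff (Finsupp.single 1 1) (localEquation F v u w) = ∑ i, w i * eval v (pderiv i F) := by
  rw [coeff_single_one, (pderiv_localEquation F v u w).2, coeff_sum]
  simp [coeff_C_mul, constantCoeff_localEquation]

lemma ordGE_two_of_isSingularAt {A : WeightedFrame} (hA : A.e = 1) {F : Form} {d : ℕ}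
    (hF : F.IsHomogeneous d) (h : IsSingularAt F A.p) : A.OrdGE 2 F := by
  obtain ⟨c, hc, hv⟩ := A.exists_smul_rep
  have h0 : eval A.v F = 0 := by
    rw [hv, eval_smul_of_isHomogeneous hF, show eval A.p.rep F = 0 from h.1, mul_zero]
  have h1 : ∀ i, eval A.v (pderiv i F) = 0 := fun i => by
    rw [hv, eval_smul_of_isHomogeneous hF.pderiv, h.2 i, mul_zero]
  rw [WeightedFrame.ordGE_iff]
  intro m hm
  rw [hA] at hm
  have hcases : (m 0 = 0 ∧ m 1 = 0) ∨ (m 0 = 1 ∧ m 1 = 0) ∨ (m 0 = 0 ∧ m 1 = 1) := by omega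
  rw [← finsupp_fin_two m]
  rcases hcases with ⟨e0, e1⟩ | ⟨e0, e1⟩ | ⟨e0, e1⟩
  · rw [e0, e1]; simp only [Finsupp.single_zero, add_zero]
    rw [constantCoeff_localEquation, h0]
  · rw [e0, e1]; simp only [Finsupp.single_zero, add_zero]
    rw [coeff_localEquation_x]; simp [h1]
  · rw [e0, e1]; simp only [Finsupp.single_zero, zero_add]
    rw [coeff_localEquation_y]; simp [h1]

lemma isTangentAt_of_ordGE {A : WeightedFrame} {F : Form} {d : ℕ}
    (hF : F.IsHomogeneous d) {L : Line} (hLv : L.rep ⬝ᵥ A.v = 0) (hLu : L.rep ⬝ᵥ A.u = 0)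
    (h : A.OrdGE 2 F) (hy : coeff (Finsupp.single 1 1) (localEquation F A.v A.u A.w) ≠ 0) :
    IsTangentAt F A.p L := by
  obtain ⟨k, hk, hv⟩ := A.exists_smul_rep
  have h1 : A.OrdGE 1 F := h.mono (by norm_num)
  have hF0 : eval A.v F = 0 := (A.ordGE_one_iff F).mp h1
  set g : Fin 3 → ℂ := fun i => eval A.v (pderiv i F) with hg
  have gv : g ⬝ᵥ A.v = 0 := by
    have := congrArg (eval A.v) hF.sum_X_mul_pderiv
    rw [map_sum, map_nsmul, hF0, smul_zero] at this
    simpa [dotProduct, hg, mul_comm] using this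
  have gu : g ⬝ᵥ A.u = 0 := by
    have := (A.ordGE_iff 2 F).mp h (Finsupp.single 0 1) (by simp)
    rw [coeff_localEquation_x] at this
    simpa [dotProduct, hg, mul_comm] using this
  have gw : g ⬝ᵥ A.w ≠ 0 := by
    rw [coeff_localEquation_y] at hy
    simpa [dotProduct, hg, mul_comm] using hy
  obtain ⟨a, b, c, ha, hb, hc, hz⟩ := exists_dual A.isFrame.2
  have e1 : ∀ z, L.rep ⬝ᵥ z = (c ⬝ᵥ z) * (L.rep ⬝ᵥ A.w) := by
    intro z
    conv_lhs => rw [hz z]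
    simp [dotProduct_add, hLv, hLu]
  have e2 : ∀ z, g ⬝ᵥ z = (c ⬝ᵥ z) * (g ⬝ᵥ A.w) := by
    intro z
    conv_lhs => rw [hz z]
    simp [dotProduct_add, gv, gu]
  have lw : L.rep ⬝ᵥ A.w ≠ 0 := by
    intro h0
    apply L.rep_nonzero
    ext i
    have := e1 (Pi.single i 1)
    simpa [h0] using this
  refine ⟨?_, (k ^ (d - 1))⁻¹ * (g ⬝ᵥ A.w / L.rep ⬝ᵥ A.w),
    mul_ne_zero (inv_ne_zero (pow_ne_zero _ hk)) (div_ne_zero gw lw), fun i => ?_⟩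
  · rw [A.passesThrough_iff hF]; exact h1
  · have hi : g i = k ^ (d - 1) * eval A.p.rep (pderiv i F) := by
      rw [hg]; simp only
      rw [hv, eval_smul_of_isHomogeneous hF.pderiv]
    have s1 := e1 (Pi.single i 1)
    have s2 := e2 (Pi.single i 1)
    simp only [dotProduct_single, mul_one] at s1 s2
    rw [hi] at s2
    have hk' : k ^ (d - 1) ≠ 0 := pow_ne_zero _ hk
    field_simp
    rw [mul_comm (eval _ _), s2, s1]
    ring

/-! ### Components of a plane curve -/

/-- The substitution `X i ↦ T X i`, which separates the homogeneous components of a polynomial. -/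
def degreeExpansion : Form →ₐ[ℂ] Polynomial Form :=
  aeval fun i => Polynomial.C (X i) * Polynomial.X

lemma degreeExpansion_monomial (m : Fin 3 →₀ ℕ) (c : ℂ) :
    degreeExpansion (monomial m c) = Polynomial.monomial m.degree (monomial m c) := by
  rw [degreeExpansion, aeval_monomial, Finsupp.prod_fintype _ _ (by simp), monomial_eq,
    Finsupp.prod_fintype _ _ (by simp), ← Polynomial.C_mul_X_pow_eq_monomial,
    Finsupp.degree_eq_sum, ← Finset.prod_pow_eq_pow_sum]
  simp only [mul_pow, Finset.prod_mul_distrib, map_mul, map_prod, map_pow]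
  have : (algebraMap ℂ (Polynomial Form)) c = Polynomial.C (C c) := rfl
  rw [this, mul_assoc]

lemma coeff_degreeExpansion (P : Form) (k : ℕ) :
    (degreeExpansion P).coeff k = homogeneousComponent k P := by
  induction P using MvPolynomial.induction_on' with
  | monomial m c =>
    rw [degreeExpansion_monomial, Polynomial.coeff_monomial,
      homogeneousComponent_of_mem (isHomogeneous_monomial c rfl)]
    simp only [eq_comm]
  | add p q hp hq => rw [map_add, Polynomial.coeff_add, hp, hq, map_add]

lemma degreeExpansion_ne_zero {P : Form} (hP : P ≠ 0) : degreeExpansion P ≠ 0 := by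
  intro h
  apply hP
  rw [← sum_homogeneousComponent P]
  exact Finset.sum_eq_zero fun k _ => by rw [← coeff_degreeExpansion, h, Polynomial.coeff_zero]

lemma degreeExpansion_of_isHomogeneous {F : Form} {n : ℕ} (hF : F.IsHomogeneous n) :
    degreeExpansion F = Polynomial.monomial n F := by
  ext1 k
  rw [coeff_degreeExpansion, Polynomial.coeff_monomial, homogeneousComponent_of_mem hF]
  simp only [eq_comm]

/-- A factor of a form is a form. -/
lemma exists_isHomogeneous_of_dvd {F G : Form} {n : ℕ} (hF : F.IsHomogeneous n) (h0 : F ≠ 0)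
    (h : G ∣ F) : ∃ k, G.IsHomogeneous k := by
  obtain ⟨H, rfl⟩ := h
  have hG0 := degreeExpansion_ne_zero (left_ne_zero_of_mul h0)
  have hH0 := degreeExpansion_ne_zero (right_ne_zero_of_mul h0)
  have hFm := degreeExpansion_of_isHomogeneous hF
  -- lowest and highest degrees are additive, and agree for `F`
  have h1 := Polynomial.natDegree_mul hG0 hH0
  have h2 := Polynomial.natTrailingDegree_mul hG0 hH0
  rw [← map_mul, hFm, Polynomial.natDegree_monomial, if_neg h0] at h1
  rw [← map_mul, hFm, Polynomial.natTrailingDegree_monomial h0] at h2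
  have h3 := Polynomial.natTrailingDegree_le_natDegree (degreeExpansion G)
  have h4 := Polynomial.natTrailingDegree_le_natDegree (degreeExpansion H)
  have h5 : (degreeExpansion G).natTrailingDegree = (degreeExpansion G).natDegree := by omega
  refine ⟨(degreeExpansion G).natDegree, ?_⟩
  have hG : homogeneousComponent (degreeExpansion G).natDegree G = G := by
    conv_rhs => rw [← sum_homogeneousComponent G]
    by_cases hmem : (degreeExpansion G).natDegree ∈ Finset.range (G.totalDegree + 1)
    · rw [Finset.sum_eq_single_of_mem _ hmem]
      intro k _ hk
      rw [← coeff_degreeExpansion]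
      rcases lt_or_gt_of_ne hk with h | h
      · exact Polynomial.coeff_eq_zero_of_lt_natTrailingDegree (by omega)
      · exact Polynomial.coeff_eq_zero_of_natDegree_lt h
    · exfalso
      rw [Finset.mem_range, not_lt] at hmem
      have := homogeneousComponent_eq_zero (degreeExpansion G).natDegree G (by omega)
      rw [← coeff_degreeExpansion] at this
      exact hG0 (Polynomial.leadingCoeff_eq_zero.mp this)
  have h := homogeneousComponent_isHomogeneous (degreeExpansion G).natDegree G
  rwa [hG] at h

lemma exists_factorization {F : Form} (h0 : F ≠ 0) (hu : ¬ IsUnit F) :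
    ∃ (r : ℕ) (D : Fin r → Form), (∀ i, Irreducible (D i)) ∧ F = ∏ i, D i := by
  obtain ⟨f, hf, hprod, -⟩ := (WfDvdMonoid.not_isUnit_iff_exists_factors_eq F h0).mp hu
  refine ⟨f.toList.length, f.toList.get, fun i => hf _ ?_, ?_⟩
  · rw [← Multiset.mem_toList]; exact List.get_mem _ _
  · rw [← hprod, ← Multiset.prod_toList]
    exact (Fin.prod_univ_getElem f.toList).symm

lemma not_dvd_of_degree_lt {F G : Form} {d d' : ℕ} (hF : F.IsHomogeneous d)
    (hG : G.IsHomogeneous d') (h0 : G ≠ 0) (h : d' < d) : ¬ F ∣ G := by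
  intro hdvd
  have h1 := totalDegree_le_of_dvd_of_isDomain hdvd h0
  have hF0 : F ≠ 0 := fun h => h0 (by rw [h] at hdvd; exact zero_dvd_iff.mp hdvd)
  rw [hF.totalDegree hF0, hG.totalDegree h0] at h1
  omega

lemma degree_ne_zero_of_irreducible {F : Form} {d : ℕ} (hF : F.IsHomogeneous d)
    (h : Irreducible F) : d ≠ 0 := by
  rintro rfl
  have h1 := (totalDegree_eq_zero_iff_eq_C (p := F)).mp (hF.totalDegree h.ne_zero)
  apply h.not_isUnit
  rw [h1]
  have : coeff 0 F ≠ 0 := fun h0 => h.ne_zero (by rw [h1, h0, C_0])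
  exact (isUnit_iff_ne_zero.mpr this).map C

lemma IsReducedAt.of_dvd {F G : Form} {p : Point} (h : IsReducedAt F p) (hG : G ∣ F) :
    IsReducedAt G p := fun K hK hKG => h K hK (hKG.trans hG)

lemma linForm_irreducible {a : Fin 3 → ℂ} (h : a ≠ 0) : Irreducible (linForm a) := by
  have h1 := linForm_isHomogeneous a
  have h0 := linForm_ne_zero h
  have key : ∀ G : Form, G.IsHomogeneous 0 → G ≠ 0 → IsUnit G := by
    intro G hG hG0
    have h1 := (totalDegree_eq_zero_iff_eq_C (p := G)).mp (hG.totalDegree hG0)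
    rw [h1]
    have : coeff 0 G ≠ 0 := fun h0 => hG0 (by rw [h1, h0, C_0])
    exact (isUnit_iff_ne_zero.mpr this).map C
  rw [irreducible_iff]
  refine ⟨fun hu => ?_, fun G H hGH => ?_⟩
  · obtain ⟨H, hH⟩ := hu.exists_right_inv
    have hd : linForm a ∣ (1 : Form) := ⟨H, hH.symm⟩
    exact not_dvd_of_degree_lt h1 (isHomogeneous_one _ _) one_ne_zero one_pos hd
  · have hGH0 : G * H ≠ 0 := hGH ▸ h0
    obtain ⟨k, hk⟩ := exists_isHomogeneous_of_dvd h1 h0 ⟨H, hGH⟩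
    obtain ⟨l, hl⟩ := exists_isHomogeneous_of_dvd h1 h0 (Dvd.intro_left _ hGH.symm)
    have hkl : k + l = 1 := (hk.mul hl).inj_right (hGH ▸ h1) hGH0
    rcases Nat.eq_zero_or_pos k with h | h
    · subst h; exact Or.inl (key G hk (left_ne_zero_of_mul hGH0))
    · exact Or.inr (key H (by rwa [show l = 0 by omega] at hl) (right_ne_zero_of_mul hGH0))

/-- The frames at the three `[3;3]`-points (weights `(1, 2)`, along the distinguished tangent lines)
and at the quadruple point (weights `(1, 1)`, index `none`). -/
structure FrameSystem (p : Fin 3 → Point) (L : Fin 3 → Line) (p₄ : Point) where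
  /-- the frames -/
  A : Option (Fin 3) → WeightedFrame
  p_none : (A none).p = p₄
  e_none : (A none).e = 1
  p_some : ∀ k, (A (some k)).p = p k
  e_some : ∀ k, (A (some k)).e = 2
  dot_v : ∀ k, (L k).rep ⬝ᵥ (A (some k)).v = 0
  dot_u : ∀ k, (L k).rep ⬝ᵥ (A (some k)).u = 0
  inj : Function.Injective fun t => (A t).p

variable {p : Fin 3 → Point} {L : Fin 3 → Line} {p₄ : Point}

/-- `D` is an irreducible curve of degree `d`, of multiplicity `b` at the quadruple point, and of
the weighted order `2 (a k)` of an `[a k; a k]`-point at the `k`-th `[3;3]`-point. The order along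
the transverse axis is exactly `a k` there, so that `D` has no larger weighted order. -/
structure FrameSystem.HasType (S : FrameSystem p L p₄) (D : Form) (d : ℕ) (a : Fin 3 → ℕ)
    (b : ℕ) : Prop where
  irr : Irreducible D
  hom : D.IsHomogeneous d
  ord : ∀ k, (S.A (some k)).OrdGE (2 * a k) D
  coeff_ne : ∀ k, coeff (Finsupp.single 1 (a k))
    (localEquation D (S.A (some k)).v (S.A (some k)).u (S.A (some k)).w) ≠ 0
  mult : ∀ n, (S.A none).OrdGE n D ↔ n ≤ b

namespace FrameSystem
variable {S : FrameSystem p L p₄} {D D' G : Form} {d d' b b' : ℕ} {a a' : Fin 3 → ℕ}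

/-- The multiplicities of a component at the four points, as a function on the index set. -/
def mults (a : Fin 3 → ℕ) (b : ℕ) : Option (Fin 3) → ℕ := fun t => t.elim b a

lemma HasType.ord_mults (h : S.HasType D d a b) (t : Option (Fin 3)) :
    (S.A t).OrdGE ((S.A t).e * mults a b t) D := by
  cases t with
  | none => rw [S.e_none, one_mul]; exact (h.mult b).mpr le_rfl
  | some k => rw [S.e_some]; exact h.ord k

lemma sum_mults (S : FrameSystem p L p₄) (f : ℕ → ℕ → ℕ) :
    ∑ t, (S.A t).e * f (mults a b t) (mults a' b' t) = f b b' + 2 * ∑ k, f (a k) (a' k) := by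
  rw [Fintype.sum_option, S.e_none, one_mul, Finset.mul_sum]
  simp [S.e_some, mults]

lemma HasType.genus (h : S.HasType D d a b) :
    2 * (∑ k, a k * (a k - 1)) + b * (b - 1) + 3 * d ≤ d * d + 2 := by
  have := genus_bound S.inj (mults a b) (degree_ne_zero_of_irreducible h.hom h.irr) h.hom h.irr
    h.ord_mults
  rw [S.sum_mults (a' := a) (b' := b) fun x _ => x * (x - 1)] at this
  omega

/-- Bézout's inequality for a component and a curve that does not contain it, with further
points. -/
lemma HasType.bezout_of_not_dvd (h : S.HasType D d a b) (hG : G.IsHomogeneous d')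
    (hdvd : ¬ D ∣ G) (ha' : ∀ k, (S.A (some k)).OrdGE (2 * a' k) G)
    (hb' : (S.A none).OrdGE b' G) {n : ℕ} (B : Fin n → WeightedFrame)
    (hB : Function.Injective fun j => (B j).p) (hAB : ∀ t j, (S.A t).p ≠ (B j).p)
    (hBe : ∀ j, (B j).e = 1) (hBD : ∀ j, (B j).OrdGE 1 D) (hBG : ∀ j, (B j).OrdGE 1 G) :
    2 * (∑ k, a k * a' k) + b * b' + n ≤ d * d' := by
  have hG0 : G ≠ 0 := by rintro rfl; exact hdvd (dvd_zero _)
  have := bezout (A := Sum.elim S.A B) (by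
    rintro (i | i) (j | j) hij
    · exact congrArg _ (S.inj hij)
    · exact absurd hij (hAB i j)
    · exact absurd hij.symm (hAB j i)
    · exact congrArg _ (hB hij)) (Sum.elim (mults a b) fun _ => 1)
    (Sum.elim (mults a' b') fun _ => 1) h.hom hG h.irr.ne_zero hG0
    (h.irr.isRelPrime_iff_not_dvd.mpr hdvd) (by
      rintro (t | j)
      · exact h.ord_mults t
      · simpa [hBe] using hBD j) (by
      rintro ((_ | k) | j)
      · rw [Sum.elim_inl, Sum.elim_inl, S.e_none, one_mul]; exact hb'
      · rw [Sum.elim_inl, Sum.elim_inl, S.e_some]; exact ha' k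
      · simpa [hBe] using hBG j)
  rw [Fintype.sum_sum_type] at this
  simp only [Sum.elim_inl, Sum.elim_inr, hBe] at this
  rw [S.sum_mults fun x y => x * y] at this
  simp at this
  omega

lemma HasType.bezout (h : S.HasType D d a b) (h' : S.HasType D' d' a' b') (hdvd : ¬ D ∣ D') :
    2 * (∑ k, a k * a' k) + b * b' ≤ d * d' :=
  h.bezout_of_not_dvd h'.hom hdvd h'.ord ((h'.mult b').mpr le_rfl) (n := 0) Fin.elim0
    (fun j => j.elim0) (fun _ j => j.elim0) (fun j => j.elim0) (fun j => j.elim0) fun j => j.elim0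

lemma HasType.passesThrough (h : S.HasType D d a b) {k : Fin 3} (hk : 1 ≤ a k) :
    PassesThrough D (p k) := by
  rw [← S.p_some, WeightedFrame.passesThrough_iff _ h.hom]
  exact (h.ord k).mono (by omega)

lemma HasType.passesThrough_none (h : S.HasType D d a b) (hb : 1 ≤ b) : PassesThrough D p₄ := by
  rw [← S.p_none, WeightedFrame.passesThrough_iff _ h.hom]
  exact (h.mult 1).mpr hb

/-- A frame of weight `1` at any of the points. -/
lemma exists_weight_one (A : WeightedFrame) :
    ∃ B : WeightedFrame, B.p = A.p ∧ B.v = A.v ∧ B.u = A.u ∧ B.w = A.w ∧ B.e = 1 :=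
  ⟨⟨A.p, A.v, A.u, A.w, 1, A.isFrame, one_pos⟩, rfl, rfl, rfl, rfl, rfl⟩

/-- The frames given by the hypotheses. The quadruple point differs from the `[3;3]`-points because
the transverse axis of a `[3;3]`-point meets the curve with multiplicity `3`. -/
lemma exists_frameSystem {F : Form} (hF : F.IsHomogeneous 8) (hp : Function.Injective p)
    (h33 : ∀ i, IsInfNearPoint 3 F (p i) (L i)) (h4 : IsNFoldPoint 4 F p₄) :
    ∃ S : FrameSystem p L p₄, F ≠ 0 ∧
      (∀ k, (S.A (some k)).OrdGE 6 F) ∧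
      (∀ k, coeff (Finsupp.single 1 3)
        (localEquation F (S.A (some k)).v (S.A (some k)).u (S.A (some k)).w) ≠ 0) ∧
      (S.A none).loc F ≠ 0 ∧ ((S.A none).loc F).natTrailingDegree = 4 := by
  choose _ v u w hfr hgerm using h33
  obtain ⟨_, v₄, u₄, w₄, hfr₄, hgerm₄⟩ := h4
  let A₄ : WeightedFrame := ⟨p₄, v₄, u₄, w₄, 1, hfr₄, one_pos⟩
  let A : Option (Fin 3) → WeightedFrame := fun t => t.elim A₄
    fun k => ⟨p k, v k, u k, w k, 2, (hfr k).1, two_pos⟩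
  have hloc₄ := hgerm₄.natTrailingDegree_scale
  -- a germ of multiplicity `4` cannot have order `3` along the transverse axis
  have hne : ∀ k, p k ≠ p₄ := by
    intro k hk
    obtain ⟨B, hBp, hBv, hBu, hBw, hBe⟩ := exists_weight_one (A (some k))
    have h1 : A₄.OrdGE 4 F :=
      (X_pow_dvd_iff_le_natTrailingDegree hloc₄.1 4).mpr hloc₄.2.ge
    have h2 : B.OrdGE 4 F := h1.of_weight_one hF (by rw [hBp]; exact hk.symm) rfl
    rw [B.ordGE_iff, hBe, hBv, hBu, hBw] at h2
    exact (hgerm k).weighted_order.2 (h2 _ (by simp))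
  refine ⟨⟨A, rfl, rfl, fun _ => rfl, fun _ => rfl, fun k => (hfr k).2.1, fun k => (hfr k).2.2, ?_⟩,
    ?_, fun k => (hgerm k).weighted_order.1, fun k => (hgerm k).weighted_order.2, hloc₄.1,
    hloc₄.2⟩
  · rintro (_ | i) (_ | j) hij
    · rfl
    · exact absurd hij.symm (hne j)
    · exact absurd hij (hne i)
    · exact congrArg _ (hp hij)
  · rintro rfl
    exact hloc₄.1 (map_zero _)

/-- The decomposition of the octic into irreducible components, with their numerical types. -/
lemma exists_components {F : Form} (hF : F.IsHomogeneous 8) (S : FrameSystem p L p₄) (h0 : F ≠ 0)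
    (h33 : ∀ i, IsReducedAt F (p i)) (h4 : IsReducedAt F p₄)
    (hord : ∀ k, (S.A (some k)).OrdGE 6 F)
    (hcoeff : ∀ k, coeff (Finsupp.single 1 3)
        (localEquation F (S.A (some k)).v (S.A (some k)).u (S.A (some k)).w) ≠ 0)
    (hloc : (S.A none).loc F ≠ 0) (hmult : ((S.A none).loc F).natTrailingDegree = 4) :
    ∃ (r : ℕ) (D : Fin r → Form) (d b : Fin r → ℕ) (a : Fin r → Fin 3 → ℕ),
      F = ∏ i, D i ∧ (∀ i, S.HasType (D i) (d i) (a i) (b i)) ∧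
      ∑ i, d i = 8 ∧ (∀ k, ∑ i, a i k = 3) ∧ ∑ i, b i = 4 ∧
      ∀ i j, i ≠ j → 2 * (∑ k, a i k * a j k) + b i * b j ≤ d i * d j := by
  have hu : ¬ IsUnit F := by
    intro hu
    obtain ⟨H, hH⟩ := hu.exists_right_inv
    exact not_dvd_of_degree_lt hF (isHomogeneous_one _ _) one_ne_zero (by norm_num) ⟨H, hH.symm⟩
  obtain ⟨r, D, hirr, hprod⟩ := exists_factorization h0 hu
  have hdvd : ∀ i, D i ∣ F := fun i => hprod ▸ Finset.dvd_prod_of_mem _ (Finset.mem_univ i)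
  choose d hd using fun i => exists_isHomogeneous_of_dvd hF h0 (hdvd i)
  rw [hprod] at hloc
  obtain ⟨b, hbsum, hb⟩ := exists_multiplicities (S.A none) D hloc
  choose a hasum haord hacoeff using fun k =>
    exists_half_orders (S.A (some k)) (S.e_some k) D 3 (hprod ▸ hord k) (hprod ▸ hcoeff k)
  have htype : ∀ i, S.HasType (D i) (d i) (fun k => a k i) (b i) := fun i =>
    ⟨hirr i, hd i, fun k => haord k i, fun k => hacoeff k i, hb i⟩
  refine ⟨r, D, d, b, fun i k => a k i, hprod, htype, ?_, hasum, ?_, fun i j hij => ?_⟩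
  · have := IsHomogeneous.prod Finset.univ D d fun i _ => hd i
    rw [← hprod] at this
    exact this.inj_right hF h0
  · rw [hbsum, ← hprod, hmult]
  · by_cases hdij : D i ∣ D j
    · -- a multiple component avoids all four points
      have hsq : D i * D i ∣ F := by
        rw [hprod, ← Finset.mul_prod_erase _ _ (Finset.mem_univ i)]
        exact mul_dvd_mul_left _ (hdij.trans
          (Finset.dvd_prod_of_mem _ (Finset.mem_erase.mpr ⟨hij.symm, Finset.mem_univ j⟩)))
      have ha0 : ∀ k, a k i = 0 := by
        intro k
        by_contra hne
        exact h33 k (D i) ((htype i).passesThrough (Nat.one_le_iff_ne_zero.mpr hne)) hsq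
      have hb0 : b i = 0 := by
        by_contra hne
        exact h4 (D i) ((htype i).passesThrough_none (Nat.one_le_iff_ne_zero.mpr hne)) hsq
      simp [ha0, hb0]
    · exact (htype i).bezout (htype j) hdij

end FrameSystem

/-! ### Lines, tangency and further singular points -/

lemma exists_eq_C_mul_of_dvd {F G : Form} {d : ℕ} (hF : F.IsHomogeneous d)
    (hG : G.IsHomogeneous d) (h0 : G ≠ 0) (h : F ∣ G) : ∃ c : ℂ, c ≠ 0 ∧ F = C c * G := by
  obtain ⟨K, hK⟩ := h
  have hK0 : K ≠ 0 := by rintro rfl; exact h0 (by rw [hK, mul_zero])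
  have hF0 : F ≠ 0 := by rintro rfl; exact h0 (by rw [hK, zero_mul])
  obtain ⟨k, hk⟩ := exists_isHomogeneous_of_dvd hG h0 (Dvd.intro_left _ hK.symm)
  have hkd : d + k = d := (hF.mul hk).inj_right (hK ▸ hG) (hK ▸ h0)
  obtain rfl : k = 0 := by omega
  have h1 := (totalDegree_eq_zero_iff_eq_C (p := K)).mp (hk.totalDegree hK0)
  have hc : coeff 0 K ≠ 0 := fun h => hK0 (by rw [h1, h, C_0])
  refine ⟨(coeff 0 K)⁻¹, inv_ne_zero hc, ?_⟩
  rw [hK, mul_comm F K, ← mul_assoc]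
  nth_rewrite 2 [h1]
  rw [← C_mul, inv_mul_cancel₀ hc, C_1, one_mul]

lemma not_dvd_of_irreducible {F G : Form} {d d' : ℕ} (hF : F.IsHomogeneous d)
    (hirr : Irreducible F) (hG : G.IsHomogeneous d') (h0 : d' ≠ 0) (h : d' < d) : ¬ G ∣ F := by
  rintro ⟨K, hK⟩
  have hG0 : G ≠ 0 := by rintro rfl; exact hirr.ne_zero (by rw [hK, zero_mul])
  rcases hirr.isUnit_or_isUnit hK with hu | hu
  · exact not_dvd_of_degree_lt hG (isHomogeneous_one _ _) one_ne_zero (Nat.pos_of_ne_zero h0)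
      hu.dvd
  · exact not_dvd_of_degree_lt hF hG hG0 h (hu.dvd_mul_right.mp hK.dvd)

namespace FrameSystem
variable {p : Fin 3 → Point} {L : Fin 3 → Line} {p₄ : Point}
variable {S : FrameSystem p L p₄} {D D' G : Form} {d d' b b' : ℕ} {a a' : Fin 3 → ℕ}

/-- A line that has the type of the distinguished tangent line is that line. -/
lemma HasType.line_eq (h : S.HasType D 1 a b) {k : Fin 3} (hk : 1 ≤ a k) :
    ∃ c : ℂ, c ≠ 0 ∧ D = C c * lineForm (L k) := by
  rw [lineForm_eq]
  apply exists_eq_C_mul_of_dvd h.hom (linForm_isHomogeneous _) (linForm_ne_zero (L k).rep_nonzero)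
  by_contra hdvd
  have := h.bezout_of_not_dvd (linForm_isHomogeneous _) hdvd (a' := Pi.single k 1) (b' := 0)
    (fun j => by
      rcases eq_or_ne j k with rfl | hj
      · have := WeightedFrame.ordGE_linForm_of_dot_eq_zero (S.dot_v j) (S.dot_u j)
        rw [S.e_some] at this
        simpa using this
      · simpa [Pi.single_eq_of_ne hj] using (S.A (some j)).ordGE_zero _)
    ((S.A none).ordGE_zero _) (n := 0) Fin.elim0
    (fun j => j.elim0) (fun _ j => j.elim0) (fun j => j.elim0) (fun j => j.elim0) fun j => j.elim0
  have h2 : ∑ j, a j * (Pi.single k 1 : Fin 3 → ℕ) j = a k := by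
    simp [Pi.single_apply]
  omega

lemma HasType.isTangentAt (h : S.HasType D d a b) {k : Fin 3} (hk : a k = 1) :
    IsTangentAt D (p k) (L k) := by
  rw [← S.p_some]
  have h1 := h.ord k
  have h2 := h.coeff_ne k
  rw [hk] at h1 h2
  exact isTangentAt_of_ordGE h.hom (S.dot_v k) (S.dot_u k) h1 h2

lemma HasType.eval_ne_zero (h : S.HasType D d a b) {k : Fin 3} (hk : a k = 0) :
    eval (S.A (some k)).v D ≠ 0 := by
  have h2 := h.coeff_ne k
  rwa [hk, Finsupp.single_zero, constantCoeff_localEquation] at h2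

lemma HasType.eval_none_eq_zero (h : S.HasType D d a b) (hb : 1 ≤ b) :
    eval (S.A none).v D = 0 :=
  ((S.A none).ordGE_one_iff D).mp ((h.mult 1).mpr hb)

/-- Bézout's inequality with the multiplicities, instead of the weighted orders, at the
`[3;3]`-points. -/
lemma HasType.sum_le (h : S.HasType D d a b) (hG : G.IsHomogeneous d')
    (hdvd : ¬ D ∣ G) (h0 : ∀ k, eval (S.A (some k)).v G = 0) : ∑ k, a k ≤ d * d' := by
  choose B hBp hBv _ _ hBe using fun k => exists_weight_one (S.A (some k))
  have hG0 : G ≠ 0 := by rintro rfl; exact hdvd (dvd_zero _)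
  have := PlaneCurve.bezout (A := B) (by
    intro i j hij
    simp only [hBp] at hij
    exact Option.some_injective _ (S.inj hij)) a (fun _ => 1) h.hom hG h.irr.ne_zero hG0
    (h.irr.isRelPrime_iff_not_dvd.mpr hdvd)
    (fun k => by
      rw [hBe, one_mul]
      exact (h.ord k).of_weight_two h.hom (hBp k).symm (S.e_some k))
    (fun k => by
      rw [hBe, one_mul, WeightedFrame.ordGE_one_iff, hBv]; exact h0 k)
  simpa [hBe] using this

/-- The three points are not on a line if they are on a curve that would meet that line too
often. -/
lemma HasType.linearIndependent (h : S.HasType D d a b) (hd : 2 ≤ d) (ha : d < ∑ k, a k) :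
    LinearIndependent ℂ fun k => (S.A (some k)).v := by
  by_contra hLI
  set M : Matrix (Fin 3) (Fin 3) ℂ := Matrix.of fun k => (S.A (some k)).v with hM
  have hdet : M.det = 0 := by
    by_contra hne
    exact hLI (Matrix.linearIndependent_rows_iff_isUnit.mpr
      ((Matrix.isUnit_iff_isUnit_det _).mpr (isUnit_iff_ne_zero.mpr hne)))
  obtain ⟨l, hl, hMl⟩ := Matrix.exists_mulVec_eq_zero_iff.mpr hdet
  have := h.sum_le (linForm_isHomogeneous l)
    (not_dvd_of_degree_lt h.hom (linForm_isHomogeneous l) (linForm_ne_zero hl) (by omega))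
    (fun k => by
      rw [eval_linForm, dotProduct_comm]
      exact congrFun hMl k)
  omega

lemma HasType.dot_none_eq_zero (h : S.HasType D 1 a b) {k : Fin 3} (hk : 1 ≤ a k) (hb : 1 ≤ b) :
    (L k).rep ⬝ᵥ (S.A none).v = 0 := by
  obtain ⟨c, hc, rfl⟩ := h.line_eq hk
  have := h.eval_none_eq_zero hb
  rw [lineForm_eq, map_mul, eval_C, eval_linForm] at this
  exact (mul_eq_zero.mp this).resolve_left hc

lemma HasType.dot_some_ne_zero (h : S.HasType D 1 a b) {j k : Fin 3} (hk : 1 ≤ a k)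
    (hj : a j = 0) : (L k).rep ⬝ᵥ (S.A (some j)).v ≠ 0 := by
  obtain ⟨c, hc, rfl⟩ := h.line_eq hk
  have := h.eval_ne_zero hj
  rw [lineForm_eq, map_mul, eval_C, eval_linForm] at this
  exact right_ne_zero_of_mul this

/-- Three tangent lines of a conic are not concurrent: their points of tangency would be on the
polar line of the common point. -/
lemma HasType.not_concurrent (h : S.HasType D 2 a 0) (ha : ∀ k, a k = 1) :
    ¬ ∀ k, (L k).rep ⬝ᵥ (S.A none).v = 0 := by
  intro hL
  set v := (S.A none).v with hv
  have hpd : ∀ i, (pderiv i D).IsHomogeneous 1 := fun i => h.hom.pderiv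
  -- the polar line of the common point, which is not `0` by Euler's formula
  set P : Form := ∑ i, C (v i) * pderiv i D with hP
  have hPhom : P.IsHomogeneous 1 := IsHomogeneous.sum _ _ _ fun i _ => by
    simpa using (isHomogeneous_C (Fin 3) (v i)).mul (hpd i)
  have heuler := congrArg (eval v) h.hom.sum_X_mul_pderiv
  have hDv : eval v D ≠ 0 := fun h0 => by
    have := (h.mult 1).mp (((S.A none).ordGE_one_iff D).mpr h0)
    omega
  have hP0 : P ≠ 0 := by
    intro h0
    have h1 := congrArg (eval v) h0
    simp only [hP, map_sum, map_mul, eval_C, eval_X, map_zero, map_nsmul] at h1 heuler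
    rw [h1] at heuler
    have h2 : (2 : ℂ) * eval v D = 0 := by simpa using heuler.symm
    exact hDv ((mul_eq_zero.mp h2).resolve_left two_ne_zero)
  have := h.sum_le hPhom (not_dvd_of_degree_lt h.hom hPhom hP0 (by norm_num)) (fun k => by
    obtain ⟨-, c, -, hc⟩ := h.isTangentAt (ha k)
    obtain ⟨c', -, hc'⟩ := (S.A (some k)).exists_smul_rep
    rw [hc', eval_smul_of_isHomogeneous hPhom, S.p_some]
    simp only [hP, map_sum, map_mul, eval_C, hc]
    have h1 := hL k
    rw [dotProduct] at h1
    rw [show ∑ i, v i * (c * (L k).rep i) = c * ∑ i, (L k).rep i * v i by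
      rw [Finset.mul_sum]; exact Finset.sum_congr rfl fun i _ => by ring, h1]
    ring)
  simp [ha] at this

/-- If the numerical inequalities for the components are equalities, all singular points are among
the four given points: a further one would violate Bézout's inequality for two components, or the
genus bound for one. -/
lemma eq_of_isSingularAt {ι : Type*} [Fintype ι] [DecidableEq ι] {F : Form} {n : ℕ}
    (hF : F.IsHomogeneous n) {D : ι → Form}
    {d b : ι → ℕ} {a : ι → Fin 3 → ℕ} (hprod : F = ∏ i, D i)
    (h : ∀ i, S.HasType (D i) (d i) (a i) (b i))
    (hdvd : ∀ i j, i ≠ j → ¬ D i ∣ D j)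
    (hg : ∀ i, d i * d i + 2 ≤ 2 * (∑ k, a i k * (a i k - 1)) + b i * (b i - 1) + 3 * d i)
    (hpair : ∀ i j, i ≠ j → d i * d j ≤ 2 * (∑ k, a i k * a j k) + b i * b j)
    {q : Point} (hq : IsSingularAt F q) : q = p₄ ∨ ∃ k, q = p k := by
  by_contra! hne
  obtain ⟨B, hBp, hBe⟩ := exists_frame q
  have hAB : ∀ t, (S.A t).p ≠ B.p := by
    rintro (_ | k)
    · rw [S.p_none, hBp]; exact hne.1.symm
    · rw [S.p_some, hBp]; exact (hne.2 k).symm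
  have hord : B.OrdGE 2 F := ordGE_two_of_isSingularAt hBe hF (hBp ▸ hq)
  rw [WeightedFrame.OrdGE, hprod, map_prod] at hord
  obtain ⟨i, -, hi⟩ := (Polynomial.prime_X.dvd_finsetProd_iff _).mp
    ((dvd_pow_self Polynomial.X two_ne_zero).trans hord)
  have hi1 : B.OrdGE 1 (D i) := by rwa [WeightedFrame.OrdGE, pow_one]
  have hrest : ¬ Polynomial.X ∣ ∏ j ∈ Finset.univ.erase i, B.loc (D j) := by
    intro hX
    obtain ⟨j, hj, hjX⟩ := (Polynomial.prime_X.dvd_finsetProd_iff _).mp hX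
    have hij : i ≠ j := (Finset.ne_of_mem_erase hj).symm
    have hj1 : B.OrdGE 1 (D j) := by rwa [WeightedFrame.OrdGE, pow_one]
    have := (h i).bezout_of_not_dvd (h j).hom (hdvd i j hij) (h j).ord
      (((h j).mult _).mpr le_rfl) (n := 1) (fun _ => B) (fun _ _ _ => Subsingleton.elim _ _)
      (fun t _ => hAB t) (fun _ => hBe) (fun _ => hi1) fun _ => hj1
    have := hpair i j hij
    omega
  rw [← Finset.mul_prod_erase _ _ (Finset.mem_univ i)] at hord
  have hi2 : B.OrdGE 2 (D i) := Polynomial.prime_X.pow_dvd_of_dvd_mul_right 2 hrest hord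
  have := genus_bound (A := fun o : Option (Option (Fin 3)) => o.elim B S.A) (by
    rintro (_ | s) (_ | t) hst
    · rfl
    · exact absurd hst.symm (hAB t)
    · exact absurd hst (hAB s)
    · exact congrArg _ (S.inj hst)) (fun o => o.elim 2 (mults (a i) (b i)))
    (degree_ne_zero_of_irreducible (h i).hom (h i).irr) (h i).hom (h i).irr (by
      rintro (_ | t)
      · simpa [hBe] using hi2
      · exact (h i).ord_mults t)
  rw [Fintype.sum_option] at this
  simp only [Option.elim] at this
  have h3 := S.sum_mults (a := a i) (b := b i) (a' := a i) (b' := b i) fun x _ => x * (x - 1)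
  simp only [hBe] at this
  rw [h3] at this
  have := hg i
  omega

/-- A product of irreducible curves, each through one of the points at which it is reduced, is
squarefree. -/
lemma squarefree_of_components {ι : Type*} [Fintype ι] {F : Form} {D : ι → Form}
    (hprod : F = ∏ i, D i) (hirr : ∀ i, Irreducible (D i))
    (hred : ∀ i, ∃ q, IsReducedAt F q ∧ PassesThrough (D i) q) : Squarefree F := by
  have h0 : F ≠ 0 := by rw [hprod]; exact Finset.prod_ne_zero_iff.mpr fun i _ => (hirr i).ne_zero
  intro G hG
  by_contra hu
  have hG0 : G ≠ 0 := by rintro rfl; exact h0 (zero_dvd_iff.mp (by simpa using hG))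
  obtain ⟨P, hP, hPG⟩ := WfDvdMonoid.exists_irreducible_factor hu hG0
  have hPP : P * P ∣ F := (mul_dvd_mul hPG hPG).trans hG
  have h1 : P ∣ ∏ i, D i := hprod ▸ (dvd_mul_right P P).trans hPP
  obtain ⟨i, -, hi⟩ := (hP.prime.dvd_finsetProd_iff _).mp h1
  have hDP : D i ∣ P := (hP.associated_of_dvd (hirr i) hi).symm.dvd
  obtain ⟨q, hq, hqD⟩ := hred i
  exact hq (D i) hqD ((mul_dvd_mul hDP hDP).trans hPP)

end FrameSystem

/-! ### Pencils -/

namespace WeightedFrame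
variable {A : WeightedFrame}

lemma OrdGE.neg {k : ℕ} {F : Form} (hF : A.OrdGE k F) : A.OrdGE k (-F) := by
  unfold OrdGE at *
  rw [map_neg]; exact hF.neg_right

lemma OrdGE.sub {k : ℕ} {F G : Form} (hF : A.OrdGE k F) (hG : A.OrdGE k G) :
    A.OrdGE k (F - G) := sub_eq_add_neg F G ▸ hF.add hG.neg

lemma OrdGE.mul_left {k : ℕ} {F : Form} (hF : A.OrdGE k F) (G : Form) : A.OrdGE k (G * F) :=
  hF.dvd (dvd_mul_left F G)

lemma OrdGE.mul_right {k : ℕ} {F : Form} (hF : A.OrdGE k F) (G : Form) : A.OrdGE k (F * G) :=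
  hF.dvd (dvd_mul_right F G)

end WeightedFrame

lemma isHomogeneous_C_mul {F : Form} {d : ℕ} (hF : F.IsHomogeneous d) (c : ℂ) :
    (C c * F).IsHomogeneous d := by
  simpa using (isHomogeneous_C (Fin 3) c).mul hF

/-- If the intersection numbers of `D` with the curves of a pencil are used up by the given points,
then `D` is in the pencil: the member through a further point of `D` contains `D`. -/
lemma FrameSystem.HasType.exists_pencil {p : Fin 3 → Point} {L : Fin 3 → Line} {p₄ : Point}
    {S : FrameSystem p L p₄} {D G₁ G₂ : Form} {d b b' : ℕ} {a : Fin 3 → ℕ} (a' : Fin 3 → ℕ)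
    (h : S.HasType D d a b) (h₁ : G₁.IsHomogeneous d) (h₂ : G₂.IsHomogeneous d)
    (ha₁ : ∀ k, (S.A (some k)).OrdGE (2 * a' k) G₁) (ha₂ : ∀ k, (S.A (some k)).OrdGE (2 * a' k) G₂)
    (hb₁ : (S.A none).OrdGE b' G₁) (hb₂ : (S.A none).OrdGE b' G₂)
    (hsum : d * d ≤ 2 * (∑ k, a k * a' k) + b * b')
    (hne : ∀ r s : ℂ, C r * G₁ + C s * G₂ = 0 → r = 0 ∧ s = 0) :
    ∃ r s : ℂ, D = C r * G₁ + C s * G₂ := by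
  -- a further point of `D`, and the member of the pencil through it
  obtain ⟨B, hB, hBinj, hAB⟩ := exists_points (degree_ne_zero_of_irreducible h.hom h.irr) h.hom
    h.irr.ne_zero (fun t => (S.A t).p) 1
  obtain ⟨r, s, hrs, hG⟩ : ∃ r s : ℂ, ¬ (r = 0 ∧ s = 0) ∧
      r * eval (B 0).v G₁ + s * eval (B 0).v G₂ = 0 := by
    by_cases h0 : eval (B 0).v G₁ = 0
    · exact ⟨1, 0, by simp, by simp [h0]⟩
    · exact ⟨eval (B 0).v G₂, -eval (B 0).v G₁, by simp [h0], by ring⟩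
  have hhom : (C r * G₁ + C s * G₂).IsHomogeneous d :=
    (isHomogeneous_C_mul h₁ r).add (isHomogeneous_C_mul h₂ s)
  obtain ⟨c, -, hc⟩ := exists_eq_C_mul_of_dvd h.hom hhom (fun h0 => hrs (hne r s h0)) (by
    by_contra hdvd
    have := h.bezout_of_not_dvd hhom hdvd (a' := a') (b' := b')
      (fun k => ((ha₁ k).mul_left _).add ((ha₂ k).mul_left _))
      ((hb₁.mul_left _).add (hb₂.mul_left _)) B hBinj hAB (fun j => (hB j).1) (fun j => (hB j).2)
      (fun j => by
        rw [Subsingleton.elim j 0, WeightedFrame.ordGE_one_iff]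
        simpa using hG)
    omega)
  refine ⟨c * r, c * s, ?_⟩
  rw [hc, C_mul, C_mul]; ring

/-! ### Initial forms -/

/-- The form `F` has order at least `k` and initial form (homogeneous part of weight `k`) `g` in the
frame `A`. -/
def WeightedFrame.HasInit (A : WeightedFrame) (k : ℕ) (F : Form) (g : Germ) : Prop :=
  ∃ P : Polynomial Germ, A.loc F = Polynomial.X ^ k * P ∧ P.coeff 0 = g

namespace WeightedFrame
variable {A : WeightedFrame}

lemma HasInit.mul {k l : ℕ} {F G : Form} {f g : Germ} (hF : A.HasInit k F f)
    (hG : A.HasInit l G g) : A.HasInit (k + l) (F * G) (f * g) := by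
  obtain ⟨P, hP, rfl⟩ := hF
  obtain ⟨P', hP', rfl⟩ := hG
  exact ⟨P * P', by rw [map_mul, hP, hP']; ring, Polynomial.mul_coeff_zero _ _⟩

lemma loc_C (A : WeightedFrame) (c : ℂ) : A.loc (C c) = Polynomial.C (C c) := by
  rw [← algebraMap_eq, AlgHom.commutes]; rfl

lemma HasInit.C_mul {k : ℕ} {F : Form} {f : Germ} (hF : A.HasInit k F f) (c : ℂ) :
    A.HasInit k (C c * F) (C c * f) := by
  obtain ⟨P, hP, rfl⟩ := hF
  exact ⟨Polynomial.C (C c) * P, by rw [map_mul, hP, loc_C]; ring, by simp⟩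

lemma HasInit.isOrdinaryPoint {n : ℕ} {F : Form} (hA : A.e = 1) (hF : IsReducedAt F A.p)
    (a b : Fin n → ℂ) (h : A.HasInit n F (∏ i, (C (a i) * X 0 + C (b i) * X 1)))
    (h0 : ∀ i, a i ≠ 0 ∨ b i ≠ 0) (hab : ∀ i j, i ≠ j → a i * b j ≠ a j * b i) :
    IsOrdinaryPoint n F A.p := by
  refine ⟨hF, A.v, A.u, A.w, A.isFrame, ?_⟩
  obtain ⟨P, hP, hP0⟩ := h
  rw [loc_eq, hA] at hP
  exact isOrdinaryGerm_of_scale a b ⟨P, hP⟩ (by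
    rw [hP, Polynomial.coeff_X_pow_mul', if_pos le_rfl, Nat.sub_self, hP0]) h0 hab

lemma HasInit.isNondegInfNearPoint {n : ℕ} {F : Form} {L : Line} (hA : A.e = 2)
    (hLv : L.rep ⬝ᵥ A.v = 0) (hLu : L.rep ⬝ᵥ A.u = 0) (hF : IsReducedAt F A.p)
    (a b : Fin n → ℂ) (h : A.HasInit (2 * n) F (∏ i, (C (a i) * X 0 ^ 2 + C (b i) * X 1)))
    (hb : ∀ i, b i ≠ 0) (hab : ∀ i j, i ≠ j → a i * b j ≠ a j * b i) :
    IsNondegInfNearPoint n F A.p L := by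
  refine ⟨hF, A.v, A.u, A.w, ⟨A.isFrame, hLv, hLu⟩, ?_⟩
  obtain ⟨P, hP, hP0⟩ := h
  rw [loc_eq, hA] at hP
  exact isNondegInfNearGerm_of_scale a b ⟨P, hP⟩ (by
    rw [hP, Polynomial.coeff_X_pow_mul', if_pos le_rfl, Nat.sub_self, hP0]) hb hab

end WeightedFrame

/-! ### Homogeneous coordinates -/

/-- A basis `e` of `ℂ³` and its dual basis `ξ`, given by coefficient vectors of linear forms. -/
structure CoordinateSystem where
  /-- the basis -/
  e : Fin 3 → Fin 3 → ℂ
  /-- the dual basis -/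
  ξ : Fin 3 → Fin 3 → ℂ
  dual : ∀ i j, ξ i ⬝ᵥ e j = if i = j then 1 else 0
  expand : ∀ z : Fin 3 → ℂ, z = ∑ k, (ξ k ⬝ᵥ z) • e k

lemma exists_coordinateSystem {e : Fin 3 → Fin 3 → ℂ} (h : LinearIndependent ℂ e) :
    ∃ K : CoordinateSystem, K.e = e := by
  have h' : LinearIndependent ℂ ![e 0, e 1, e 2] := by
    convert h using 1; ext i : 1; fin_cases i <;> rfl
  obtain ⟨a, b, c, ha, hb, hc, hz⟩ := exists_dual h'
  refine ⟨⟨e, ![a, b, c], fun i j => ?_, fun z => ?_⟩, rfl⟩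
  · fin_cases i <;> fin_cases j
    exacts [ha.1, ha.2.1, ha.2.2, hb.1, hb.2.1, hb.2.2, hc.1, hc.2.1, hc.2.2]
  · rw [Fin.sum_univ_three]; exact hz z

namespace CoordinateSystem
variable (K : CoordinateSystem)

/-- The coordinates as linear forms. -/
def coord (i : Fin 3) : Form := linForm (K.ξ i)

/-- The vector with given coordinates. -/
def vec (a : Fin 3 → ℂ) : Fin 3 → ℂ := ∑ k, a k • K.e k

/-- Renumbering of the coordinates. -/
def perm (σ : Equiv.Perm (Fin 3)) : CoordinateSystem where
  e := K.e ∘ σ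
  ξ := K.ξ ∘ σ
  dual i j := by simp [K.dual]
  expand z := by
    rw [← Equiv.sum_comp σ.symm]
    simpa using K.expand z

lemma dot_vec (i : Fin 3) (a : Fin 3 → ℂ) : K.ξ i ⬝ᵥ K.vec a = a i := by
  simp [vec, dotProduct_sum, K.dual]

lemma coord_isHomogeneous (i : Fin 3) : (K.coord i).IsHomogeneous 1 := linForm_isHomogeneous _

lemma eval_vec_coord (i : Fin 3) (a : Fin 3 → ℂ) : eval (K.vec a) (K.coord i) = a i := by
  rw [coord, eval_linForm, dot_vec]

lemma eq_sum (l : Fin 3 → ℂ) : l = ∑ k, (l ⬝ᵥ K.e k) • K.ξ k := by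
  ext i
  have h : (Pi.single i 1 : Fin 3 → ℂ) = _ := K.expand (Pi.single i 1)
  have h1 : l i = l ⬝ᵥ Pi.single i 1 := by simp
  rw [h1, h, dotProduct_sum, Finset.sum_apply]
  refine Finset.sum_congr rfl fun k _ => ?_
  simp [mul_comm]

lemma vec_injective : Function.Injective K.vec := fun a b h => by
  ext i; rw [← K.dot_vec i a, h, K.dot_vec]

lemma exists_weightedFrame {q : Point} {a b c : Fin 3 → ℂ} (ha : K.vec a ∈ q.submodule)
    (hdet : (Matrix.of ![a, b, c]).det ≠ 0) {e : ℕ} (he : 0 < e) :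
    ∃ A : WeightedFrame, A.p = q ∧ A.v = K.vec a ∧ A.u = K.vec b ∧ A.w = K.vec c ∧ A.e = e := by
  refine ⟨⟨q, K.vec a, K.vec b, K.vec c, e, ⟨ha, ?_⟩, he⟩, rfl, rfl, rfl, rfl, rfl⟩
  have h1 : LinearIndependent ℂ ![a, b, c] := Matrix.linearIndependent_rows_iff_isUnit.mpr
    ((Matrix.isUnit_iff_isUnit_det _).mpr (isUnit_iff_ne_zero.mpr hdet))
  have h2 := h1.map' (Fintype.linearCombination ℂ K.e) (LinearMap.ker_eq_bot.mpr fun x y h => by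
    rw [Fintype.linearCombination_apply, Fintype.linearCombination_apply] at h
    exact K.vec_injective h)
  have h3 : ![K.vec a, K.vec b, K.vec c] = Fintype.linearCombination ℂ K.e ∘ ![a, b, c] := by
    ext i : 1
    fin_cases i <;> simp [Fintype.linearCombination_apply, vec]
  rw [h3]; exact h2

lemma loc_coord {A : WeightedFrame} {a b c : Fin 3 → ℂ} (hv : A.v = K.vec a) (hu : A.u = K.vec b)
    (hw : A.w = K.vec c) (i : Fin 3) : A.loc (K.coord i) = Polynomial.C (C (a i)) +
      Polynomial.C (C (b i) * X 0) * Polynomial.X +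
      Polynomial.C (C (c i) * X 1) * Polynomial.X ^ A.e := by
  rw [coord, WeightedFrame.loc_linForm, hv, hu, hw, K.dot_vec, K.dot_vec, K.dot_vec]

/-- A parametrization in the given coordinates, together with its inverse, shows that an irreducible
curve is rational. -/
lemma isRationalCurve {F F₀ : Form} (hirr : Irreducible F) (hF : F = aeval K.coord F₀) {d e : ℕ}
    (γ : Fin 3 → MvPolynomial (Fin 2) ℂ) (h : Fin 2 → Form) (hγ : ∀ i, (γ i).IsHomogeneous d)
    (hh : ∀ j, (h j).IsHomogeneous e) (h0 : aeval γ F₀ = 0) (hne : aeval γ (h 0) ≠ 0)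
    (hinv : aeval γ (h 0) * X 1 = aeval γ (h 1) * X 0) : IsRationalCurve F := by
  set g : Fin 3 → MvPolynomial (Fin 2) ℂ := fun i => ∑ k, C (K.e k i) * γ k with hg
  have hcoord : ∀ j, aeval g (K.coord j) = γ j := by
    intro j
    have h1 : ∀ k, ∑ i, C (K.ξ j i) * (C (K.e k i) * γ k) = (if j = k then 1 else 0) * γ k := by
      intro k
      simp_rw [← mul_assoc, ← C_mul, ← Finset.sum_mul, ← map_sum]
      rw [show ∑ i, K.ξ j i * K.e k i = K.ξ j ⬝ᵥ K.e k from rfl, K.dual]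
      split_ifs <;> simp
    calc aeval g (K.coord j) = ∑ i, C (K.ξ j i) * g i := by
          simp [coord, linForm, algebraMap_eq]
      _ = ∑ k, ∑ i, C (K.ξ j i) * (C (K.e k i) * γ k) := by
          simp_rw [hg, Finset.mul_sum]; exact Finset.sum_comm
      _ = γ j := by simp [h1]
  have hcomp : ∀ M : Form, aeval g (aeval K.coord M) = aeval γ M := by
    intro M
    rw [← AlgHom.comp_apply, comp_aeval]
    congr 2
    ext1 j
    exact hcoord j
  refine ⟨hirr, d, g, e, fun j => aeval K.coord (h j), fun i => ?_, fun j => ?_, ?_, ?_, ?_⟩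
  · exact IsHomogeneous.sum _ _ _ fun k _ => by
      simpa using (isHomogeneous_C (Fin 2) (K.e k i)).mul (hγ k)
  · have := (hh j).aeval K.coord (fun i => K.coord_isHomogeneous i)
    simpa using this
  · rw [hF, hcomp, h0]
  · rw [hcomp]; exact hne
  · rw [hcomp, hcomp]; exact hinv

end CoordinateSystem

/-- Lines are rational: in coordinates whose first coordinate is the given linear form, the other
two parametrize the line. -/
lemma linForm_isRationalCurve {a : Fin 3 → ℂ} (h : a ≠ 0) : IsRationalCurve (linForm a) := by
  obtain ⟨u, w, hLI⟩ := exists_basis_extension h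
  obtain ⟨K, hK⟩ := exists_coordinateSystem hLI
  have hK' : ∀ z, ∀ i, (K.e i) ⬝ᵥ K.ξ z = if z = i then 1 else 0 := fun z i => by
    rw [dotProduct_comm, K.dual]
  -- the system dual to `K`
  let K' : CoordinateSystem := ⟨K.ξ, K.e, fun i j => by rw [hK']; simp [eq_comm], fun z => by
    simpa [dotProduct_comm] using K.eq_sum z⟩
  refine K'.isRationalCurve (F₀ := X 0) (d := 1) (e := 1) (linForm_irreducible h) ?_
    ![0, X 0, X 1] ![X 1, X 2] ?_ ?_ ?_ ?_ ?_
  · rw [aeval_X, CoordinateSystem.coord]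
    exact congrArg linForm (congrFun hK 0).symm
  · intro i
    fin_cases i
    exacts [isHomogeneous_zero _ _ _, isHomogeneous_X _ _, isHomogeneous_X _ _]
  · intro j
    fin_cases j
    exacts [isHomogeneous_X _ _, isHomogeneous_X _ _]
  · simp
  · simp
  · simp [mul_comm]

/-! ### Coordinates adapted to the four points -/

namespace CoordinateSystem

/-- The `k`-th base point of the coordinate system is `p k`, and its unit point is `p₄`. -/
structure Adapted (K : CoordinateSystem) {p : Fin 3 → Point} {L : Fin 3 → Line} {p₄ : Point}
    (S : FrameSystem p L p₄) : Prop where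
  smul : ∀ k, ∃ c : ℂ, c ≠ 0 ∧ (S.A (some k)).v = c • K.e k
  unit : (S.A none).v = K.e 0 + K.e 1 + K.e 2

variable {K : CoordinateSystem} {p : Fin 3 → Point} {L : Fin 3 → Line} {p₄ : Point}
  {S : FrameSystem p L p₄}

lemma Adapted.mem (h : K.Adapted S) (k : Fin 3) : K.e k ∈ (p k).submodule := by
  obtain ⟨c, hc, hv⟩ := h.smul k
  have h1 := (S.A (some k)).isFrame.1
  rw [S.p_some, hv] at h1
  simpa [smul_smul, inv_mul_cancel₀ hc] using (p k).submodule.smul_mem c⁻¹ h1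

lemma Adapted.mem_unit (h : K.Adapted S) : K.e 0 + K.e 1 + K.e 2 ∈ p₄.submodule := by
  have h1 := (S.A none).isFrame.1
  rwa [S.p_none, h.unit] at h1

lemma Adapted.ordGE_coord (h : K.Adapted S) {i k : Fin 3} (hik : i ≠ k) :
    (S.A (some k)).OrdGE 1 (K.coord i) := by
  obtain ⟨c, -, hv⟩ := h.smul k
  rw [WeightedFrame.ordGE_one_iff, coord, eval_linForm, hv, dotProduct_smul, K.dual, if_neg hik,
    smul_zero]

lemma Adapted.ordGE_coord_sub (h : K.Adapted S) (i j : Fin 3) :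
    (S.A none).OrdGE 1 (K.coord i - K.coord j) := by
  rw [WeightedFrame.ordGE_one_iff, map_sub, coord, coord, eval_linForm, eval_linForm, h.unit]
  simp only [dotProduct_add, K.dual]
  fin_cases i <;> fin_cases j <;> simp

lemma Adapted.dot_e (h : K.Adapted S) (k : Fin 3) : (L k).rep ⬝ᵥ K.e k = 0 := by
  obtain ⟨c, hc, hv⟩ := h.smul k
  have := S.dot_v k
  rw [hv, dotProduct_smul, smul_eq_mul] at this
  exact (mul_eq_zero.mp this).resolve_left hc

/-- The line through the unit point and a base point. -/
lemma eq_smul_sub {i j k : Fin 3} (hij : i ≠ j) (hjk : j ≠ k) (hik : i ≠ k) {l : Fin 3 → ℂ}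
    (hl : l ≠ 0) (h1 : l ⬝ᵥ K.e k = 0) (h2 : l ⬝ᵥ (K.e 0 + K.e 1 + K.e 2) = 0) :
    ∃ c : ℂ, c ≠ 0 ∧ l = c • (K.ξ i - K.ξ j) := by
  have hsum : (∑ t, l ⬝ᵥ K.e t) = 0 := by
    rw [Fin.sum_univ_three, ← dotProduct_add, ← dotProduct_add]; exact h2
  have huniv : (Finset.univ : Finset (Fin 3)) = {i, j, k} := by
    ext t; fin_cases t <;> fin_cases i <;> fin_cases j <;> fin_cases k <;> simp_all
  have hl' := K.eq_sum l
  rw [huniv, Finset.sum_insert (by simp [hij, hik]), Finset.sum_insert (by simp [hjk]),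
    Finset.sum_singleton, h1] at hsum hl'
  have hj : l ⬝ᵥ K.e j = -(l ⬝ᵥ K.e i) := by linear_combination hsum
  rw [hj, zero_smul, add_zero, neg_smul, ← sub_eq_add_neg, ← smul_sub] at hl'
  refine ⟨l ⬝ᵥ K.e i, fun h0 => hl ?_, hl'⟩
  rw [hl', h0, zero_smul]

/-- If the three `[3;3]`-points are not on a line, and the quadruple point is on two of the
distinguished tangent lines, which contain no other of the three points, then the four points are in
general position, and hence the base points and the unit point of a coordinate system. -/
lemma exists_adapted (hLI : LinearIndependent ℂ fun k => (S.A (some k)).v)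
    (h0 : (L 0).rep ⬝ᵥ (S.A none).v = 0) (h1 : (L 1).rep ⬝ᵥ (S.A none).v = 0)
    (h01 : (L 0).rep ⬝ᵥ (S.A (some 1)).v ≠ 0) (h02 : (L 0).rep ⬝ᵥ (S.A (some 2)).v ≠ 0)
    (h10 : (L 1).rep ⬝ᵥ (S.A (some 0)).v ≠ 0) (h12 : (L 1).rep ⬝ᵥ (S.A (some 2)).v ≠ 0) :
    ∃ K : CoordinateSystem, K.Adapted S := by
  obtain ⟨K₀, hK₀⟩ := exists_coordinateSystem hLI
  set c : Fin 3 → ℂ := fun k => K₀.ξ k ⬝ᵥ (S.A none).v with hc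
  have hv : (S.A none).v = c 0 • (S.A (some 0)).v + c 1 • (S.A (some 1)).v
      + c 2 • (S.A (some 2)).v := by
    have := K₀.expand (S.A none).v
    rwa [Fin.sum_univ_three, hK₀] at this
  have e0 : c 1 * ((L 0).rep ⬝ᵥ (S.A (some 1)).v) + c 2 * ((L 0).rep ⬝ᵥ (S.A (some 2)).v) = 0 := by
    have := h0
    rw [hv] at this
    simpa [dotProduct_add, S.dot_v] using this
  have e1 : c 0 * ((L 1).rep ⬝ᵥ (S.A (some 0)).v) + c 2 * ((L 1).rep ⬝ᵥ (S.A (some 2)).v) = 0 := by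
    have := h1
    rw [hv] at this
    simpa [dotProduct_add, S.dot_v] using this
  have hne : (S.A none).v ≠ 0 := (S.A none).v_ne_zero
  have h2 : c 2 ≠ 0 := by
    intro h
    rw [h, zero_mul, add_zero] at e0 e1
    apply hne
    rw [hv, h, (mul_eq_zero.mp e0).resolve_right h01, (mul_eq_zero.mp e1).resolve_right h10]
    simp
  have hc1 : c 1 ≠ 0 := by
    intro h
    rw [h, zero_mul, zero_add] at e0
    exact mul_ne_zero h2 h02 e0
  have hc0 : c 0 ≠ 0 := by
    intro h
    rw [h, zero_mul, zero_add] at e1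
    exact mul_ne_zero h2 h12 e1
  have hcall : ∀ k, c k ≠ 0 := by
    intro k; fin_cases k
    exacts [hc0, hc1, h2]
  obtain ⟨K, hK⟩ := exists_coordinateSystem (hLI.units_smul fun k => Units.mk0 (c k) (hcall k))
  have hKe : ∀ k, K.e k = c k • (S.A (some k)).v := fun k => congrFun hK k
  refine ⟨K, fun k => ⟨(c k)⁻¹, inv_ne_zero (hcall k), ?_⟩, ?_⟩
  · rw [hKe, smul_smul, inv_mul_cancel₀ (hcall k), one_smul]
  · rw [hKe, hKe, hKe, hv]

lemma vec_zero (K : CoordinateSystem) : K.vec ![1, 0, 0] = K.e 0 := by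
  simp [vec, Fin.sum_univ_three]

lemma vec_two (K : CoordinateSystem) : K.vec ![0, 0, 1] = K.e 2 := by
  simp [vec, Fin.sum_univ_three]

lemma vec_unit (K : CoordinateSystem) : K.vec ![1, 1, 1] = K.e 0 + K.e 1 + K.e 2 := by
  simp [vec, Fin.sum_univ_three]

lemma lineForm_eq_of_rep {K : CoordinateSystem} {M : Line} {c : ℂ} {i j : Fin 3}
    (h : M.rep = c • (K.ξ i - K.ξ j)) : lineForm M = C c * (K.coord i - K.coord j) := by
  rw [lineForm_eq, h, linForm_smul, linForm_sub]; rfl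

end CoordinateSystem

lemma eq_of_rep_mem {q q' : Point} {v : Fin 3 → ℂ} (hv : v ∈ q'.submodule) {c : ℂ}
    (h : q.rep = c • v) : q = q' := by
  rw [Projectivization.submodule_eq, Submodule.mem_span_singleton] at hv
  obtain ⟨c', rfl⟩ := hv
  rw [← q.mk_rep, ← q'.mk_rep, Projectivization.mk_eq_mk_iff']
  exact ⟨c * c', by rw [h, smul_smul]⟩

/-! ### The quintics with three tacnodes -/

/-- The quintics through the unit point with tacnodes at the base points, tangent there to the lines
through the unit point. There is one linear relation: the three summands with `r = s = q = 1` have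
sum `0`. -/
def quintic {R : Type*} [CommRing R] (r s q x y z : R) : R :=
  r * (y - z) * (z * x + x * y - y * z) ^ 2 + s * (z - x) * (x * y + y * z - z * x) ^ 2 +
    q * (x - y) * (y * z + z * x - x * y) ^ 2

lemma quintic_rotate {R : Type*} [CommRing R] (r s q x y z : R) :
    quintic s q r y z x = quintic r s q x y z := by
  unfold quintic; ring

lemma map_quintic {R R' : Type*} [CommRing R] [CommRing R'] [Algebra ℂ R] [Algebra ℂ R']
    (f : R →ₐ[ℂ] R') (r s q x y z : R) :
    f (quintic r s q x y z) = quintic (f r) (f s) (f q) (f x) (f y) (f z) := by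
  simp [quintic]

namespace CoordinateSystem
variable (K : CoordinateSystem)

/-- The quintic with parameters `r`, `s`, `q` in given coordinates. -/
def quinticForm (r s q : ℂ) : Form :=
  quintic (C r) (C s) (C q) (K.coord 0) (K.coord 1) (K.coord 2)

/-- The product of the lines that join the base points to the unit point. -/
def triangleForm : Form :=
  (K.coord 1 - K.coord 2) * (K.coord 2 - K.coord 0) * (K.coord 0 - K.coord 1)

lemma quinticForm_perm (r s q : ℂ) :
    (K.perm (finRotate 3)).quinticForm s q r = K.quinticForm r s q :=
  quintic_rotate _ _ _ _ _ _

lemma triangleForm_perm : (K.perm (finRotate 3)).triangleForm = K.triangleForm := by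
  change (K.coord 2 - K.coord 0) * (K.coord 0 - K.coord 1) * (K.coord 1 - K.coord 2) = _
  unfold triangleForm; ring

variable {K}

/-- The initial forms at a base point, along the line to the unit point. -/
lemma hasInit_quinticForm {A : WeightedFrame} (hv : A.v = K.vec ![1, 0, 0])
    (hu : A.u = K.vec ![0, 1, 1]) (hw : A.w = K.vec ![0, 1, 0]) (he : A.e = 2) (r s q : ℂ) :
    A.HasInit 4 (K.quinticForm r s q)
      (C (q - s) * (X 0 ^ 2) ^ 2 + C (4 * r - 2 * s - 2 * q) * (X 0 ^ 2 * X 1)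
        + C (q - s) * X 1 ^ 2) ∧
    A.HasInit 2 K.triangleForm (-X 1) := by
  have h := K.loc_coord hv hu hw
  set T : Polynomial Germ := Polynomial.X
  set x' : Polynomial Germ := Polynomial.C (X 0)
  set y' : Polynomial Germ := Polynomial.C (X 1)
  have h0 : A.loc (K.coord 0) = 1 := by rw [h]; simp
  have h1 : A.loc (K.coord 1) = T * (x' + T * y') := by
    rw [h, he]; simp [x', y']; ring
  have h2 : A.loc (K.coord 2) = T * x' := by
    rw [h]; simp [x', mul_comm]
  constructor
  · refine ⟨Polynomial.C (C r) * y' * (2 * x' + T * y' - T * (x' + T * y') * x') ^ 2 +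
      Polynomial.C (C s) * (T * x' - 1) * (y' + x' * (x' + T * y')) ^ 2 +
      Polynomial.C (C q) * (1 - T * (x' + T * y')) * (x' * (x' + T * y') - y') ^ 2, ?_, ?_⟩
    · rw [quinticForm, map_quintic, h0, h1, h2, WeightedFrame.loc_C, WeightedFrame.loc_C,
        WeightedFrame.loc_C, quintic]
      ring
    · rw [Polynomial.coeff_zero_eq_eval_zero]
      simp only [x', y', T, Polynomial.eval_add, Polynomial.eval_mul, Polynomial.eval_sub,
        Polynomial.eval_pow, Polynomial.eval_C, Polynomial.eval_X, Polynomial.eval_one,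
        Polynomial.eval_ofNat, map_sub, map_mul, map_ofNat]
      ring
  · refine ⟨y' * (T * x' - 1) * (1 - T * (x' + T * y')), ?_, ?_⟩
    · rw [triangleForm, map_mul, map_mul, map_sub, map_sub, map_sub, h0, h1, h2]
      ring
    · rw [Polynomial.coeff_zero_eq_eval_zero]
      simp [x', y', T]

end CoordinateSystem

/-- Factorization of a palindromic binary quadratic form without a multiple root. -/
lemma exists_palindromic_roots {a b : ℂ} (ha : a ≠ 0) (h : b ^ 2 ≠ 4 * a ^ 2) :
    ∃ t u : ℂ, t * u = 1 ∧ t ≠ u ∧ b = -a * (t + u) := by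
  obtain ⟨w, hw⟩ := IsAlgClosed.exists_pow_nat_eq (b ^ 2 - 4 * a ^ 2) two_pos
  have hw0 : w ≠ 0 := by
    rintro rfl
    exact h (by linear_combination -hw)
  refine ⟨(-b + w) / (2 * a), (-b - w) / (2 * a), ?_, ?_, ?_⟩
  · field_simp
    linear_combination -hw
  · intro h
    field_simp at h
    exact hw0 (by linear_combination h / 2)
  · field_simp
    ring

namespace CoordinateSystem
variable {K : CoordinateSystem}

/-- The tacnode of the quintic at the first base point, and the `[3;3]`-point of its sum with the
lines: the initial form of the quintic is palindromic in `x²` and `y`, hence up to a constant a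
product of two factors `x² - t y`, `x² - u y` with `t u = 1`, which are distinct for distinct
parameters; the tangent line contributes the factor `y`. -/
lemma quintic_isNondegInfNearPoint_zero {r s q μ : ℂ} (hrs : r ≠ s) (hsq : s ≠ q) (hqr : q ≠ r)
    (hμ : μ ≠ 0) {P : Point} (hP : K.e 0 ∈ P.submodule) {M : Line} {c : ℂ}
    (hM : M.rep = c • (K.ξ 1 - K.ξ 2)) {F : Form}
    (hF : F = C μ * (K.quinticForm r s q * K.triangleForm)) (hred : IsReducedAt F P) :
    IsNondegInfNearPoint 2 (K.quinticForm r s q) P M ∧ IsNondegInfNearPoint 3 F P M := by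
  obtain ⟨A, rfl, hv, hu, hw, he⟩ := K.exists_weightedFrame (b := ![0, 1, 1]) (c := ![0, 1, 0])
    (K.vec_zero.symm ▸ hP) (by simp [Matrix.det_fin_three]) two_pos
  have hMv : M.rep ⬝ᵥ A.v = 0 := by simp [hM, hv, dot_vec]
  have hMu : M.rep ⬝ᵥ A.u = 0 := by simp [hM, hu, dot_vec]
  obtain ⟨h1, h2⟩ := hasInit_quinticForm hv hu hw he r s q
  have hqs : q - s ≠ 0 := sub_ne_zero.mpr hsq.symm
  obtain ⟨t, u, htu, hne, hb⟩ := exists_palindromic_roots (b := 4 * r - 2 * s - 2 * q) hqs (by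
    intro h0
    have h1 : 16 * ((r - s) * (r - q)) = 0 := by linear_combination h0
    simp [sub_eq_zero, hrs, hqr.symm] at h1)
  have ht : t ≠ 0 := left_ne_zero_of_mul (htu ▸ one_ne_zero)
  have hu : u ≠ 0 := right_ne_zero_of_mul (htu ▸ one_ne_zero)
  have hC : (C t * C u : Germ) = 1 := by rw [← C_mul, htu, C_1]
  constructor
  · refine WeightedFrame.HasInit.isNondegInfNearPoint he hMv hMu
      (hred.of_dvd (hF ▸ (dvd_mul_right _ _).mul_left _)) ![1, q - s] ![-t, -((q - s) * u)] ?_ ?_ ?_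
    · convert h1 using 1
      rw [hb]
      simp only [Fin.prod_univ_two, Matrix.cons_val_zero, Matrix.cons_val_one, map_sub, map_mul,
        map_neg, map_add, C_1]
      linear_combination (C q - C s) * X 1 ^ 2 * hC
    · intro i; fin_cases i <;> simp [ht, hu, hqs]
    · intro i j hij
      fin_cases i <;> fin_cases j <;> simp [hqs, hne, hne.symm] at hij ⊢
  · have h3 := (h1.mul h2).C_mul μ
    rw [← hF] at h3
    refine WeightedFrame.HasInit.isNondegInfNearPoint he hMv hMu hred
      ![1, q - s, 0] ![-t, -((q - s) * u), -μ] ?_ ?_ ?_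
    · convert h3 using 1
      rw [hb]
      simp only [Fin.prod_univ_three, Matrix.cons_val_zero, Matrix.cons_val_one, Matrix.cons_val,
        map_sub, map_mul, map_neg, map_add, C_1, C_0]
      linear_combination -(C q - C s) * C μ * X 1 ^ 3 * hC
    · intro i; fin_cases i <;> simp [ht, hu, hqs, hμ]
    · intro i j hij
      fin_cases i <;> fin_cases j <;> simp [hμ, hqs, hne, hne.symm] at hij ⊢

/-- The tacnodes of the quintic, and the `[3;3]`-points of its sum with the three lines. -/
lemma quintic_isNondegInfNearPoint {r s q μ : ℂ} (hrs : r ≠ s) (hsq : s ≠ q) (hqr : q ≠ r)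
    (hμ : μ ≠ 0) {p : Fin 3 → Point} (hp : ∀ k, K.e k ∈ (p k).submodule) {L : Fin 3 → Line}
    {c : Fin 3 → ℂ} (hL : ∀ k, (L k).rep = c k • (K.ξ (k + 1) - K.ξ (k + 2))) {F : Form}
    (hF : F = C μ * (K.quinticForm r s q * K.triangleForm)) (hred : ∀ k, IsReducedAt F (p k))
    (k : Fin 3) :
    IsNondegInfNearPoint 2 (K.quinticForm r s q) (p k) (L k) ∧
      IsNondegInfNearPoint 3 F (p k) (L k) := by
  fin_cases k
  · exact quintic_isNondegInfNearPoint_zero hrs hsq hqr hμ (hp 0) (hL 0) hF (hred 0)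
  · rw [← quinticForm_perm] at hF ⊢
    rw [← triangleForm_perm] at hF
    exact quintic_isNondegInfNearPoint_zero hsq hqr hrs hμ (hp 1) (hL 1) hF (hred 1)
  · rw [← quinticForm_perm, ← quinticForm_perm] at hF ⊢
    rw [← triangleForm_perm, ← triangleForm_perm] at hF
    exact quintic_isNondegInfNearPoint_zero hqr hrs hsq hμ (hp 2) (hL 2) hF (hred 2)

/-- The initial forms at the unit point. -/
lemma hasInit_quinticForm_unit {A : WeightedFrame} (hv : A.v = K.vec ![1, 1, 1])
    (hu : A.u = K.vec ![1, 0, 0]) (hw : A.w = K.vec ![0, 1, 0]) (he : A.e = 1) (r s q : ℂ) :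
    A.HasInit 1 (K.quinticForm r s q) (C (q - s) * X 0 + C (r - q) * X 1) ∧
    A.HasInit 3 K.triangleForm (X 1 * (-X 0) * (X 0 - X 1)) := by
  have h := K.loc_coord hv hu hw
  set T : Polynomial Germ := Polynomial.X
  set x' : Polynomial Germ := Polynomial.C (X 0)
  set y' : Polynomial Germ := Polynomial.C (X 1)
  have h0 : A.loc (K.coord 0) = 1 + T * x' := by rw [h]; simp [x', mul_comm]
  have h1 : A.loc (K.coord 1) = 1 + T * y' := by rw [h, he]; simp [y', mul_comm]
  have h2 : A.loc (K.coord 2) = 1 := by rw [h]; simp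
  constructor
  · refine ⟨Polynomial.C (C r) * y' *
          (1 + T * x' + (1 + T * x') * (1 + T * y') - (1 + T * y')) ^ 2 -
        Polynomial.C (C s) * x' * ((1 + T * x') * (1 + T * y') + (1 + T * y') - (1 + T * x')) ^ 2 +
        Polynomial.C (C q) * (x' - y') *
          ((1 + T * y') + (1 + T * x') - (1 + T * x') * (1 + T * y')) ^ 2, ?_, ?_⟩
    · rw [quinticForm, map_quintic, h0, h1, h2, WeightedFrame.loc_C, WeightedFrame.loc_C,
        WeightedFrame.loc_C, quintic]
      ring
    · rw [Polynomial.coeff_zero_eq_eval_zero]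
      simp only [x', y', T, Polynomial.eval_add, Polynomial.eval_mul, Polynomial.eval_sub,
        Polynomial.eval_pow, Polynomial.eval_C, Polynomial.eval_X, Polynomial.eval_one, map_sub]
      ring
  · refine ⟨y' * (-x') * (x' - y'), ?_, ?_⟩
    · rw [triangleForm, map_mul, map_mul, map_sub, map_sub, map_sub, h0, h1, h2]
      ring
    · rw [Polynomial.coeff_zero_eq_eval_zero]
      simp [x', y']

lemma quintic_isOrdinaryPoint {r s q μ : ℂ} (hrs : r ≠ s) (hsq : s ≠ q) (hqr : q ≠ r)
    (hμ : μ ≠ 0) {P : Point} (hP : K.e 0 + K.e 1 + K.e 2 ∈ P.submodule) {F : Form}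
    (hF : F = C μ * (K.quinticForm r s q * K.triangleForm)) (hred : IsReducedAt F P) :
    IsOrdinaryPoint 4 F P := by
  obtain ⟨A, rfl, hv, hu, hw, he⟩ := K.exists_weightedFrame (b := ![1, 0, 0]) (c := ![0, 1, 0])
    (K.vec_unit.symm ▸ hP) (by simp [Matrix.det_fin_three]) one_pos
  obtain ⟨h1, h2⟩ := hasInit_quinticForm_unit hv hu hw he r s q
  have hinit := (h1.mul h2).C_mul μ
  rw [← hF] at hinit
  have hqs : q - s ≠ 0 := sub_ne_zero.mpr hsq.symm
  have hqr' : q - r ≠ 0 := sub_ne_zero.mpr hqr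
  refine WeightedFrame.HasInit.isOrdinaryPoint he hred
    ![q - s, 0, -1, 1] ![r - q, μ, 0, -1] ?_ ?_ ?_
  · convert hinit using 1
    simp only [Fin.prod_univ_four, Matrix.cons_val_zero, Matrix.cons_val_one, Matrix.cons_val,
      map_neg, C_1, C_0]
    ring
  · intro i; fin_cases i <;> simp [hqs, hμ]
  · intro i j hij
    fin_cases i <;> fin_cases j <;>
      simp [hμ, hμ.symm, hqs, hqr', hqr'.symm, hrs, hrs.symm] at hij ⊢

end CoordinateSystem

/-- The substitution `x ↦ 1 / (x (y + z))`, and cyclically, takes the quintic to a conic and factors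
that come from the exceptional curves. It is the composition of two quadratic transformations and a
projectivity; `y z + z x - x y` becomes `x y`, up to a factor that is symmetric in the
coordinates. -/
lemma quintic_quadratic_transform {R : Type*} [CommRing R] (r s q x y z : R) :
    quintic r s q (y * z * (x + z) * (x + y)) (x * z * (y + z) * (x + y))
      (x * y * (x + z) * (y + z)) = 4 * (x * y * z) ^ 4 * ((x + y) * (x + z) * (y + z)) ^ 2 *
        ((s - q) * x ^ 2 + (q - r) * y ^ 2 - (s - q + (q - r)) * z ^ 2) := by
  unfold quintic
  set a := y * z * (x + z) * (x + y) with ha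
  set b := x * z * (y + z) * (x + y) with hb
  set c := x * y * (x + z) * (y + z) with hc
  have h1 : c * a + a * b - b * c = 2 * (x * y * z) * ((x + y) * (x + z) * (y + z)) * (y * z) := by
    rw [ha, hb, hc]; ring
  have h2 : a * b + b * c - c * a = 2 * (x * y * z) * ((x + y) * (x + z) * (y + z)) * (x * z) := by
    rw [ha, hb, hc]; ring
  have h3 : b * c + c * a - a * b = 2 * (x * y * z) * ((x + y) * (x + z) * (y + z)) * (x * y) := by
    rw [ha, hb, hc]; ring
  have h4 : b - c = x ^ 2 * (z ^ 2 - y ^ 2) := by rw [hb, hc]; ring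
  have h5 : c - a = y ^ 2 * (x ^ 2 - z ^ 2) := by rw [hc, ha]; ring
  have h6 : a - b = z ^ 2 * (y ^ 2 - x ^ 2) := by rw [ha, hb]; ring
  rw [h1, h2, h3, h4, h5, h6]
  generalize (x + y) * (x + z) * (y + z) = k
  ring

lemma ne_zero_of_eval {σ : Type*} {f : MvPolynomial σ ℂ} (z : σ → ℂ) (h : eval z f ≠ 0) :
    f ≠ 0 := by
  rintro rfl; exact h (map_zero _)

namespace CoordinateSystem
variable {K : CoordinateSystem}

/-- Parametrization of the conic `α x² + β y² = (α + β) z²` by the lines through `[1 : 1 : 1]`. -/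
lemma exists_conic_param {α β : ℂ} (hα : α ≠ 0) (hβ : β ≠ 0) (hαβ : α + β ≠ 0) :
    ∃ x y z : MvPolynomial (Fin 2) ℂ,
      (x.IsHomogeneous 2 ∧ y.IsHomogeneous 2 ∧ z.IsHomogeneous 2) ∧
      C α * x ^ 2 + C β * y ^ 2 - (C α + C β) * z ^ 2 = 0 ∧
      (x ≠ 0 ∧ y ≠ 0 ∧ z ≠ 0 ∧ x + y ≠ 0 ∧ x + z ≠ 0 ∧ y + z ≠ 0 ∧ x - z ≠ 0) ∧
      (x - z) * X 1 = (y - z) * X 0 := by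
  have hsq : ∀ i, ((X i : MvPolynomial (Fin 2) ℂ) ^ 2).IsHomogeneous 2 := fun i => by
    simpa using (isHomogeneous_X ℂ i).pow 2
  have hC : ∀ {n : ℕ} {f : MvPolynomial (Fin 2) ℂ} (c : ℂ), f.IsHomogeneous n →
      (C c * f).IsHomogeneous n := fun c hf => by
    simpa using (isHomogeneous_C (Fin 2) c).mul hf
  have h01 : (X 0 * X 1 : MvPolynomial (Fin 2) ℂ).IsHomogeneous 2 :=
    (isHomogeneous_X ℂ 0).mul (isHomogeneous_X ℂ 1)
  have h2 : (C (2 : ℂ) : MvPolynomial (Fin 2) ℂ) = 2 := map_ofNat C 2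
  refine ⟨C (-α) * X 0 ^ 2 + C β * X 1 ^ 2 - C (2 * β) * (X 0 * X 1),
    C α * X 0 ^ 2 - C β * X 1 ^ 2 - C (2 * α) * (X 0 * X 1), C α * X 0 ^ 2 + C β * X 1 ^ 2,
    ⟨?_, ?_, ?_⟩, ?_, ⟨?_, ?_, ?_, ?_, ?_, ?_, ?_⟩, ?_⟩
  · exact ((hC _ (hsq 0)).add (hC _ (hsq 1))).sub (hC _ h01)
  · exact ((hC _ (hsq 0)).sub (hC _ (hsq 1))).sub (hC _ h01)
  · exact (hC _ (hsq 0)).add (hC _ (hsq 1))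
  · rw [C_mul, C_mul, C_neg, h2]; ring
  · exact ne_zero_of_eval ![0, 1] (by simp [hβ])
  · exact ne_zero_of_eval ![1, 0] (by simp [hα])
  · exact ne_zero_of_eval ![1, 0] (by simp [hα])
  · have h : -(2 * β) + -(2 * α) ≠ 0 := fun h => hαβ (by linear_combination -h / 2)
    exact ne_zero_of_eval ![1, 1] (by
      simp only [map_add, map_sub, map_mul, map_pow, eval_C, eval_X, Matrix.cons_val_zero,
        Matrix.cons_val_one]
      intro h0
      exact h (by linear_combination h0))
  · exact ne_zero_of_eval ![0, 1] (by simp [hβ])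
  · exact ne_zero_of_eval ![1, 0] (by simp [hα])
  · exact ne_zero_of_eval ![1, 0] (by
      simp only [map_add, map_sub, map_mul, map_pow, eval_C, eval_X, Matrix.cons_val_zero,
        Matrix.cons_val_one]
      intro h0
      exact hα (by linear_combination -h0 / 2))
  · rw [C_mul, C_mul, C_neg, h2]; ring

/-- The quintic is parametrized by the conic of `quintic_quadratic_transform`, and the conic by the
lines through the unit point. -/
lemma quinticForm_isRationalCurve {r s q : ℂ} (hrs : r ≠ s) (hsq : s ≠ q) (hqr : q ≠ r)
    (hirr : Irreducible (K.quinticForm r s q)) : IsRationalCurve (K.quinticForm r s q) := by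
  obtain ⟨x, y, z, ⟨hxh, hyh, hzh⟩, hconic, ⟨n1, n2, n3, n4, n5, n6, n7⟩, hinv⟩ :=
    exists_conic_param (sub_ne_zero.mpr hsq) (sub_ne_zero.mpr hqr) (fun h => hrs (by
      linear_combination -h))
  have hX : ∀ i : Fin 3, (X i : Form).IsHomogeneous 1 := isHomogeneous_X ℂ
  set γ : Fin 3 → MvPolynomial (Fin 2) ℂ :=
    ![y * z * (x + z) * (x + y), x * z * (y + z) * (x + y), x * y * (x + z) * (y + z)] with hγ
  set h : Fin 2 → Form := ![(X 0 * X 1 + X 1 * X 2 - X 2 * X 0) * (X 1 * (X 2 - X 0)),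
    (X 2 * X 0 + X 0 * X 1 - X 1 * X 2) * (X 0 * (X 2 - X 1))] with hh
  have e0 : aeval γ (h 0) =
      2 * (x * y * z) ^ 3 * ((x + y) * (x + z) * (y + z)) ^ 2 * (x - z) := by
    simp only [hh, hγ, Matrix.cons_val_zero, map_mul, map_add, map_sub, aeval_X,
      Matrix.cons_val_one, Matrix.cons_val]
    ring
  have e1 : aeval γ (h 1) =
      2 * (x * y * z) ^ 3 * ((x + y) * (x + z) * (y + z)) ^ 2 * (y - z) := by
    simp only [hh, hγ, Matrix.cons_val_zero, map_mul, map_add, map_sub, aeval_X,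
      Matrix.cons_val_one, Matrix.cons_val]
    ring
  refine K.isRationalCurve (F₀ := quintic (C r) (C s) (C q) (X 0) (X 1) (X 2)) hirr ?_
    (d := 8) (e := 4) γ h ?_ ?_ ?_ ?_ ?_
  · rw [map_quintic]; simp [quinticForm, algebraMap_eq]
  · intro i
    fin_cases i
    · exact ((hyh.mul hzh).mul (hxh.add hzh)).mul (hxh.add hyh)
    · exact ((hxh.mul hzh).mul (hyh.add hzh)).mul (hxh.add hyh)
    · exact ((hxh.mul hyh).mul (hxh.add hzh)).mul (hyh.add hzh)
  · intro j
    fin_cases j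
    · exact ((((hX 0).mul (hX 1)).add ((hX 1).mul (hX 2))).sub ((hX 2).mul (hX 0))).mul
        ((hX 1).mul ((hX 2).sub (hX 0)))
    · exact ((((hX 2).mul (hX 0)).add ((hX 0).mul (hX 1))).sub ((hX 1).mul (hX 2))).mul
        ((hX 0).mul ((hX 2).sub (hX 1)))
  · rw [C_sub, C_sub] at hconic
    rw [map_quintic]
    simp only [hγ, aeval_X, aeval_C, algebraMap_eq, Matrix.cons_val_zero, Matrix.cons_val_one,
      Matrix.cons_val]
    rw [quintic_quadratic_transform, hconic, mul_zero]
  · rw [e0]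
    exact mul_ne_zero (mul_ne_zero (mul_ne_zero two_ne_zero (pow_ne_zero _
      (mul_ne_zero (mul_ne_zero n1 n2) n3)))
      (pow_ne_zero _ (mul_ne_zero (mul_ne_zero n4 n5) n6))) n7
  · rw [e0, e1, mul_assoc, mul_assoc _ (y - z), hinv]

lemma quinticForm_isHomogeneous (r s q : ℂ) : (K.quinticForm r s q).IsHomogeneous 5 := by
  have hX := K.coord_isHomogeneous
  have h : ∀ (c : ℂ) (i j k : Fin 3), (C c * (K.coord i - K.coord j) * (K.coord j * K.coord k +
      K.coord k * K.coord i - K.coord i * K.coord j) ^ 2).IsHomogeneous 5 := fun c i j k => by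
    simpa using (isHomogeneous_C_mul ((hX i).sub (hX j)) c).mul
      (((((hX j).mul (hX k)).add ((hX k).mul (hX i))).sub ((hX i).mul (hX j))).pow 2)
  have := ((h r 1 2 0).add (h s 2 0 1)).add (h q 0 1 2)
  exact this

lemma coord_sub_isHomogeneous (i j : Fin 3) : (K.coord i - K.coord j).IsHomogeneous 1 :=
  (K.coord_isHomogeneous i).sub (K.coord_isHomogeneous j)

/-- The parameters of an irreducible quintic are distinct: otherwise one of the three lines splits
off. -/
lemma quinticForm_ne {r s q : ℂ} (hirr : Irreducible (K.quinticForm r s q)) :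
    r ≠ s ∧ s ≠ q ∧ q ≠ r := by
  have key : ∀ i j, ¬ K.coord i - K.coord j ∣ K.quinticForm r s q := fun i j =>
    not_dvd_of_irreducible (quinticForm_isHomogeneous r s q) hirr (coord_sub_isHomogeneous i j)
      one_ne_zero (by norm_num)
  -- for equal parameters, the linear relation between the three summands gives a factorization
  refine ⟨?_, ?_, ?_⟩ <;> rintro rfl
  · refine key 0 1 ⟨(C q - C r) * (K.coord 1 * K.coord 2 + K.coord 2 * K.coord 0
      - K.coord 0 * K.coord 1) ^ 2, ?_⟩
    unfold quinticForm quintic; ring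
  · refine key 1 2 ⟨(C r - C s) * (K.coord 2 * K.coord 0 + K.coord 0 * K.coord 1
      - K.coord 1 * K.coord 2) ^ 2, ?_⟩
    unfold quinticForm quintic; ring
  · refine key 2 0 ⟨(C s - C q) * (K.coord 0 * K.coord 1 + K.coord 1 * K.coord 2
      - K.coord 2 * K.coord 0) ^ 2, ?_⟩
    unfold quinticForm quintic; ring

variable {p : Fin 3 → Point} {L : Fin 3 → Line} {p₄ : Point} {S : FrameSystem p L p₄}

lemma ordGE_two_of_rep_eq {k : Fin 3} {c : ℂ} (hc : c ≠ 0) {l : Fin 3 → ℂ}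
    (h : (L k).rep = c • l) : (S.A (some k)).OrdGE 2 (linForm l) := by
  have h1 : l = c⁻¹ • (L k).rep := by rw [h, smul_smul, inv_mul_cancel₀ hc, one_smul]
  rw [h1, ← S.e_some k]
  apply WeightedFrame.ordGE_linForm_of_dot_eq_zero
  · rw [smul_dotProduct, S.dot_v, smul_zero]
  · rw [smul_dotProduct, S.dot_u, smul_zero]

lemma coord_sub_ordGE {k i j : Fin 3} {c : ℂ} (hc : c ≠ 0)
    (h : (L k).rep = c • (K.ξ i - K.ξ j)) :
    (S.A (some k)).OrdGE 2 (K.coord i - K.coord j) := by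
  rw [coord, coord, ← linForm_sub]
  exact ordGE_two_of_rep_eq hc h

lemma ordGE_quintic {A : WeightedFrame} {x y z : Form} (hy : A.OrdGE 1 y) (hz : A.OrdGE 1 z)
    (hyz : A.OrdGE 2 (y - z)) (r s q : Form) : A.OrdGE 4 (quintic r s q x y z) := by
  have h1 : A.OrdGE 1 (x * (y + z) - y * z) := ((hy.add hz).mul_left x).sub (hy.mul_right z)
  have h2 : A.OrdGE 2 (y * z + x * (y - z)) := (hy.mul hz).add (hyz.mul_left x)
  have h3 : A.OrdGE 2 (y * z - x * (y - z)) := (hy.mul hz).sub (hyz.mul_left x)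
  have := (((hyz.mul_left r).mul (h1.pow 2)).add ((h2.pow 2).mul_left (s * (z - x)))).add
    ((h3.pow 2).mul_left (q * (x - y)))
  rwa [show r * (y - z) * (x * (y + z) - y * z) ^ 2 + s * (z - x) * (y * z + x * (y - z)) ^ 2 +
    q * (x - y) * (y * z - x * (y - z)) ^ 2 = quintic r s q x y z by unfold quintic; ring] at this

/-- Each quintic with the given tacnodes through the unit point is in the family, which is a pencil:
two of its curves have intersection number `3 · 8 + 1 = 5 · 5` at the four points. -/
lemma Adapted.exists_quintic (hK : K.Adapted S) {c : Fin 3 → ℂ} (hc : ∀ k, c k ≠ 0)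
    (hL : ∀ k, (L k).rep = c k • (K.ξ (k + 1) - K.ξ (k + 2))) {D : Form}
    (h : S.HasType D 5 (fun _ => 2) 1) : ∃ r s : ℂ, D = K.quinticForm r s 0 := by
  have hord : ∀ k, (S.A (some k)).OrdGE 2 (K.coord (k + 1) - K.coord (k + 2)) := fun k =>
    coord_sub_ordGE (hc k) (hL k)
  have main : ∀ r s : ℂ, (∀ k, (S.A (some k)).OrdGE 4 (K.quinticForm r s 0)) ∧
      (S.A none).OrdGE 1 (K.quinticForm r s 0) := by
    refine fun r s => ⟨fun k => ?_, ?_⟩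
    · fin_cases k
      · exact ordGE_quintic (hK.ordGE_coord (by decide)) (hK.ordGE_coord (by decide)) (hord 0) _ _ _
      · rw [quinticForm, ← quintic_rotate]
        exact ordGE_quintic (hK.ordGE_coord (by decide)) (hK.ordGE_coord (by decide)) (hord 1) _ _ _
      · rw [quinticForm, ← quintic_rotate, ← quintic_rotate]
        exact ordGE_quintic (hK.ordGE_coord (by decide)) (hK.ordGE_coord (by decide)) (hord 2) _ _ _
    · exact ((((hK.ordGE_coord_sub 1 2).mul_left _).mul_right _).add
        (((hK.ordGE_coord_sub 2 0).mul_left _).mul_right _)).add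
        (((hK.ordGE_coord_sub 0 1).mul_left _).mul_right _)
  obtain ⟨r, s, hD⟩ := h.exists_pencil (fun _ => 2) (b' := 1) (quinticForm_isHomogeneous 1 0 0)
    (quinticForm_isHomogeneous 0 1 0) (main 1 0).1 (main 0 1).1 (main 1 0).2 (main 0 1).2 (by simp)
    (fun r s h0 => by
      have h1 := congrArg (eval (K.vec ![1, 2, 1])) h0
      have h2 := congrArg (eval (K.vec ![1, 1, 2])) h0
      simp [quinticForm, quintic, eval_vec_coord] at h1 h2
      norm_num at h1 h2
      exact ⟨h1, by linear_combination h2 + h1⟩)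
  refine ⟨r, s, ?_⟩
  rw [hD]
  simp [quinticForm, quintic]
  ring

end CoordinateSystem

/-! ### The octics with a quintic component -/

lemma irreducible_C_mul {F : Form} (h : Irreducible F) {c : ℂ} (hc : c ≠ 0) :
    Irreducible (C c * F) :=
  (irreducible_isUnit_mul ((isUnit_iff_ne_zero.mpr hc).map C)).mpr h

lemma lineForm_isRationalCurve (M : Line) : IsRationalCurve (lineForm M) :=
  linForm_isRationalCurve M.rep_nonzero

section
variable {p : Fin 3 → Point} {L : Fin 3 → Line} {p₄ : Point} {S : FrameSystem p L p₄}
  {K : CoordinateSystem}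

lemma FrameSystem.HasType.not_dvd {D D' : Form} {d d' b b' : ℕ} {a a' : Fin 3 → ℕ}
    (h : S.HasType D d a b) (h' : S.HasType D' d' a' b') {k : Fin 3} (hk : 1 ≤ a k)
    (hk' : a' k = 0) : ¬ D ∣ D' := by
  rintro ⟨G, rfl⟩
  apply h'.eval_ne_zero hk'
  have := ((S.A (some k)).ordGE_one_iff D).mp ((h.ord k).mono (by omega))
  rw [map_mul, this, zero_mul]

lemma FrameSystem.HasType.not_dvd_of_degree_ne {D D' : Form} {d d' b b' : ℕ} {a a' : Fin 3 → ℕ}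
    (h : S.HasType D d a b) (h' : S.HasType D' d' a' b') (hd : d ≠ d') : ¬ D ∣ D' := by
  rcases hd.lt_or_gt with hlt | hlt
  · exact not_dvd_of_irreducible h'.hom h'.irr h.hom (degree_ne_zero_of_irreducible h.hom h.irr) hlt
  · exact not_dvd_of_degree_lt h.hom h'.hom h'.irr.ne_zero hlt

lemma FrameSystem.passesThrough_lineForm {M : Line} (h : M.rep ⬝ᵥ (S.A none).v = 0) :
    PassesThrough (lineForm M) p₄ := by
  rwa [← S.p_none, lineForm_eq, WeightedFrame.passesThrough_iff _ (linForm_isHomogeneous _),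
    WeightedFrame.ordGE_one_iff, eval_linForm]

namespace CoordinateSystem

lemma Adapted.eq_of_passesThrough (hK : K.Adapted S) {M N : Line} {c c' : ℂ} (hc : c ≠ 0)
    (hc' : c' ≠ 0) (hM : M.rep = c • (K.ξ 1 - K.ξ 2)) (hN : N.rep = c' • (K.ξ 2 - K.ξ 0))
    {q : Point} (h1 : PassesThrough (lineForm M) q) (h2 : PassesThrough (lineForm N) q) :
    q = p₄ := by
  rw [PassesThrough, lineForm_eq, eval_linForm, hM, smul_dotProduct, sub_dotProduct, smul_eq_mul,
    mul_eq_zero, sub_eq_zero] at h1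
  rw [PassesThrough, lineForm_eq, eval_linForm, hN, smul_dotProduct, sub_dotProduct, smul_eq_mul,
    mul_eq_zero, sub_eq_zero] at h2
  refine eq_of_rep_mem hK.mem_unit (c := K.ξ 0 ⬝ᵥ q.rep) ?_
  have := K.expand q.rep
  rwa [Fin.sum_univ_three, h1.resolve_left hc, h2.resolve_left hc', ← smul_add, ← smul_add] at this

lemma C_mul_quinticForm (c r s q : ℂ) :
    C c * K.quinticForm r s q = K.quinticForm (c * r) (c * s) (c * q) := by
  simp only [quinticForm, quintic, C_mul]; ring

end CoordinateSystem

/-- The octics with a component that is a quintic with three tacnodes. -/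
theorem quintic_case {F : Form} (hF : F.IsHomogeneous 8) (h33 : ∀ i, IsReducedAt F (p i))
    (h4 : IsReducedAt F p₄) {E : Fin 4 → Form} (hprod : F = ∏ i, E i)
    (h0 : S.HasType (E 0) 5 (fun _ => 2) 1)
    (hl : ∀ k : Fin 3, S.HasType (E k.succ) 1 (fun j => if j = k then 1 else 0) 1) :
    Squarefree F ∧ (∀ q, IsSingularAt F q → q = p₄ ∨ ∃ i, q = p i) ∧
      IsQuinticConfiguration F p L p₄ ∧ (∀ i, IsNondegInfNearPoint 3 F (p i) (L i)) ∧
      IsOrdinaryPoint 4 F p₄ := by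
  have htype : ∀ i, S.HasType (E i) ((![5, 1, 1, 1] : Fin 4 → ℕ) i)
      ((Fin.cons (fun _ => 2) fun k j => if j = k then 1 else 0 : Fin 4 → Fin 3 → ℕ) i) 1 := by
    refine Fin.cases h0 fun k => ?_
    have h1 : (![5, 1, 1, 1] : Fin 4 → ℕ) k.succ = 1 := by fin_cases k <;> rfl
    rw [h1, Fin.cons_succ]
    exact hl k
  choose c hc hEc using fun k => (hl k).line_eq (k := k) (by simp)
  have hdot : ∀ k, (L k).rep ⬝ᵥ (S.A none).v = 0 := fun k =>
    (hl k).dot_none_eq_zero (k := k) (by simp) le_rfl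
  have hdot' : ∀ k j, j ≠ k → (L k).rep ⬝ᵥ (S.A (some j)).v ≠ 0 := fun k j hj =>
    (hl k).dot_some_ne_zero (k := k) (j := j) (by simp) (by simp [hj])
  have hLI := h0.linearIndependent (by norm_num) (by simp)
  obtain ⟨K, hK⟩ := CoordinateSystem.exists_adapted hLI (hdot 0) (hdot 1)
    (hdot' 0 1 (by decide)) (hdot' 0 2 (by decide)) (hdot' 1 0 (by decide)) (hdot' 1 2 (by decide))
  choose m hm hL using fun k => K.eq_smul_sub (i := k + 1) (j := k + 2) (k := k)
    (by revert k; decide) (by revert k; decide) (by revert k; decide) (L k).rep_nonzero (hK.dot_e k)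
    (hK.unit ▸ hdot k)
  obtain ⟨r, s, hE0⟩ := hK.exists_quintic hm hL h0
  set κ := c 0 * c 1 * c 2 with hκ
  have hκ0 : κ ≠ 0 := mul_ne_zero (mul_ne_zero (hc 0) (hc 1)) (hc 2)
  have hD : C κ * E 0 = K.quinticForm (κ * r) (κ * s) 0 := by
    rw [hE0, K.C_mul_quinticForm, mul_zero]
  have hirr : Irreducible (K.quinticForm (κ * r) (κ * s) 0) := hD ▸ irreducible_C_mul h0.irr hκ0
  obtain ⟨n1, n2, n3⟩ := K.quinticForm_ne hirr
  have hFD : F = K.quinticForm (κ * r) (κ * s) 0 * lineForm (L 0) * lineForm (L 1) *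
      lineForm (L 2) := by
    rw [hprod, Fin.prod_univ_succ, Fin.prod_univ_three, hEc, hEc, hEc, ← hD, hκ, C_mul, C_mul]
    ring
  have hline : ∀ k, lineForm (L k) = C (m k) * (K.coord (k + 1) - K.coord (k + 2)) := fun k =>
    CoordinateSystem.lineForm_eq_of_rep (hL k)
  have hFt : F = C (m 0 * m 1 * m 2) *
      (K.quinticForm (κ * r) (κ * s) 0 * K.triangleForm) := by
    have e0 : lineForm (L 0) = C (m 0) * (K.coord 1 - K.coord 2) := hline 0
    have e1 : lineForm (L 1) = C (m 1) * (K.coord 2 - K.coord 0) := hline 1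
    have e2 : lineForm (L 2) = C (m 2) * (K.coord 0 - K.coord 1) := hline 2
    rw [hFD, e0, e1, e2, C_mul, C_mul, CoordinateSystem.triangleForm]
    ring
  have hμ : m 0 * m 1 * m 2 ≠ 0 := mul_ne_zero (mul_ne_zero (hm 0) (hm 1)) (hm 2)
  have hnd := K.quintic_isNondegInfNearPoint n1 n2 n3 hμ hK.mem hL hFt h33
  refine ⟨FrameSystem.squarefree_of_components hprod (fun i => (htype i).irr) fun i =>
    ⟨p₄, h4, (htype i).passesThrough_none le_rfl⟩, fun q hq => ?_, ⟨fun q => ⟨fun h => ?_, ?_⟩,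
    _, K.quinticForm_isHomogeneous _ _ _, K.quinticForm_isRationalCurve n1 n2 n3 hirr, hFD, ?_,
    fun i => (hnd i).1⟩, fun i => (hnd i).2,
    K.quintic_isOrdinaryPoint n1 n2 n3 hμ hK.mem_unit hFt h4⟩
  · refine FrameSystem.eq_of_isSingularAt hF hprod htype ?_ (by decide) (by decide) hq
    refine Fin.cases (Fin.cases (fun h => absurd rfl h) fun k _ => ?_) fun k =>
      Fin.cases (fun _ => ?_) fun l hkl => ?_
    · exact h0.not_dvd_of_degree_ne (hl k) (by norm_num)
    · exact (hl k).not_dvd_of_degree_ne h0 (by norm_num)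
    · exact (hl k).not_dvd (hl l) (k := k) (by simp) (by
        rw [if_neg]; rintro rfl; exact hkl rfl)
  · exact hK.eq_of_passesThrough (hm 0) (hm 1) (hL 0) (hL 1) (h 0) (h 1)
  · rintro rfl i
    exact FrameSystem.passesThrough_lineForm (hdot i)
  · rw [← hD, PassesThrough, map_mul, show eval p₄.rep (E 0) = 0 from
      h0.passesThrough_none le_rfl, mul_zero]

end

/-! ### The quartics with a tacnode and a node -/

/-- The quartics with a node at the unit point, a tacnode at the third base point with tangent line
`x + y = 0`, and tangent at the other two base points to the lines through the unit point. They form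
a pencil, generated by a double conic and the sum of two lines and the double tacnodal tangent. -/
def quartic {R : Type*} [CommRing R] (a c x y z : R) : R :=
  a * ((y * z + x * z - 2 * (x * y)) ^ 2 - c * ((y - z) * (x - z) * (x + y) ^ 2))

lemma map_quartic {R R' : Type*} [CommRing R] [CommRing R'] [Algebra ℂ R] [Algebra ℂ R']
    (f : R →ₐ[ℂ] R') (a c x y z : R) :
    f (quartic a c x y z) = quartic (f a) (f c) (f x) (f y) (f z) := by
  have h2 : f 2 = 2 := map_ofNat f 2
  simp [quartic, h2]

namespace CoordinateSystem
variable (K : CoordinateSystem)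

/-- The quartic with parameters `a`, `c` in given coordinates. -/
def quarticForm (a c : ℂ) : Form :=
  quartic (C a) (C c) (K.coord 0) (K.coord 1) (K.coord 2)

/-- The conic through the base points that is tangent at two of them to the lines through the unit
point. -/
def conicForm : Form :=
  K.coord 0 * K.coord 1 - K.coord 0 * K.coord 2 - K.coord 1 * K.coord 2

/-- The sum of the conic and its two tangent lines through the unit point. -/
def residualForm : Form :=
  K.conicForm * ((K.coord 1 - K.coord 2) * (K.coord 2 - K.coord 0))

lemma quarticForm_perm (a c : ℂ) :
    (K.perm (Equiv.swap 0 1)).quarticForm a c = K.quarticForm a c := by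
  change quartic (C a) (C c) (K.coord 1) (K.coord 0) (K.coord 2) = _
  unfold quarticForm quartic; ring

lemma residualForm_perm : (K.perm (Equiv.swap 0 1)).residualForm = K.residualForm := by
  change (K.coord 1 * K.coord 0 - K.coord 1 * K.coord 2 - K.coord 0 * K.coord 2) *
    ((K.coord 0 - K.coord 2) * (K.coord 2 - K.coord 1)) = _
  unfold residualForm conicForm; ring

variable {K}

/-- The initial forms at the first base point, along the line to the unit point. -/
lemma hasInit_quarticForm_zero {A : WeightedFrame} (hv : A.v = K.vec ![1, 0, 0])
    (hu : A.u = K.vec ![0, 1, 1]) (hw : A.w = K.vec ![0, 1, 0]) (he : A.e = 2) (a c : ℂ) :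
    A.HasInit 2 (K.quarticForm a c) (C a * (X 0 ^ 2 - C c * X 1)) ∧
    A.HasInit 4 K.residualForm ((X 0 ^ 2 - X 1) * X 1) := by
  have h := K.loc_coord hv hu hw
  set T : Polynomial Germ := Polynomial.X
  set x' : Polynomial Germ := Polynomial.C (X 0)
  set y' : Polynomial Germ := Polynomial.C (X 1)
  have h0 : A.loc (K.coord 0) = 1 := by rw [h]; simp
  have h1 : A.loc (K.coord 1) = T * (x' + T * y') := by
    rw [h, he]; simp [x', y']; ring
  have h2 : A.loc (K.coord 2) = T * x' := by
    rw [h]; simp [x', mul_comm]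
  constructor
  · refine ⟨Polynomial.C (C a) * ((T * (x' + T * y') * x' + x' - 2 * (x' + T * y')) ^ 2 -
      Polynomial.C (C c) * (y' * (1 - T * x') * (1 + T * (x' + T * y')) ^ 2)), ?_, ?_⟩
    · rw [quarticForm, map_quartic, h0, h1, h2, WeightedFrame.loc_C, WeightedFrame.loc_C, quartic]
      ring
    · rw [Polynomial.coeff_zero_eq_eval_zero]
      simp only [x', y', T, Polynomial.eval_add, Polynomial.eval_mul, Polynomial.eval_sub,
        Polynomial.eval_pow, Polynomial.eval_C, Polynomial.eval_X, Polynomial.eval_one,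
        Polynomial.eval_ofNat]
      ring
  · refine ⟨(y' - (x' + T * y') * x') * (y' * (T * x' - 1)), ?_, ?_⟩
    · rw [residualForm, conicForm]
      simp only [map_mul, map_sub, h0, h1, h2]
      ring
    · rw [Polynomial.coeff_zero_eq_eval_zero]
      simp only [x', y', T, Polynomial.eval_add, Polynomial.eval_mul, Polynomial.eval_sub,
        Polynomial.eval_C, Polynomial.eval_X, Polynomial.eval_one]
      ring

/-- The initial forms at the third base point, along the line `x + y = 0`. -/
lemma hasInit_quarticForm_two {A : WeightedFrame} (hv : A.v = K.vec ![0, 0, 1])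
    (hu : A.u = K.vec ![1, -1, 0]) (hw : A.w = K.vec ![1, 0, 0]) (he : A.e = 2) (a c : ℂ) :
    A.HasInit 4 (K.quarticForm a c) (C a * ((X 1 + 2 * X 0 ^ 2) ^ 2 - C c * X 1 ^ 2)) ∧
    A.HasInit 2 K.residualForm (X 0 ^ 2 + X 1) := by
  have h := K.loc_coord hv hu hw
  set T : Polynomial Germ := Polynomial.X
  set x' : Polynomial Germ := Polynomial.C (X 0)
  set y' : Polynomial Germ := Polynomial.C (X 1)
  have h0 : A.loc (K.coord 0) = T * (x' + T * y') := by
    rw [h, he]; simp [x', y']; ring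
  have h1 : A.loc (K.coord 1) = -(T * x') := by
    rw [h]; simp [x']; ring
  have h2 : A.loc (K.coord 2) = 1 := by rw [h]; simp
  constructor
  · refine ⟨Polynomial.C (C a) * ((y' + 2 * (x' * (x' + T * y'))) ^ 2 -
      Polynomial.C (C c) * ((-(T * x') - 1) * (T * (x' + T * y') - 1) * y' ^ 2)), ?_, ?_⟩
    · rw [quarticForm, map_quartic, h0, h1, h2, WeightedFrame.loc_C, WeightedFrame.loc_C, quartic]
      ring
    · rw [Polynomial.coeff_zero_eq_eval_zero]
      simp only [x', y', T, Polynomial.eval_add, Polynomial.eval_mul, Polynomial.eval_sub,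
        Polynomial.eval_pow, Polynomial.eval_C, Polynomial.eval_X, Polynomial.eval_one,
        Polynomial.eval_ofNat, Polynomial.eval_neg]
      ring
  · refine ⟨-(x' * (x' + T * y') + y') * ((-(T * x') - 1) * (1 - T * (x' + T * y'))), ?_, ?_⟩
    · rw [residualForm, conicForm]
      simp only [map_mul, map_sub, h0, h1, h2]
      ring
    · rw [Polynomial.coeff_zero_eq_eval_zero]
      simp only [x', y', T, Polynomial.eval_add, Polynomial.eval_mul, Polynomial.eval_sub,
        Polynomial.eval_C, Polynomial.eval_X, Polynomial.eval_one, Polynomial.eval_neg]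
      ring

/-- The initial forms at the unit point. -/
lemma hasInit_quarticForm_unit {A : WeightedFrame} (hv : A.v = K.vec ![1, 1, 1])
    (hu : A.u = K.vec ![1, 0, 0]) (hw : A.w = K.vec ![0, 1, 0]) (he : A.e = 1) (a c : ℂ) :
    A.HasInit 2 (K.quarticForm a c) (C a * ((X 0 + X 1) ^ 2 - 4 * C c * (X 0 * X 1))) ∧
    A.HasInit 2 K.residualForm (X 0 * X 1) := by
  have h := K.loc_coord hv hu hw
  set T : Polynomial Germ := Polynomial.X
  set x' : Polynomial Germ := Polynomial.C (X 0)
  set y' : Polynomial Germ := Polynomial.C (X 1)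
  have h0 : A.loc (K.coord 0) = 1 + T * x' := by rw [h]; simp [x', mul_comm]
  have h1 : A.loc (K.coord 1) = 1 + T * y' := by rw [h, he]; simp [y', mul_comm]
  have h2 : A.loc (K.coord 2) = 1 := by rw [h]; simp
  constructor
  · refine ⟨Polynomial.C (C a) * ((x' + y' + 2 * T * (x' * y')) ^ 2 -
      Polynomial.C (C c) * (x' * y' * (2 + T * (x' + y')) ^ 2)), ?_, ?_⟩
    · rw [quarticForm, map_quartic, h0, h1, h2, WeightedFrame.loc_C, WeightedFrame.loc_C, quartic]
      ring
    · rw [Polynomial.coeff_zero_eq_eval_zero]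
      simp only [x', y', T, Polynomial.eval_add, Polynomial.eval_mul, Polynomial.eval_sub,
        Polynomial.eval_pow, Polynomial.eval_C, Polynomial.eval_X, Polynomial.eval_ofNat]
      ring
  · refine ⟨(T ^ 2 * (x' * y') - 1) * (y' * (-x')), ?_, ?_⟩
    · rw [residualForm, conicForm]
      simp only [map_mul, map_sub, h0, h1, h2]
      ring
    · rw [Polynomial.coeff_zero_eq_eval_zero]
      simp [x', y', T, mul_comm]

variable {a c μ : ℂ} {F : Form} {P : Point} {M : Line}

/-- The `[3;3]`-point at the first base point: quartic, conic and line have the initial forms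
`x² - c y`, `x² - y` and `y`. -/
lemma quartic_isNondegInfNearPoint_zero (ha : a ≠ 0) (hc : c ≠ 0) (hc1 : c ≠ 1) (hμ : μ ≠ 0)
    (hP : K.e 0 ∈ P.submodule) {m : ℂ} (hM : M.rep = m • (K.ξ 1 - K.ξ 2))
    (hF : F = C μ * (K.quarticForm a c * K.residualForm)) (hred : IsReducedAt F P) :
    IsNondegInfNearPoint 3 F P M := by
  obtain ⟨A, rfl, hv, hu, hw, he⟩ := K.exists_weightedFrame (b := ![0, 1, 1]) (c := ![0, 1, 0])
    (K.vec_zero.symm ▸ hP) (by simp [Matrix.det_fin_three]) two_pos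
  have hMv : M.rep ⬝ᵥ A.v = 0 := by simp [hM, hv, dot_vec]
  have hMu : M.rep ⬝ᵥ A.u = 0 := by simp [hM, hu, dot_vec]
  obtain ⟨h1, h2⟩ := hasInit_quarticForm_zero hv hu hw he a c
  have h3 := (h1.mul h2).C_mul μ
  rw [← hF] at h3
  refine WeightedFrame.HasInit.isNondegInfNearPoint he hMv hMu hred
    ![1, 1, 0] ![-c, -1, μ * a] ?_ ?_ ?_
  · convert h3 using 1
    simp only [Fin.prod_univ_three, Matrix.cons_val_zero, Matrix.cons_val_one, Matrix.cons_val,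
      map_mul, map_neg, C_1, C_0]
    ring
  · intro i; fin_cases i <;> simp [hc, hμ, ha]
  · intro i j hij
    fin_cases i <;> fin_cases j <;> simp [hc1, hc1.symm, hμ, ha] at hij ⊢

/-- The tacnode of the quartic, and the `[3;3]`-point of its sum with the conic: with `c = w²`, the
branches of the quartic have the initial forms `2 x² + (1 ± w) y`, and the conic has `x² + y`. -/
lemma quartic_isNondegInfNearPoint_two (ha : a ≠ 0) (hc : c ≠ 0) (hc1 : c ≠ 1) (hμ : μ ≠ 0)
    (hP : K.e 2 ∈ P.submodule) {m : ℂ} (hM : M.rep = m • (K.ξ 0 + K.ξ 1))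
    (hF : F = C μ * (K.quarticForm a c * K.residualForm)) (hred : IsReducedAt F P) :
    IsNondegInfNearPoint 2 (K.quarticForm a c) P M ∧ IsNondegInfNearPoint 3 F P M := by
  obtain ⟨A, rfl, hv, hu, hw, he⟩ := K.exists_weightedFrame (b := ![1, -1, 0]) (c := ![1, 0, 0])
    (K.vec_two.symm ▸ hP) (by simp [Matrix.det_fin_three]) two_pos
  have hMv : M.rep ⬝ᵥ A.v = 0 := by simp [hM, hv, dot_vec]
  have hMu : M.rep ⬝ᵥ A.u = 0 := by simp [hM, hu, dot_vec]
  obtain ⟨h1, h2⟩ := hasInit_quarticForm_two hv hu hw he a c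
  obtain ⟨w, hw⟩ := IsAlgClosed.exists_pow_nat_eq c two_pos
  have hw0 : w ≠ 0 := by rintro rfl; exact hc (by rw [← hw]; ring)
  have hw1 : 1 - w ≠ 0 := fun h => hc1 (by rw [← hw]; linear_combination -(1 + w) * h)
  have hw2 : 1 + w ≠ 0 := fun h => hc1 (by rw [← hw]; linear_combination -(1 - w) * h)
  have hC : (C c : Germ) = C w ^ 2 := by rw [← C_pow, hw]
  have hC2 : (C 2 : Germ) = 2 := map_ofNat C 2
  have n1 : 2 * a * (1 + w) ≠ 2 * (a * (1 - w)) := fun h => hw0 (by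
    have : a * w = 0 := by linear_combination h / 4
    exact (mul_eq_zero.mp this).resolve_left ha)
  have n2 : a * (1 - w) ≠ 2 * a := fun h => hw2 (by
    have : a * (1 + w) = 0 := by linear_combination -h
    exact (mul_eq_zero.mp this).resolve_left ha)
  have n3 : 1 + w ≠ 2 := fun h => hw1 (by linear_combination -h)
  constructor
  · refine WeightedFrame.HasInit.isNondegInfNearPoint he hMv hMu
      (hred.of_dvd (hF ▸ (dvd_mul_right _ _).mul_left _)) ![2 * a, 2] ![a * (1 - w), 1 + w] ?_ ?_ ?_
    · convert h1 using 1
      simp only [Fin.prod_univ_two, Matrix.cons_val_zero, Matrix.cons_val_one, hC, map_sub, map_mul,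
        map_add, C_1, hC2]
      ring
    · intro i; fin_cases i <;> simp [ha, hw1, hw2]
    · intro i j hij
      fin_cases i <;> fin_cases j
      exacts [absurd rfl hij, n1, n1.symm, absurd rfl hij]
  · have h3 := (h1.mul h2).C_mul μ
    rw [← hF] at h3
    refine WeightedFrame.HasInit.isNondegInfNearPoint he hMv hMu hred
      ![2 * a, 2, μ] ![a * (1 - w), 1 + w, μ] ?_ ?_ ?_
    · convert h3 using 1
      simp only [Fin.prod_univ_three, Matrix.cons_val_zero, Matrix.cons_val_one, Matrix.cons_val,
        hC, map_sub, map_mul, map_add, C_1, hC2]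
      ring
    · intro i; fin_cases i <;> simp [ha, hw1, hw2, hμ]
    · have n2' : 2 * a * μ ≠ μ * (a * (1 - w)) := fun h =>
        n2 (mul_left_cancel₀ hμ (by linear_combination -h))
      have n3' : 2 * μ ≠ μ * (1 + w) := fun h => n3 (mul_left_cancel₀ hμ (by linear_combination -h))
      intro i j hij
      fin_cases i <;> fin_cases j
      exacts [absurd rfl hij, n1, n2', n1.symm, absurd rfl hij, n3', n2'.symm, n3'.symm,
        absurd rfl hij]

/-- The node of the quartic, and the quadruple point of its sum with the two lines: the initial form
of the quartic is palindromic in `x` and `y`, and the lines have the initial forms `x` and `y`. -/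
lemma quartic_isOrdinaryPoint (ha : a ≠ 0) (hc : c ≠ 0) (hc1 : c ≠ 1) (hμ : μ ≠ 0)
    (hP : K.e 0 + K.e 1 + K.e 2 ∈ P.submodule)
    (hF : F = C μ * (K.quarticForm a c * K.residualForm)) (hred : IsReducedAt F P) :
    IsOrdinaryPoint 2 (K.quarticForm a c) P ∧ IsOrdinaryPoint 4 F P := by
  obtain ⟨A, rfl, hv, hu, hw, he⟩ := K.exists_weightedFrame (b := ![1, 0, 0]) (c := ![0, 1, 0])
    (K.vec_unit.symm ▸ hP) (by simp [Matrix.det_fin_three]) one_pos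
  obtain ⟨h1, h2⟩ := hasInit_quarticForm_unit hv hu hw he a c
  obtain ⟨t, u, htu, hne, hb⟩ := exists_palindromic_roots (b := a * (2 - 4 * c)) ha (by
    intro h0
    have h1 : 16 * (a ^ 2 * (c * (c - 1))) = 0 := by linear_combination h0
    simp [sub_eq_zero, ha, hc, hc1] at h1)
  have ht : t ≠ 0 := left_ne_zero_of_mul (htu ▸ one_ne_zero)
  have hu : u ≠ 0 := right_ne_zero_of_mul (htu ▸ one_ne_zero)
  have hC : (C t * C u : Germ) = 1 := by rw [← C_mul, htu, C_1]
  have hbC : (C a * (2 - 4 * C c) : Germ) = -C a * (C t + C u) := by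
    have h2 : (C 2 : Germ) = 2 := map_ofNat C 2
    have h4 : (C 4 : Germ) = 4 := map_ofNat C 4
    have := congrArg (C : ℂ → Germ) hb
    simpa only [C_mul, C_sub, C_add, C_neg, h2, h4] using this
  have n1 : 1 * (-(a * u)) ≠ a * -t := fun h =>
    hne (mul_left_cancel₀ ha (by linear_combination h))
  constructor
  · refine WeightedFrame.HasInit.isOrdinaryPoint he
      (hred.of_dvd (hF ▸ (dvd_mul_right _ _).mul_left _)) ![1, a] ![-t, -(a * u)] ?_ ?_ ?_
    · convert h1 using 1
      simp only [Fin.prod_univ_two, Matrix.cons_val_zero, Matrix.cons_val_one, map_mul,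
        map_neg, C_1]
      linear_combination C a * X 1 ^ 2 * hC - X 0 * X 1 * hbC
    · intro i; fin_cases i <;> simp [ha]
    · intro i j hij
      fin_cases i <;> fin_cases j
      exacts [absurd rfl hij, n1, n1.symm, absurd rfl hij]
  · have h3 := (h1.mul h2).C_mul μ
    rw [← hF] at h3
    refine WeightedFrame.HasInit.isOrdinaryPoint he hred
      ![1, a, μ, 0] ![-t, -(a * u), 0, 1] ?_ ?_ ?_
    · convert h3 using 1
      simp only [Fin.prod_univ_four, Matrix.cons_val_zero, Matrix.cons_val_one, Matrix.cons_val,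
        map_mul, map_neg, C_1, C_0]
      linear_combination C μ * X 0 * X 1 * (C a * X 1 ^ 2 * hC - X 0 * X 1 * hbC)
    · intro i; fin_cases i <;> simp [ha, hμ]
    · intro i j hij
      fin_cases i <;> fin_cases j
      all_goals
        first
        | exact absurd rfl hij
        | exact n1
        | exact n1.symm
        | simp [ha, ha.symm, hμ, hμ.symm, ht, hu]

end CoordinateSystem

namespace CoordinateSystem
variable {K : CoordinateSystem}

/-- Parametrization of the quartic: on it, `s = Q / ((x + y) (y - z))` with
`Q = y z + x z - 2 x y` satisfies `s² = c (x - z) / (y - z)`, and the two equations determine the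
point. -/
lemma exists_quartic_param {c : ℂ} (hc : c ≠ 0) :
    ∃ x y z : MvPolynomial (Fin 2) ℂ,
      (x.IsHomogeneous 4 ∧ y.IsHomogeneous 4 ∧ z.IsHomogeneous 4) ∧
      (x + y ≠ 0 ∧ y - z ≠ 0) ∧
      (y * z + x * z - 2 * (x * y)) * X 1 = (x + y) * (y - z) * X 0 ∧
      C c * (x - z) * X 1 ^ 2 = (y - z) * X 0 ^ 2 := by
  set s : MvPolynomial (Fin 2) ℂ := X 0
  set t : MvPolynomial (Fin 2) ℂ := X 1
  have hs : s.IsHomogeneous 1 := isHomogeneous_X ℂ 0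
  have ht : t.IsHomogeneous 1 := isHomogeneous_X ℂ 1
  have hC : ∀ {n : ℕ} {f : MvPolynomial (Fin 2) ℂ} (c : ℂ), f.IsHomogeneous n →
      (C c * f).IsHomogeneous n := fun c hf => by
    simpa using (isHomogeneous_C (Fin 2) c).mul hf
  have h2 : (C (2 : ℂ) : MvPolynomial (Fin 2) ℂ) = 2 := map_ofNat C 2
  set q := s ^ 2 + C c * t ^ 2 + C (2 * c) * (s * t) with hq
  set z := C c * (t * (C 2 * (s ^ 2 * t) + s ^ 3 + C c * (s * t ^ 2))) with hz
  have hqh : q.IsHomogeneous 2 := ((hs.pow 2).add (hC _ (ht.pow 2))).add (hC _ (hs.mul ht))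
  have hzh : z.IsHomogeneous 4 := hC _ (ht.mul (((hC _ ((hs.pow 2).mul ht)).add (hs.pow 3)).add
    (hC _ (hs.mul (ht.pow 2)))))
  refine ⟨z - s ^ 2 * q, z - C c * (t ^ 2 * q), z, ⟨hzh.sub ((hs.pow 2).mul hqh),
    hzh.sub (hC _ ((ht.pow 2).mul hqh)), hzh⟩, ⟨?_, ?_⟩, ?_, ?_⟩
  · exact ne_zero_of_eval ![1, 0] (by simp [hz, hq, s, t])
  · exact ne_zero_of_eval ![0, 1] (by simp [hz, hq, s, t, hc])
  · rw [hz, hq, C_mul, h2]; ring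
  · ring

lemma quarticForm_isRationalCurve {a c : ℂ} (hc : c ≠ 0) (hirr : Irreducible (K.quarticForm a c)) :
    IsRationalCurve (K.quarticForm a c) := by
  obtain ⟨x, y, z, ⟨hx, hy, hz⟩, ⟨n1, n2⟩, h1, h2⟩ := exists_quartic_param hc
  have hX : ∀ i : Fin 3, (X i : Form).IsHomogeneous 1 := isHomogeneous_X ℂ
  have hC : (C (2 : ℂ) : MvPolynomial (Fin 2) ℂ) = 2 := map_ofNat C 2
  refine K.isRationalCurve (F₀ := quartic (C a) (C c) (X 0) (X 1) (X 2)) hirr ?_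
    (d := 4) (e := 2) ![x, y, z]
    ![X 1 * X 2 + X 0 * X 2 - C 2 * (X 0 * X 1), (X 0 + X 1) * (X 1 - X 2)] ?_ ?_ ?_ ?_ ?_
  · rw [map_quartic]; simp [quarticForm, algebraMap_eq]
  · intro i
    fin_cases i
    exacts [hx, hy, hz]
  · intro j
    fin_cases j
    · exact (((hX 1).mul (hX 2)).add ((hX 0).mul (hX 2))).sub
        (isHomogeneous_C_mul ((hX 0).mul (hX 1)) 2)
    · exact ((hX 0).add (hX 1)).mul ((hX 1).sub (hX 2))
  · rw [map_quartic]
    simp only [aeval_X, aeval_C, algebraMap_eq, Matrix.cons_val_zero, Matrix.cons_val_one,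
      Matrix.cons_val]
    have ht : (X 1 : MvPolynomial (Fin 2) ℂ) ^ 2 ≠ 0 := pow_ne_zero _ (X_ne_zero 1)
    refine (mul_eq_zero.mp ?_).resolve_left ht
    unfold quartic
    linear_combination C a * ((y * z + x * z - 2 * (x * y)) * X 1 + (x + y) * (y - z) * X 0) * h1 -
      C a * (y - z) * (x + y) ^ 2 * h2
  · have e0 : aeval ![x, y, z] ((![X 1 * X 2 + X 0 * X 2 - C 2 * (X 0 * X 1),
        (X 0 + X 1) * (X 1 - X 2)] : Fin 2 → Form) 0) = y * z + x * z - 2 * (x * y) := by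
      simp only [map_add, map_sub, map_mul, aeval_X, aeval_C, algebraMap_eq,
        Matrix.cons_val_zero, Matrix.cons_val_one, Matrix.cons_val, hC]
    rw [e0]
    intro h0
    rw [h0, zero_mul] at h1
    exact mul_ne_zero (mul_ne_zero n1 n2) (X_ne_zero 0) h1.symm
  · simpa only [map_add, map_sub, map_mul, aeval_X, aeval_C, algebraMap_eq,
      Matrix.cons_val_zero, Matrix.cons_val_one, Matrix.cons_val, hC] using h1

lemma conicForm_isRationalCurve {r : ℂ} (hirr : Irreducible (C r * K.conicForm)) :
    IsRationalCurve (C r * K.conicForm) := by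
  have hX : ∀ i : Fin 2, (X i : MvPolynomial (Fin 2) ℂ).IsHomogeneous 1 := isHomogeneous_X ℂ
  have hs : (X 0 + X 1 : MvPolynomial (Fin 2) ℂ) ≠ 0 := ne_zero_of_eval ![1, 0] (by simp)
  refine K.isRationalCurve (F₀ := C r * (X 0 * X 1 - X 0 * X 2 - X 1 * X 2)) hirr ?_
    (d := 2) (e := 1) ![X 1 * (X 0 + X 1), X 0 * (X 0 + X 1), X 0 * X 1] ![X 1, X 0] ?_ ?_ ?_ ?_ ?_
  · simp [conicForm, algebraMap_eq]
  · intro i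
    fin_cases i
    exacts [(hX 1).mul ((hX 0).add (hX 1)), (hX 0).mul ((hX 0).add (hX 1)), (hX 0).mul (hX 1)]
  · intro j
    fin_cases j
    exacts [isHomogeneous_X _ _, isHomogeneous_X _ _]
  · simp only [map_mul, map_sub, aeval_X, aeval_C, algebraMap_eq, Matrix.cons_val_zero,
      Matrix.cons_val_one, Matrix.cons_val]
    ring
  · simp [hs]
  · simp only [aeval_X, Matrix.cons_val_zero, Matrix.cons_val_one]
    ring

lemma quarticForm_isHomogeneous (a c : ℂ) : (K.quarticForm a c).IsHomogeneous 4 := by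
  have hX := K.coord_isHomogeneous
  have hC : (C (2 : ℂ) : Form) = 2 := map_ofNat C 2
  have := isHomogeneous_C_mul ((((((hX 1).mul (hX 2)).add ((hX 0).mul (hX 2))).sub
    (isHomogeneous_C_mul ((hX 0).mul (hX 1)) 2)).pow 2).sub (isHomogeneous_C_mul
      (((K.coord_sub_isHomogeneous 1 2).mul (K.coord_sub_isHomogeneous 0 2)).mul
        (((hX 0).add (hX 1)).pow 2)) c)) a
  rw [hC] at this
  exact this

/-- An irreducible quartic of the family is not one of its three degenerate members. -/
lemma quarticForm_ne {a c : ℂ} (hirr : Irreducible (K.quarticForm a c)) :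
    a ≠ 0 ∧ c ≠ 0 ∧ c ≠ 1 := by
  have hX := K.coord_isHomogeneous
  refine ⟨?_, ?_, ?_⟩ <;> rintro rfl
  · exact hirr.ne_zero (by simp [quarticForm, quartic])
  · have hQ := (((hX 1).mul (hX 2)).add ((hX 0).mul (hX 2))).sub
      (isHomogeneous_C_mul ((hX 0).mul (hX 1)) 2)
    refine not_dvd_of_irreducible (quarticForm_isHomogeneous a 0) hirr hQ two_ne_zero (by norm_num)
      ⟨C a * (K.coord 1 * K.coord 2 + K.coord 0 * K.coord 2 - C 2 * (K.coord 0 * K.coord 1)), ?_⟩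
    rw [show (C (2 : ℂ) : Form) = 2 from map_ofNat C 2, quarticForm, quartic, C_0]
    ring
  · refine not_dvd_of_irreducible (quarticForm_isHomogeneous a 1) hirr
      (K.coord_sub_isHomogeneous 0 1) one_ne_zero (by norm_num)
      ⟨C a * ((K.coord 0 - K.coord 1) * (K.coord 2 * (K.coord 0 + K.coord 1) -
        K.coord 0 * K.coord 1)), ?_⟩
    rw [quarticForm, quartic, C_1]
    ring

variable {p : Fin 3 → Point} {L : Fin 3 → Line} {p₄ : Point} {S : FrameSystem p L p₄}

/-- The conic is determined by the three points and two tangent lines: it is the member through the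
third base point of the pencil of conics that are tangent at the other two. -/
lemma Adapted.exists_conic (hK : K.Adapted S) {m₀ m₁ : ℂ} (hm₀ : m₀ ≠ 0) (hm₁ : m₁ ≠ 0)
    (hL₀ : (L 0).rep = m₀ • (K.ξ 1 - K.ξ 2)) (hL₁ : (L 1).rep = m₁ • (K.ξ 2 - K.ξ 0)) {D : Form}
    (h : S.HasType D 2 (fun _ => 1) 0) : ∃ r : ℂ, D = C r * K.conicForm := by
  have hord₀ := coord_sub_ordGE (S := S) hm₀ hL₀
  have hord₁ := coord_sub_ordGE (S := S) hm₁ hL₁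
  have hX := K.coord_isHomogeneous
  have hz₀ : (S.A (some 0)).OrdGE 2 (K.coord 2 ^ 2) :=
    (hK.ordGE_coord (by decide)).pow 2
  have hz₁ : (S.A (some 1)).OrdGE 2 (K.coord 2 ^ 2) :=
    (hK.ordGE_coord (by decide)).pow 2
  obtain ⟨r, s, hD⟩ := h.exists_pencil (![1, 1, 0]) (b' := 0)
    (G₁ := (K.coord 1 - K.coord 2) * (K.coord 2 - K.coord 0)) (G₂ := K.coord 2 ^ 2)
    ((K.coord_sub_isHomogeneous 1 2).mul (K.coord_sub_isHomogeneous 2 0)) ((hX 2).pow 2)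
    (fun k => by
      fin_cases k
      exacts [hord₀.mul_right _, hord₁.mul_left _, WeightedFrame.ordGE_zero _ _])
    (fun k => by
      fin_cases k
      exacts [hz₀, hz₁, WeightedFrame.ordGE_zero _ _])
    (WeightedFrame.ordGE_zero _ _) (WeightedFrame.ordGE_zero _ _) (by simp [Fin.sum_univ_three])
    (fun r s h0 => by
      have h1 := congrArg (eval (K.vec ![1, 1, 0])) h0
      have h2 := congrArg (eval (K.vec ![1, 0, 1])) h0
      simp [eval_vec_coord] at h1 h2
      exact ⟨h1, h2⟩)
  have h2 : (S.A (some 2)).OrdGE 1 D := (h.ord 2).mono (by norm_num)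
  obtain ⟨c, hc, hv⟩ := hK.smul 2
  rw [WeightedFrame.ordGE_one_iff, hv, ← vec_two, eval_smul_of_isHomogeneous h.hom, hD] at h2
  have hrs : r = s := by
    simp [eval_vec_coord, hc] at h2
    linear_combination -h2
  refine ⟨-r, ?_⟩
  rw [hD, ← hrs, conicForm, C_neg]
  ring

/-- The third tangent line of the conic. -/
lemma Adapted.exists_rep_two (hK : K.Adapted S) {r : ℂ}
    (h : IsTangentAt (C r * K.conicForm) (p 2) (L 2)) :
    ∃ m : ℂ, m ≠ 0 ∧ (L 2).rep = m • (K.ξ 0 + K.ξ 1) := by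
  obtain ⟨-, c, hc, hd⟩ := h
  have hmem := hK.mem 2
  rw [Projectivization.submodule_eq, Submodule.mem_span_singleton] at hmem
  obtain ⟨t, ht⟩ := hmem
  have ht0 : t ≠ 0 := by
    rintro rfl
    have := K.dual 2 2
    rw [← ht] at this
    simp at this
  have hrep : ∀ i : Fin 3, i ≠ 2 → K.ξ i ⬝ᵥ (p 2).rep = 0 := fun i hi => by
    have := K.dual i 2
    rw [← ht, dotProduct_smul, if_neg hi, smul_eq_mul] at this
    exact (mul_eq_zero.mp this).resolve_left ht0
  have hrep' : ∀ i : Fin 3, i ≠ 2 → eval (p 2).rep (K.coord i) = 0 := fun i hi => by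
    rw [coord, eval_linForm, hrep i hi]
  have key : ∀ i, eval (p 2).rep (pderiv i (C r * K.conicForm)) =
      -(r * (K.ξ 2 ⬝ᵥ (p 2).rep)) * (K.ξ 0 i + K.ξ 1 i) := by
    intro i
    have hp : ∀ j, pderiv i (K.coord j) = C (K.ξ j i) := fun j => pderiv_linForm _ _
    have h2 : eval (p 2).rep (K.coord 2) = K.ξ 2 ⬝ᵥ (p 2).rep := by rw [coord, eval_linForm]
    simp only [conicForm, Derivation.leibniz, map_sub, pderiv_C, hp, smul_eq_mul, map_add, map_mul,
      eval_C, hrep' 0 (by decide), hrep' 1 (by decide), h2, map_zero]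
    ring
  have hL : (L 2).rep = (c⁻¹ * -(r * (K.ξ 2 ⬝ᵥ (p 2).rep))) • (K.ξ 0 + K.ξ 1) := by
    ext i
    have h1 := hd i
    rw [key i] at h1
    rw [Pi.smul_apply, Pi.add_apply, smul_eq_mul, mul_assoc, h1, inv_mul_cancel_left₀ hc]
  refine ⟨_, fun h0 => (L 2).rep_nonzero ?_, hL⟩
  rw [hL, h0, zero_smul]

/-- Each quartic with the given node, tacnode and tangent lines is in the family, because two such
quartics have intersection number `2 + 2 + 8 + 4 = 4 · 4` at the four points. -/
lemma Adapted.exists_quartic (hK : K.Adapted S) {m₀ m₁ m₂ : ℂ} (hm₀ : m₀ ≠ 0) (hm₁ : m₁ ≠ 0)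
    (hm₂ : m₂ ≠ 0)
    (hL₀ : (L 0).rep = m₀ • (K.ξ 1 - K.ξ 2)) (hL₁ : (L 1).rep = m₁ • (K.ξ 2 - K.ξ 0))
    (hL₂ : (L 2).rep = m₂ • (K.ξ 0 + K.ξ 1)) {D : Form}
    (h : S.HasType D 4 ![1, 1, 2] 2) : ∃ a c : ℂ, D = K.quarticForm a c := by
  have hord₀ := coord_sub_ordGE (S := S) hm₀ hL₀
  have hord₁ := coord_sub_ordGE (S := S) hm₁ hL₁
  have hord₂ : (S.A (some 2)).OrdGE 2 (K.coord 0 + K.coord 1) := by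
    rw [coord, coord, ← linForm_add]
    exact ordGE_two_of_rep_eq hm₂ hL₂
  have hX := K.coord_isHomogeneous
  -- the conic through the four points that is tangent to the tacnodal tangent
  set Q := K.coord 2 * (K.coord 0 + K.coord 1) - C 2 * (K.coord 0 * K.coord 1) with hQ
  have hQh : Q.IsHomogeneous 2 := ((hX 2).mul ((hX 0).add (hX 1))).sub
    (isHomogeneous_C_mul ((hX 0).mul (hX 1)) 2)
  have hQ₀ : (S.A (some 0)).OrdGE 1 Q := ((hK.ordGE_coord (by decide)).mul_right _).sub
    (((hK.ordGE_coord (by decide)).mul_left _).mul_left _)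
  have hQ₁ : (S.A (some 1)).OrdGE 1 Q := ((hK.ordGE_coord (by decide)).mul_right _).sub
    (((hK.ordGE_coord (by decide)).mul_right _).mul_left _)
  have hQ₂ : (S.A (some 2)).OrdGE 2 Q := (hord₂.mul_left _).sub
    (((hK.ordGE_coord (by decide)).mul (hK.ordGE_coord (by decide))).mul_left _)
  have hQ₄ : (S.A none).OrdGE 1 Q := by
    rw [WeightedFrame.ordGE_one_iff, hK.unit, ← vec_unit]
    simp [hQ, eval_vec_coord]
    norm_num
  have hC : (C (2 : ℂ) : Form) = 2 := map_ofNat C 2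
  obtain ⟨r, s, hD⟩ := h.exists_pencil (![1, 1, 2]) (b' := 2) (G₁ := Q ^ 2)
    (G₂ := (K.coord 1 - K.coord 2) * (K.coord 2 - K.coord 0) * (K.coord 0 + K.coord 1) ^ 2)
    (hQh.pow 2) (((K.coord_sub_isHomogeneous 1 2).mul (K.coord_sub_isHomogeneous 2 0)).mul
      (((hX 0).add (hX 1)).pow 2))
    (fun k => by
      fin_cases k
      · exact hQ₀.pow 2
      · exact hQ₁.pow 2
      · exact hQ₂.pow 2)
    (fun k => by
      fin_cases k
      · exact (hord₀.mul_right _).mul_right _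
      · exact (hord₁.mul_left _).mul_right _
      · exact (hord₂.pow 2).mul_left _)
    (hQ₄.pow 2) (((hK.ordGE_coord_sub 1 2).mul (hK.ordGE_coord_sub 2 0)).mul_right _)
    (by simp [Fin.sum_univ_three])
    (fun r s h0 => by
      have h1 := congrArg (eval (K.vec ![1, -1, 0])) h0
      have h2 := congrArg (eval (K.vec ![1, 1, 0])) h0
      simp [hQ, eval_vec_coord] at h1 h2
      subst h1
      norm_num at h2
      exact ⟨rfl, h2⟩)
  have hr : r ≠ 0 := by
    rintro rfl
    refine not_dvd_of_irreducible h.hom h.irr (K.coord_sub_isHomogeneous 1 2) one_ne_zero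
      (by norm_num) ⟨C s * ((K.coord 2 - K.coord 0) * (K.coord 0 + K.coord 1) ^ 2), ?_⟩
    rw [hD, C_0]
    ring
  refine ⟨r, s / r, ?_⟩
  have hrs : (C s : Form) = C r * C (s / r) := by rw [← C_mul, mul_div_cancel₀ _ hr]
  rw [hD, quarticForm, quartic, hQ, hrs, hC]
  ring

end CoordinateSystem

/-! ### The octics with a conic and a quartic component -/

section
variable {p : Fin 3 → Point} {L : Fin 3 → Line} {p₄ : Point} {S : FrameSystem p L p₄}
  {K : CoordinateSystem}

lemma IsTangentAt.C_mul {F : Form} {q : Point} {M : Line} (h : IsTangentAt F q M) {c : ℂ}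
    (hc : c ≠ 0) : IsTangentAt (C c * F) q M := by
  obtain ⟨h0, m, hm, hd⟩ := h
  refine ⟨by rw [PassesThrough, map_mul, show eval q.rep F = 0 from h0, mul_zero], c * m,
    mul_ne_zero hc hm, fun i => ?_⟩
  rw [pderiv_C_mul, map_mul, eval_C, hd, mul_assoc]

namespace CoordinateSystem

/-- The `[3;3]`-points of the sum of the quartic, the conic and the two lines. -/
lemma quartic_isNondegInfNearPoint {a c μ : ℂ} (ha : a ≠ 0) (hc : c ≠ 0) (hc1 : c ≠ 1) (hμ : μ ≠ 0)
    (hp : ∀ k, K.e k ∈ (p k).submodule) {m₀ m₁ m₂ : ℂ}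
    (hL₀ : (L 0).rep = m₀ • (K.ξ 1 - K.ξ 2)) (hL₁ : (L 1).rep = m₁ • (K.ξ 2 - K.ξ 0))
    (hL₂ : (L 2).rep = m₂ • (K.ξ 0 + K.ξ 1)) {F : Form}
    (hF : F = C μ * (K.quarticForm a c * K.residualForm)) (hred : ∀ k, IsReducedAt F (p k))
    (k : Fin 3) : IsNondegInfNearPoint 3 F (p k) (L k) := by
  -- the first two base points are interchanged by a symmetry of the configuration
  fin_cases k
  · exact quartic_isNondegInfNearPoint_zero ha hc hc1 hμ (hp 0) hL₀ hF (hred 0)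
  · rw [← quarticForm_perm, ← residualForm_perm] at hF
    have hL₁' : (L 1).rep =
        (-m₁) • ((K.perm (Equiv.swap 0 1)).ξ 1 - (K.perm (Equiv.swap 0 1)).ξ 2) := by
      rw [hL₁, neg_smul, ← smul_neg, neg_sub]; rfl
    exact quartic_isNondegInfNearPoint_zero (K := K.perm (Equiv.swap 0 1)) ha hc hc1 hμ (hp 1) hL₁'
      hF (hred 1)
  · exact (quartic_isNondegInfNearPoint_two ha hc hc1 hμ (hp 2) hL₂ hF (hred 2)).2

end CoordinateSystem

/-- The octics with components a conic and a quartic, with the indices of the `[3;3]`-points such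
that the tacnode of the quartic is the third one. -/
theorem conic_case {F : Form} (hF : F.IsHomogeneous 8) (h33 : ∀ i, IsReducedAt F (p i))
    (h4 : IsReducedAt F p₄) {E : Fin 4 → Form} (hprod : F = ∏ i, E i)
    (h0 : S.HasType (E 0) 4 ![1, 1, 2] 2) (h1 : S.HasType (E 1) 2 ![1, 1, 1] 0)
    (h2 : S.HasType (E 2) 1 ![1, 0, 0] 1) (h3 : S.HasType (E 3) 1 ![0, 1, 0] 1) :
    Squarefree F ∧ (∀ q, IsSingularAt F q → q = p₄ ∨ ∃ i, q = p i) ∧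
      IsConicConfiguration F p L p₄ ∧ (∀ i, IsNondegInfNearPoint 3 F (p i) (L i)) ∧
      IsOrdinaryPoint 4 F p₄ := by
  have htype : ∀ i, S.HasType (E i) ((![4, 2, 1, 1] : Fin 4 → ℕ) i)
      ((![![1, 1, 2], ![1, 1, 1], ![1, 0, 0], ![0, 1, 0]] : Fin 4 → Fin 3 → ℕ) i)
      ((![2, 0, 1, 1] : Fin 4 → ℕ) i) := by
    intro i; fin_cases i
    exacts [h0, h1, h2, h3]
  have h1' : S.HasType (E 1) 2 (fun _ => 1) 0 := by
    convert h1 using 1; ext i; fin_cases i <;> rfl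
  obtain ⟨c₂, hc₂, hE2⟩ := h2.line_eq (k := 0) le_rfl
  obtain ⟨c₃, hc₃, hE3⟩ := h3.line_eq (k := 1) le_rfl
  have hd0 : (L 0).rep ⬝ᵥ (S.A none).v = 0 := h2.dot_none_eq_zero (k := 0) le_rfl le_rfl
  have hd1 : (L 1).rep ⬝ᵥ (S.A none).v = 0 := h3.dot_none_eq_zero (k := 1) le_rfl le_rfl
  have hLI := h1.linearIndependent le_rfl (by simp [Fin.sum_univ_three])
  obtain ⟨K, hK⟩ := CoordinateSystem.exists_adapted hLI hd0 hd1
    (h2.dot_some_ne_zero (j := 1) (k := 0) le_rfl rfl)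
    (h2.dot_some_ne_zero (j := 2) (k := 0) le_rfl rfl)
    (h3.dot_some_ne_zero (j := 0) (k := 1) le_rfl rfl)
    (h3.dot_some_ne_zero (j := 2) (k := 1) le_rfl rfl)
  obtain ⟨m₀, hm₀, hL₀⟩ := K.eq_smul_sub (i := 1) (j := 2) (k := 0) (by decide) (by decide)
    (by decide) (L 0).rep_nonzero (hK.dot_e 0) (hK.unit ▸ hd0)
  obtain ⟨m₁, hm₁, hL₁⟩ := K.eq_smul_sub (i := 2) (j := 0) (k := 1) (by decide) (by decide)
    (by decide) (L 1).rep_nonzero (hK.dot_e 1) (hK.unit ▸ hd1)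
  obtain ⟨r, hE1⟩ := hK.exists_conic hm₀ hm₁ hL₀ hL₁ h1'
  have hr : r ≠ 0 := by rintro rfl; exact h1.irr.ne_zero (by rw [hE1, C_0, zero_mul])
  obtain ⟨m₂, hm₂, hL₂⟩ := hK.exists_rep_two (hE1 ▸ h1'.isTangentAt (k := 2) rfl)
  obtain ⟨a, c, hE0⟩ := hK.exists_quartic hm₀ hm₁ hm₂ hL₀ hL₁ hL₂ h0
  obtain ⟨ha, hc, hc1⟩ := K.quarticForm_ne (hE0 ▸ h0.irr)
  obtain ⟨κ, hκ⟩ : ∃ κ, κ = c₂ * c₃ := ⟨_, rfl⟩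
  have hκ0 : κ ≠ 0 := hκ ▸ mul_ne_zero hc₂ hc₃
  have hFD : F = E 0 * (C κ * E 1) * lineForm (L 0) * lineForm (L 1) := by
    rw [hprod, Fin.prod_univ_four, hE2, hE3, hκ, C_mul]; ring
  have e0 : lineForm (L 0) = C m₀ * (K.coord 1 - K.coord 2) :=
    CoordinateSystem.lineForm_eq_of_rep hL₀
  have e1 : lineForm (L 1) = C m₁ * (K.coord 2 - K.coord 0) :=
    CoordinateSystem.lineForm_eq_of_rep hL₁
  have hFt : F = C (κ * r * m₀ * m₁) * (K.quarticForm a c * K.residualForm) := by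
    rw [hFD, e0, e1, hE0, hE1, C_mul, C_mul, C_mul, CoordinateSystem.residualForm]
    ring
  have hμ : κ * r * m₀ * m₁ ≠ 0 := mul_ne_zero (mul_ne_zero (mul_ne_zero hκ0 hr) hm₀) hm₁
  have hconic : C κ * E 1 = C (κ * r) * K.conicForm := by rw [hE1, C_mul, mul_assoc]
  have hord := CoordinateSystem.quartic_isOrdinaryPoint ha hc hc1 hμ hK.mem_unit hFt h4
  have htac := CoordinateSystem.quartic_isNondegInfNearPoint_two ha hc hc1 hμ (hK.mem 2) hL₂ hFt
    (h33 2)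
  have hrat : IsRationalCurve (E 0) :=
    hE0 ▸ CoordinateSystem.quarticForm_isRationalCurve hc (hE0 ▸ h0.irr)
  have hrat2 : IsRationalCurve (C κ * E 1) := by
    have := irreducible_C_mul h1.irr hκ0
    rw [hconic] at this ⊢
    exact CoordinateSystem.conicForm_isRationalCurve this
  rw [← hE0] at hord htac
  refine ⟨FrameSystem.squarefree_of_components hprod (fun i => (htype i).irr) fun i => ?_,
    fun q hq => ?_, ⟨fun q => ⟨fun h => ?_, ?_⟩, E 0, C κ * E 1, h0.hom, hrat,
    isHomogeneous_C_mul h1.hom κ, hrat2, hFD, fun i => (h1'.isTangentAt rfl).C_mul hκ0, hord.1,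
    h0.isTangentAt (k := 0) rfl, h0.isTangentAt (k := 1) rfl, htac.1⟩,
    CoordinateSystem.quartic_isNondegInfNearPoint ha hc hc1 hμ hK.mem hL₀ hL₁ hL₂ hFt h33, hord.2⟩
  · fin_cases i
    exacts [⟨p₄, h4, h0.passesThrough_none one_le_two⟩,
      ⟨p 0, h33 0, h1.passesThrough (k := 0) le_rfl⟩, ⟨p₄, h4, h2.passesThrough_none le_rfl⟩,
      ⟨p₄, h4, h3.passesThrough_none le_rfl⟩]
  · refine FrameSystem.eq_of_isSingularAt hF hprod htype ?_ (by decide) (by decide) hq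
    have h23 := h2.not_dvd h3 (k := 0) le_rfl rfl
    have h32 := h3.not_dvd h2 (k := 1) le_rfl rfl
    intro i j hij
    by_cases hd : (![4, 2, 1, 1] : Fin 4 → ℕ) i = (![4, 2, 1, 1] : Fin 4 → ℕ) j
    · have hc : (i = 2 ∧ j = 3) ∨ (i = 3 ∧ j = 2) := by revert i j; decide
      rcases hc with ⟨rfl, rfl⟩ | ⟨rfl, rfl⟩
      exacts [h23, h32]
    · exact (htype i).not_dvd_of_degree_ne (htype j) hd
  · exact hK.eq_of_passesThrough hm₀ hm₁ hL₀ hL₁ h.1 h.2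
  · rintro rfl
    exact ⟨FrameSystem.passesThrough_lineForm hd0, FrameSystem.passesThrough_lineForm hd1⟩

/-! ### Exclusiveness of the two configurations -/

/-- Renumbering of the `[3;3]`-points. -/
def FrameSystem.perm (S : FrameSystem p L p₄) (σ : Equiv.Perm (Fin 3)) :
    FrameSystem (p ∘ σ) (L ∘ σ) p₄ where
  A t := S.A (t.map σ)
  p_none := S.p_none
  e_none := S.e_none
  p_some k := S.p_some (σ k)
  e_some k := S.e_some (σ k)
  dot_v k := S.dot_v (σ k)
  dot_u k := S.dot_u (σ k)
  inj := S.inj.comp (Option.map_injective σ.injective)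

lemma FrameSystem.HasType.perm {D : Form} {d b : ℕ} {a : Fin 3 → ℕ} (h : S.HasType D d a b)
    (σ : Equiv.Perm (Fin 3)) : (S.perm σ).HasType D d (a ∘ σ) b :=
  ⟨h.irr, h.hom, fun k => h.ord (σ k), fun k => h.coeff_ne (σ k), h.mult⟩

lemma FrameSystem.HasType.congr {D : Form} {d b d' b' : ℕ} {a a' : Fin 3 → ℕ}
    (h : S.HasType D d a b) (hd : d = d') (ha : ∀ k, a k = a' k) (hb : b = b') :
    S.HasType D d' a' b' := by
  obtain rfl := funext ha
  subst hd hb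
  exact h

/-- An octic that is a sum of curves of degree less than `5` has no irreducible quintic as a
component. -/
lemma not_isConicConfiguration {F : Form} (h : IsQuinticConfiguration F p L p₄)
    {p' : Fin 3 → Point} {L' : Fin 3 → Line} : ¬ IsConicConfiguration F p' L' p₄ := by
  rintro ⟨-, D₄, D₂, hD₄, hr₄, hD₂, hr₂, hF', -⟩
  obtain ⟨-, D₅, hD₅, hr₅, hF, -⟩ := h
  have hdvd : D₅ ∣ D₄ * D₂ * lineForm (L' 0) * lineForm (L' 1) := by
    rw [← hF', hF, mul_assoc, mul_assoc]
    exact dvd_mul_right _ _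
  have hline : ∀ k, ¬ D₅ ∣ lineForm (L' k) := fun k =>
    not_dvd_of_degree_lt hD₅ (linForm_isHomogeneous _) (linForm_ne_zero (L' k).rep_nonzero)
      (by norm_num)
  have hp := hr₅.1.prime
  rcases hp.dvd_or_dvd hdvd with hdvd | hdvd
  · rcases hp.dvd_or_dvd hdvd with hdvd | hdvd
    · rcases hp.dvd_or_dvd hdvd with hdvd | hdvd
      · exact not_dvd_of_degree_lt hD₅ hD₄ hr₄.1.ne_zero (by norm_num) hdvd
      · exact not_dvd_of_degree_lt hD₅ hD₂ hr₂.1.ne_zero (by norm_num) hdvd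
    · exact hline 0 hdvd
  · exact hline 1 hdvd

end

end PlaneCurve

end

theorem propositionA9
    (F : PlaneCurve.Form) (hF : F.IsHomogeneous 8)
    (p : Fin 3 → PlaneCurve.Point) (hp : Function.Injective p)
    (L : Fin 3 → PlaneCurve.Line)
    (h33 : ∀ i, PlaneCurve.IsInfNearPoint 3 F (p i) (L i))
    (p₄ : PlaneCurve.Point) (h4 : PlaneCurve.IsNFoldPoint 4 F p₄) :
    Squarefree F ∧
    (∃ G : Fin 4 → PlaneCurve.Form,
      (∀ j, (∃ d : ℕ, (G j).IsHomogeneous d) ∧ PlaneCurve.IsRationalCurve (G j)) ∧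
      F = ∏ j, G j) ∧
    Xor (PlaneCurve.IsQuinticConfiguration F p L p₄)
      (∃ σ : Equiv.Perm (Fin 3), PlaneCurve.IsConicConfiguration F (p ∘ σ) (L ∘ σ) p₄) ∧
    (∀ i, PlaneCurve.IsNondegInfNearPoint 3 F (p i) (L i)) ∧
    PlaneCurve.IsOrdinaryPoint 4 F p₄ ∧
    (∀ q : PlaneCurve.Point, PlaneCurve.IsSingularAt F q → q = p₄ ∨ ∃ i, q = p i) := by
  obtain ⟨S, hF0, hord, hcoeff, hloc, hmult⟩ :=
    PlaneCurve.FrameSystem.exists_frameSystem hF hp h33 h4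
  have hred : ∀ i, PlaneCurve.IsReducedAt F (p i) := fun i => (h33 i).1
  obtain ⟨r, D, d, b, a, hprod, htype, hd, ha, hb, hpair⟩ :=
    S.exists_components hF hF0 hred h4.1 hord hcoeff hloc hmult
  have hlinehom : ∀ k, (PlaneCurve.lineForm (L k)).IsHomogeneous 1 := fun k =>
    PlaneCurve.linForm_isHomogeneous _
  have hlinerat : ∀ k, PlaneCurve.IsRationalCurve (PlaneCurve.lineForm (L k)) := fun k =>
    PlaneCurve.lineForm_isRationalCurve _
  rcases PlaneCurve.numerical_classification d b a
    (fun i => Nat.one_le_iff_ne_zero.mpr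
      (PlaneCurve.degree_ne_zero_of_irreducible (htype i).hom (htype i).irr))
    hd ha hb (fun i => (htype i).genus) hpair with ⟨e, ⟨hd0, ha0, hb0⟩, hline⟩ |
      ⟨e, σ, ⟨hd0, ha00, ha01, ha02, hb0⟩, ⟨hd1, ha1, hb1⟩, ⟨hd2, ha2, hb2⟩, hd3, ha3, hb3⟩ |
      ⟨q, l, ⟨hdq, haq, hbq⟩, hl⟩
  · obtain ⟨hsq, hsing, hconf, hnd, hop⟩ := PlaneCurve.quintic_case
      (S := S) (E := fun i => D (e i)) hF hred
      h4.1 (hprod.trans (e.prod_comp D).symm) ((htype _).congr hd0 ha0 hb0)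
      (fun k => (htype _).congr (hline k).1 (hline k).2.1 (hline k).2.2)
    refine ⟨hsq, ?_, Or.inl ⟨hconf, ?_⟩, hnd, hop, hsing⟩
    · obtain ⟨-, D₅, hD₅, hr₅, hFD, -⟩ := hconf
      refine ⟨![D₅, PlaneCurve.lineForm (L 0), PlaneCurve.lineForm (L 1),
        PlaneCurve.lineForm (L 2)], fun j => ?_, ?_⟩
      · fin_cases j
        exacts [⟨⟨5, hD₅⟩, hr₅⟩, ⟨⟨1, hlinehom 0⟩, hlinerat 0⟩, ⟨⟨1, hlinehom 1⟩, hlinerat 1⟩,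
          ⟨⟨1, hlinehom 2⟩, hlinerat 2⟩]
      · rw [Fin.prod_univ_four]; exact hFD
    · rintro ⟨σ, hσ⟩
      exact PlaneCurve.not_isConicConfiguration hconf hσ
  · obtain ⟨hsq, hsing, hconf, hnd, hop⟩ := PlaneCurve.conic_case
      (S := S.perm σ) (E := fun i => D (e i)) hF
      (fun i => hred (σ i)) h4.1 (hprod.trans (e.prod_comp D).symm)
      (((htype _).perm σ).congr hd0 (by
        intro k; fin_cases k
        exacts [ha00, ha01, ha02]) hb0)
      (((htype _).perm σ).congr hd1 (by
        intro k; fin_cases k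
        exacts [ha1 _, ha1 _, ha1 _]) hb1)
      (((htype _).perm σ).congr hd2 (by
        intro k; rw [Function.comp_apply, ha2]; fin_cases k <;> simp) hb2)
      (((htype _).perm σ).congr hd3 (by
        intro k; rw [Function.comp_apply, ha3]; fin_cases k <;> simp) hb3)
    refine ⟨hsq, ?_, Or.inr ⟨⟨σ, hconf⟩, fun h => PlaneCurve.not_isConicConfiguration h hconf⟩,
      fun i => ?_, hop, fun x hx => ?_⟩
    · obtain ⟨-, D₄, D₂, hD₄, hr₄, hD₂, hr₂, hFD, -⟩ := hconf
      refine ⟨![D₄, D₂, PlaneCurve.lineForm (L (σ 0)), PlaneCurve.lineForm (L (σ 1))],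
        fun j => ?_, ?_⟩
      · fin_cases j
        exacts [⟨⟨4, hD₄⟩, hr₄⟩, ⟨⟨2, hD₂⟩, hr₂⟩, ⟨⟨1, hlinehom _⟩, hlinerat _⟩,
          ⟨⟨1, hlinehom _⟩, hlinerat _⟩]
      · rw [Fin.prod_univ_four]; exact hFD
    · simpa using hnd (σ.symm i)
    · rcases hsing x hx with h | ⟨i, h⟩
      exacts [Or.inl h, Or.inr ⟨σ i, h⟩]
  -- a conic with its tangent lines at three points, all through the quadruple point
  · refine absurd (fun k => ?_) (((htype q).congr hdq haq hbq).not_concurrent fun _ => rfl)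
    obtain ⟨hdl, hal, hbl⟩ := hl k
    exact ((htype (l k)).congr hdl hal hbl).dot_none_eq_zero (k := k) (by simp) le_rfl
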